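/- **Lemma 6.2.** Let $k$ be a field and $G$ an abelian group. A *quantum variable* $x_i$ carries an element $g_i\in G$ and a character $\chi^{i}:G\to k^{*}$; put $p_{ij}=\chi^{i}(g_j)$ and, for words $u,v$, let $g_u$ and $\chi^u$ be the products of the $g_i$, respectively the $\chi^i$, over the letters of $u$, and $p(u,v)=\chi^u(g_v)$. For quantum variables $X$ and a set $F\subset k\langle X\rangle$, $\langle X\,\|\,F\rangle$ denotes the algebra generated by $G$ and $X$ with the relations of $G$, $x_ig=\chi^{i}(g)\,gx_i$ and $f=0$ for $f\in F$; for $F=\emptyset$ it is written $G\langle X\rangle$. A *character Hopf algebra structure* on such an algebra is a Hopf algebra structure with $\Delta(g)=g\otimes g$ $(g\in G)$ and $\Delta(x_i)=x_i\otimes 1+g_i\otimes x_i$. Let $H_1=\langle x_1,\dots,x_m\,\|\,F_1\rangle$ and $H_2=\langle x_{m+1},\dots,x_{m+n}\,\|\,F_2\rangle$ be character Hopf algebras, where all elements of $F_1$, $F_2$ are homogeneous for the grading of the free algebras by $G\times G^{*}$ in which a word $w$ has degree $(g_w,\chi^w)$. Let $\alpha_{ij}\in k$ $(i\le m<j)$,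 and suppose that $p_{ij}p_{ji}=1$ for $i\le m<j$, and that $\alpha_{ij}=0$ whenever $\chi^{i}\chi^{j}\ne 1$. Let $H=\langle x_1,\dots,x_{m+n}\,\|\,F_1,F_2,F_3\rangle$, where $F_3$ consists of the relations $$x_ix_j-p_{ij}x_jx_i=\alpha_{ij}(1-g_ig_j),\qquad i\le m<j .$$ Then $H$ has a (unique) character Hopf algebra structure. *Hard super-letters.* Order words lexicographically with $x_1>x_2>\cdots$, a proper beginning of a word being greater than the word. A non-empty word $u$ is standard if $vw>wv$ whenever $u=vw$ with $v,w$ non-empty. Standard nonassociative words are the variables and the $[[v][w]]$ with $[v],[w]$ standard nonassociative, $v>w$ standard, and $v_2\le w$ if $[v]=[[v_1][v_2]]$; a super-letter $[u]$ is such a word with the brackets read as $[u,v]=uv-p(u,v)vu$, and $[u]>[v]$ means $u>v$. A super-word is a product of super-letters; a $G$-super-word is a product of an element of $G$ and a super-word. Give the variables positive degrees $d_i$ in a linearly ordered abelian group $D$, and words and super-words the resulting degrees. A super-letter $[u]$ is *hard* in an algebra $A=\langle X\,\|\,\cdot\rangle$ if its value in $A$ is not a linear combination of super-words of the same degree in super-letters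 less than $[u]$ and of $G$-super-words of lesser degree. *Partial skew derivatives.* For $i\le m<j$ let $(\cdot)'_i:k\langle x_{m+1},\dots,x_{m+n}\rangle\to G\langle x_{m+1},\dots,x_{m+n}\rangle$ and $(\cdot)'_j:k\langle x_1,\dots,x_m\rangle\to G\langle x_1,\dots,x_m\rangle$ be the linear maps with $$(x_j)'_i=(x_i)'_j=\alpha_{ij}(1-g_ig_j),\quad (vw)'_i=(v)'_i\,w+p(x_i,v)\,v\,(w)'_i,\quad (uv)'_j=p(v,x_j)\,(u)'_j\,v+u\,(v)'_j$$ for words $u,v,w$ in the respective variables. **Claim.** The group $G$ embeds in $H$ and all super-letters hard in $H_1$ or in $H_2$ are hard in $H$, if and only if $(h)'_i=0$ in $H_2$ for all $i\le m$, $h\in F_2$, and $(f)'_j=0$ in $H_1$ for all $j>m$, $f\in F_1$. If these conditions on the derivatives are met, then multiplication $a\otimes b\mapsto ab$ induces an isomorphism $H_2\otimes_{k[G]}H_1\cong H$ of $k[G]$-bimodules, and the space spanned by the skew primitive elements of $H$ (the $a$ with $\Delta(a)=a\otimes 1+h\otimes a$ for some $h\in G$) equals the sum of the images in $H$ of the corresponding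 spaces for $H_1$ and $H_2$. -/

import Mathlib

open scoped TensorProduct

noncomputable section

/-- A family of quantum variables `x i` (`i : ι`): to each of them an element `g i` of the abelian
group `G` and a character `χ i` of `G` with values in the multiplicative group of `k` is attached. -/
structure QuantumVars (k G ι : Type*) [Field k] [CommGroup G] where
  g : ι → G
  χ : ι → (G →* kˣ)

namespace QuantumVars

section

variable {k G ι : Type*} [Field k] [CommGroup G] (V : QuantumVars k G ι)

/-- The element `g_u` of `G` attached to a word `u`. -/
def gWord (u : List ι) : G := (u.map V.g).prod

/-- The character `χ^u` attached to a word `u`. -/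
def χWord (u : List ι) : G →* kˣ := (u.map V.χ).prod

/-- The scalar `p(u, v) = χ^u(g_v)`. -/
def p (u v : List ι) : k := (V.χWord u (V.gWord v) : k)

/-- Homogeneous noncommutative polynomials for the grading of `k⟨X⟩` by `G × G^*`: linear
combinations of words `w` with one common value of `(g_w, χ^w)`. -/
def IsHomogeneous (f : FreeAlgebra k ι) : Prop :=
  ∃ (c : G) (ψ : G →* kˣ),
    f ∈ Submodule.span k
      {t | ∃ w : List ι, V.gWord w = c ∧ V.χWord w = ψ ∧ t = (w.map (FreeAlgebra.ι k)).prod}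

end

end QuantumVars

section Enveloping

variable {k G ι : Type*} [Field k] [CommGroup G]

/-- The defining relations of the algebra generated by `G` and the quantum variables:
the multiplication table of `G`, the commutation rule `x g = χ^x(g) g x`
(that is `g⁻¹ x g = χ^x(g) x`), and the additional relations `r = 0`, `r ∈ R`. -/
inductive EnvRel (V : QuantumVars k G ι) (R : Set (FreeAlgebra k (G ⊕ ι))) :
    FreeAlgebra k (G ⊕ ι) → FreeAlgebra k (G ⊕ ι) → Prop
  | one : EnvRel V R (FreeAlgebra.ι k (Sum.inl 1)) 1
  | mul (a b : G) : EnvRel V R (FreeAlgebra.ι k (Sum.inl (a * b)))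
      (FreeAlgebra.ι k (Sum.inl a) * FreeAlgebra.ι k (Sum.inl b))
  | skew (i : ι) (a : G) : EnvRel V R (FreeAlgebra.ι k (Sum.inr i) * FreeAlgebra.ι k (Sum.inl a))
      ((V.χ i a : k) • (FreeAlgebra.ι k (Sum.inl a) * FreeAlgebra.ι k (Sum.inr i)))
  | rel (r : FreeAlgebra k (G ⊕ ι)) (hr : r ∈ R) : EnvRel V R r 0

/-- The algebra generated by `G` and the quantum variables with additional relations `R`.
For `R = ∅` this is the free enveloping algebra `G⟨X⟩`. -/
def Env (V : QuantumVars k G ι) (R : Set (FreeAlgebra k (G ⊕ ι))) : Type _ := RingQuot (EnvRel V R)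

namespace Env

instance instRing (V : QuantumVars k G ι) (R : Set (FreeAlgebra k (G ⊕ ι))) : Ring (Env V R) :=
  inferInstanceAs (Ring (RingQuot (EnvRel V R)))

instance instAlgebra (V : QuantumVars k G ι) (R : Set (FreeAlgebra k (G ⊕ ι))) :
    Algebra k (Env V R) :=
  inferInstanceAs (Algebra k (RingQuot (EnvRel V R)))

/-- The projection from the free algebra on `G` and `X`. -/
def proj (V : QuantumVars k G ι) (R : Set (FreeAlgebra k (G ⊕ ι))) :
    FreeAlgebra k (G ⊕ ι) →ₐ[k] Env V R :=
  RingQuot.mkAlgHom k (EnvRel V R)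

/-- The image of a group element. -/
def grp (V : QuantumVars k G ι) (R : Set (FreeAlgebra k (G ⊕ ι))) (a : G) : Env V R :=
  proj V R (FreeAlgebra.ι k (Sum.inl a))

/-- The image of a quantum variable. -/
def gen (V : QuantumVars k G ι) (R : Set (FreeAlgebra k (G ⊕ ι))) (i : ι) : Env V R :=
  proj V R (FreeAlgebra.ι k (Sum.inr i))

variable (V : QuantumVars k G ι) (R : Set (FreeAlgebra k (G ⊕ ι)))

theorem grp_one : grp V R 1 = 1 := by
  have h := RingQuot.mkAlgHom_rel k (EnvRel.one (V := V) (R := R))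
  rw [map_one] at h
  exact h

theorem grp_mul (a b : G) : grp V R (a * b) = grp V R a * grp V R b := by
  have h := RingQuot.mkAlgHom_rel k (EnvRel.mul (V := V) (R := R) a b)
  rw [map_mul] at h
  exact h

theorem gen_mul_grp (i : ι) (a : G) :
    gen V R i * grp V R a = (V.χ i a : k) • (grp V R a * gen V R i) := by
  have h := RingQuot.mkAlgHom_rel k (EnvRel.skew (V := V) (R := R) i a)
  rw [map_mul, map_smul, map_mul] at h
  exact h

theorem proj_rel (r : FreeAlgebra k (G ⊕ ι)) (hr : r ∈ R) : proj V R r = 0 := by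
  have h := RingQuot.mkAlgHom_rel k (EnvRel.rel (V := V) (R := R) r hr)
  rw [map_zero] at h
  exact h

/-- A renaming `φ` of the variables that respects the characters and carries the relations `R` to
relations that hold in `Env V' R'` induces a homomorphism `x i ↦ x (φ i)`, `g ↦ g`. -/
def map {κ : Type*} {V : QuantumVars k G ι} {V' : QuantumVars k G κ}
    {R : Set (FreeAlgebra k (G ⊕ ι))} {R' : Set (FreeAlgebra k (G ⊕ κ))} (φ : ι → κ)
    (hχ : ∀ i, V'.χ (φ i) = V.χ i)
    (hR : ∀ r ∈ R, FreeAlgebra.lift k (Sum.elim (grp V' R') (fun i => gen V' R' (φ i))) r = 0) :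
    Env V R →ₐ[k] Env V' R' :=
  RingQuot.liftAlgHom k
    ⟨FreeAlgebra.lift k (Sum.elim (grp V' R') (fun i => gen V' R' (φ i))), by
      intro a b h
      cases h with
      | one => simp [grp_one]
      | mul a b => simp [grp_mul]
      | skew i a => simp [gen_mul_grp, hχ]
      | rel r hr => rw [hR _ hr, map_zero]⟩

end Env

/-- Noncommutative polynomials in the quantum variables, inside the free algebra on `G` and `X`. -/
def polyEmb (k G ι : Type*) [Field k] : FreeAlgebra k ι →ₐ[k] FreeAlgebra k (G ⊕ ι) :=
  FreeAlgebra.lift k (fun i => FreeAlgebra.ι k (Sum.inr i))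

/-- The algebra `⟨X ‖ F⟩` defined by the quantum variables `X` and the relations `f = 0`, `f ∈ F`,
where `F` is a set of noncommutative polynomials (the group `G` being part of the generators). -/
abbrev Quant (V : QuantumVars k G ι) (F : Set (FreeAlgebra k ι)) : Type _ :=
  Env V (polyEmb k G ι '' F)

/-- The free enveloping algebra `G⟨X⟩`. -/
abbrev FreeEnv (V : QuantumVars k G ι) : Type _ := Env V ∅

/-- The projection of the free enveloping algebra. -/
def FreeEnv.toEnv (V : QuantumVars k G ι) (R : Set (FreeAlgebra k (G ⊕ ι))) :
    FreeEnv V →ₐ[k] Env V R :=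
  Env.map id (fun _ => rfl) (fun _ hr => absurd hr (Set.notMem_empty _))

/-- A structure of character Hopf algebra on `Env V R` for which the elements of `G` are
group-like and the generators satisfy `Δ(x) = x ⊗ 1 + g_x ⊗ x`. (These values on the generators
determine the whole structure.) -/
structure CharHopf (V : QuantumVars k G ι) (R : Set (FreeAlgebra k (G ⊕ ι))) where
  comul : Env V R →ₐ[k] Env V R ⊗[k] Env V R
  counit : Env V R →ₐ[k] k
  antipode : Env V R →ₗ[k] Env V R
  coassoc : (TensorProduct.assoc k (Env V R) (Env V R) (Env V R)).toLinearMap ∘ₗ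
      comul.toLinearMap.rTensor (Env V R) ∘ₗ comul.toLinearMap =
    comul.toLinearMap.lTensor (Env V R) ∘ₗ comul.toLinearMap
  rTensor_counit_comul : ∀ a, counit.toLinearMap.rTensor (Env V R) (comul a) = 1 ⊗ₜ[k] a
  lTensor_counit_comul : ∀ a, counit.toLinearMap.lTensor (Env V R) (comul a) = a ⊗ₜ[k] 1
  mul_antipode_rTensor_comul : ∀ a, LinearMap.mul' k (Env V R)
    (antipode.rTensor (Env V R) (comul a)) = algebraMap k (Env V R) (counit a)
  mul_antipode_lTensor_comul : ∀ a, LinearMap.mul' k (Env V R)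
    (antipode.lTensor (Env V R) (comul a)) = algebraMap k (Env V R) (counit a)
  comul_grp : ∀ a, comul (Env.grp V R a) = Env.grp V R a ⊗ₜ[k] Env.grp V R a
  comul_gen : ∀ i, comul (Env.gen V R i) =
    Env.gen V R i ⊗ₜ[k] 1 + Env.grp V R (V.g i) ⊗ₜ[k] Env.gen V R i

/-- The space generated by the skew primitive elements, i.e. by the elements `a` such that
`Δ(a) = a ⊗ 1 + h ⊗ a` for some `h ∈ G`. -/
def CharHopf.skewPrim {V : QuantumVars k G ι} {R : Set (FreeAlgebra k (G ⊕ ι))}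
    (S : CharHopf V R) : Submodule k (Env V R) :=
  Submodule.span k {a | ∃ h : G, S.comul a = a ⊗ₜ[k] 1 + Env.grp V R h ⊗ₜ[k] a}

end Enveloping

section SuperLetters

variable {ι : Type*} [LinearOrder ι]

/-- The lexicographic order `u > v` on words, for the order `x₁ > x₂ > ⋯` of the letters (a letter
with a smaller index is greater) and with a proper beginning of a word greater than the word
itself. In terms of lists of indices this is the dictionary order read backwards. -/
def WordGT (u v : List ι) : Prop := List.Lex (· < ·) u v

/-- Standard words: `u` is non-empty and `vw > wv` whenever `u = vw` with non-empty `v`, `w`. -/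
def IsStandard (u : List ι) : Prop :=
  u ≠ [] ∧ ∀ v w : List ι, v ≠ [] → w ≠ [] → u = v ++ w → WordGT (v ++ w) (w ++ v)

/-- The word obtained from a nonassociative word by dropping the brackets. -/
def FreeMagma.word {ι : Type*} : FreeMagma ι → List ι
  | .of i => [i]
  | .mul a b => FreeMagma.word a ++ FreeMagma.word b

/-- Standard nonassociative words: the variables, and the `[[v][w]]` with `[v]`, `[w]` standard
nonassociative and `v > w` standard such that `v₂ ≤ w` if `[v] = [[v₁][v₂]]`. -/
inductive IsSuperLetter : FreeMagma ι → Prop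
  | of (i : ι) : IsSuperLetter (.of i)
  | mul (a b : FreeMagma ι) (ha : IsSuperLetter a) (hb : IsSuperLetter b)
      (hsa : IsStandard a.word) (hsb : IsStandard b.word) (hab : WordGT a.word b.word)
      (h : ∀ a₁ a₂, a = .mul a₁ a₂ → ¬ WordGT a₂.word b.word) : IsSuperLetter (.mul a b)

variable {k G : Type*} [Field k] [CommGroup G]

/-- The value in `Env V R` of a nonassociative word, the brackets being the skew commutators
`[u, v] = u v - p(u, v) v u`. -/
def superValue (V : QuantumVars k G ι) (R : Set (FreeAlgebra k (G ⊕ ι))) :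
    FreeMagma ι → Env V R
  | .of i => Env.gen V R i
  | .mul a b => superValue V R a * superValue V R b -
      V.p a.word b.word • (superValue V R b * superValue V R a)

/-- The value of a super-word, i.e. of a word in super-letters. -/
def superWordValue (V : QuantumVars k G ι) (R : Set (FreeAlgebra k (G ⊕ ι)))
    (W : List (FreeMagma ι)) : Env V R :=
  (W.map (superValue V R)).prod

/-- The degree of a word, when `x i` has degree `d i`. -/
def wordDeg {D : Type*} [AddCommGroup D] (d : ι → D) (u : List ι) : D := (u.map d).sum

/-- The degree of a super-word. -/
def superWordDeg {D : Type*} [AddCommGroup D] (d : ι → D) (W : List (FreeMagma ι)) : D :=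
  (W.map (fun a => wordDeg d a.word)).sum

/-- `[u]` is a hard super-letter in `Env V R`: its value is not a linear combination of values of
super-words of the same degree in super-letters less than `[u]` and of `G`-super-words of a lesser
degree. -/
def IsHard {D : Type*} [AddCommGroup D] [LinearOrder D] (V : QuantumVars k G ι)
    (R : Set (FreeAlgebra k (G ⊕ ι))) (d : ι → D) (u : FreeMagma ι) : Prop :=
  IsSuperLetter u ∧ superValue V R u ∉ Submodule.span k
    ({t | ∃ W : List (FreeMagma ι), (∀ a ∈ W, IsSuperLetter a ∧ WordGT u.word a.word) ∧
        superWordDeg d W = wordDeg d u.word ∧ t = superWordValue V R W} ∪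
     {t | ∃ (h : G) (W : List (FreeMagma ι)), (∀ a ∈ W, IsSuperLetter a) ∧
        superWordDeg d W < wordDeg d u.word ∧ t = Env.grp V R h * superWordValue V R W})

end SuperLetters

section Glueing

variable {k G ι₁ ι₂ : Type*} [Field k] [CommGroup G]

/-- The union of two families of quantum variables, those of the first one coming first. -/
def glueVars (V₁ : QuantumVars k G ι₁) (V₂ : QuantumVars k G ι₂) : QuantumVars k G (ι₁ ⊕ₗ ι₂) where
  g := fun i => Sum.elim V₁.g V₂.g (ofLex i)
  χ := fun i => Sum.elim V₁.χ V₂.χ (ofLex i)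

/-- The relations of the glued algebra: `F₁`, `F₂`, and
`x i * x j - p(x i, x j) x j * x i = α i j (1 - g i g j)` for `i` in the first and `j` in the
second family. -/
def glueRel (V₁ : QuantumVars k G ι₁) (V₂ : QuantumVars k G ι₂) (F₁ : Set (FreeAlgebra k ι₁))
    (F₂ : Set (FreeAlgebra k ι₂)) (α : ι₁ → ι₂ → k) : Set (FreeAlgebra k (G ⊕ (ι₁ ⊕ₗ ι₂))) :=
  {r | ∃ f ∈ F₁, r = FreeAlgebra.lift k (fun i => FreeAlgebra.ι k (Sum.inr (Sum.inlₗ i))) f} ∪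
  {r | ∃ f ∈ F₂, r = FreeAlgebra.lift k (fun j => FreeAlgebra.ι k (Sum.inr (Sum.inrₗ j))) f} ∪
  {r | ∃ i j, r =
    FreeAlgebra.ι k (Sum.inr (Sum.inlₗ i)) * FreeAlgebra.ι k (Sum.inr (Sum.inrₗ j)) -
      (V₁.χ i (V₂.g j) : k) •
        (FreeAlgebra.ι k (Sum.inr (Sum.inrₗ j)) * FreeAlgebra.ι k (Sum.inr (Sum.inlₗ i))) -
      α i j • (1 - FreeAlgebra.ι k (Sum.inl (V₁.g i * V₂.g j)))}

/-- The glued algebra `H`. -/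
abbrev Glue (V₁ : QuantumVars k G ι₁) (V₂ : QuantumVars k G ι₂) (F₁ : Set (FreeAlgebra k ι₁))
    (F₂ : Set (FreeAlgebra k ι₂)) (α : ι₁ → ι₂ → k) : Type _ :=
  Env (glueVars V₁ V₂) (glueRel V₁ V₂ F₁ F₂ α)

variable (V₁ : QuantumVars k G ι₁) (V₂ : QuantumVars k G ι₂) (F₁ : Set (FreeAlgebra k ι₁))
    (F₂ : Set (FreeAlgebra k ι₂)) (α : ι₁ → ι₂ → k)

/-- The natural homomorphism from the first algebra to the glued one. -/
def glueInl : Quant V₁ F₁ →ₐ[k] Glue V₁ V₂ F₁ F₂ α :=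
  Env.map Sum.inlₗ (fun _ => rfl) (by
    rintro _ ⟨f, hf, rfl⟩
    have h := Env.proj_rel (glueVars V₁ V₂) (glueRel V₁ V₂ F₁ F₂ α) _ (Or.inl (Or.inl ⟨f, hf, rfl⟩))
    rw [← h]
    simp only [polyEmb, ← AlgHom.comp_apply]
    congr 1
    ext i
    simp [Env.gen])

/-- The natural homomorphism from the second algebra to the glued one. -/
def glueInr : Quant V₂ F₂ →ₐ[k] Glue V₁ V₂ F₁ F₂ α :=
  Env.map Sum.inrₗ (fun _ => rfl) (by
    rintro _ ⟨f, hf, rfl⟩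
    have h := Env.proj_rel (glueVars V₁ V₂) (glueRel V₁ V₂ F₁ F₂ α) _ (Or.inl (Or.inr ⟨f, hf, rfl⟩))
    rw [← h]
    simp only [polyEmb, ← AlgHom.comp_apply]
    congr 1
    ext i
    simp [Env.gen])

/-- The partial skew derivative of a word in the second family with respect to `x i`, `i` in the
first family: `(x j)'ᵢ = α i j (1 - g i g j)` and `(x j · w)'ᵢ = (x j)'ᵢ w + p(x i, x j) x j (w)'ᵢ`. -/
def leftDerWord (i : ι₁) : List ι₂ → FreeEnv V₂
  | [] => 0
  | j :: w => α i j • (1 - Env.grp V₂ ∅ (V₁.g i * V₂.g j)) * (w.map (Env.gen V₂ ∅)).prod +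
      (V₁.χ i (V₂.g j) : k) • (Env.gen V₂ ∅ j * leftDerWord i w)

/-- The partial skew derivative of a word in the first family with respect to `x j`, `j` in the
second family: `(x i)'ⱼ = α i j (1 - g i g j)` and
`(x i · w)'ⱼ = p(w, x j) (x i)'ⱼ w + x i (w)'ⱼ`. -/
def rightDerWord (j : ι₂) : List ι₁ → FreeEnv V₁
  | [] => 0
  | i :: w => (V₁.χWord w (V₂.g j) : k) •
        (α i j • (1 - Env.grp V₁ ∅ (V₁.g i * V₂.g j)) * (w.map (Env.gen V₁ ∅)).prod) +
      Env.gen V₁ ∅ i * rightDerWord j w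

/-- The linear extension of `leftDerWord` to noncommutative polynomials. -/
def leftDer (i : ι₁) : FreeAlgebra k ι₂ →ₗ[k] FreeEnv V₂ :=
  (FreeAlgebra.basisFreeMonoid k ι₂).constr k
    (fun w => leftDerWord V₁ V₂ α i (FreeMonoid.toList w))

/-- The linear extension of `rightDerWord` to noncommutative polynomials. -/
def rightDer (j : ι₂) : FreeAlgebra k ι₁ →ₗ[k] FreeEnv V₁ :=
  (FreeAlgebra.basisFreeMonoid k ι₁).constr k
    (fun w => rightDerWord V₁ V₂ α j (FreeMonoid.toList w))

/-- All partial skew derivatives of the defining relations vanish: `(h)'ᵢ = 0` in the second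
algebra for `h ∈ F₂`, and `(f)'ⱼ = 0` in the first algebra for `f ∈ F₁`. -/
def DerivativesVanish : Prop :=
  (∀ i, ∀ h ∈ F₂, FreeEnv.toEnv V₂ (polyEmb k G ι₂ '' F₂) (leftDer V₁ V₂ α i h) = 0) ∧
  (∀ j, ∀ f ∈ F₁, FreeEnv.toEnv V₁ (polyEmb k G ι₁ '' F₁) (rightDer V₁ V₂ α j f) = 0)

end Glueing

section Balanced

variable {k G ι₁ ι₂ : Type*} [Field k] [CommGroup G]
  (V₁ : QuantumVars k G ι₁) (V₂ : QuantumVars k G ι₂)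
  (R₁ : Set (FreeAlgebra k (G ⊕ ι₁))) (R₂ : Set (FreeAlgebra k (G ⊕ ι₂)))

/-- The subspace of `A₂ ⊗ A₁` spanned by the `a g ⊗ b - a ⊗ g b`, `g ∈ G`. -/
def balancedRel : Submodule k (Env V₂ R₂ ⊗[k] Env V₁ R₁) :=
  Submodule.span k {t | ∃ (a : Env V₂ R₂) (g : G) (b : Env V₁ R₁),
    t = (a * Env.grp V₂ R₂ g) ⊗ₜ[k] b - a ⊗ₜ[k] (Env.grp V₁ R₁ g * b)}

/-- The tensor product `A₂ ⊗_{k[G]} A₁` of the bimodules `A₂`, `A₁` over the group algebra. -/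
abbrev BalancedTensor : Type _ := (Env V₂ R₂ ⊗[k] Env V₁ R₁) ⧸ balancedRel V₁ V₂ R₁ R₂

namespace BalancedTensor

/-- The class of `a ⊗ b`. -/
def tmul (a : Env V₂ R₂) (b : Env V₁ R₁) : BalancedTensor V₁ V₂ R₁ R₂ :=
  Submodule.Quotient.mk (a ⊗ₜ[k] b)

/-- The left action of `g ∈ G`: `g (a ⊗ b) = g a ⊗ b`. -/
def lact (g : G) : BalancedTensor V₁ V₂ R₁ R₂ →ₗ[k] BalancedTensor V₁ V₂ R₁ R₂ :=
  Submodule.mapQ _ _ ((LinearMap.mulLeft k (Env.grp V₂ R₂ g)).rTensor (Env V₁ R₁)) (by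
    rw [balancedRel, Submodule.span_le]
    rintro _ ⟨a, h, b, rfl⟩
    refine Submodule.subset_span ⟨Env.grp V₂ R₂ g * a, h, b, ?_⟩
    simp [mul_assoc])

/-- The right action of `g ∈ G`: `(a ⊗ b) g = a ⊗ b g`. -/
def ract (g : G) : BalancedTensor V₁ V₂ R₁ R₂ →ₗ[k] BalancedTensor V₁ V₂ R₁ R₂ :=
  Submodule.mapQ _ _ ((LinearMap.mulRight k (Env.grp V₁ R₁ g)).lTensor (Env V₂ R₂)) (by
    rw [balancedRel, Submodule.span_le]
    rintro _ ⟨a, h, b, rfl⟩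
    refine Submodule.subset_span ⟨a, h, b * Env.grp V₁ R₁ g, ?_⟩
    simp [mul_assoc])

end BalancedTensor

end Balanced

end

/-! The Hopf structure maps of H are prescribed on generators. They respect F₁ and F₂ because there
they factor through H₁ and H₂, and they respect F₃ because p_ij p_ji = 1 makes the mixed terms of Δ
cancel (`Glue.charHopf`).

Embedding of G implies vanishing derivatives. Let f be a polynomial that is zero in H₁. The
relations F₃ give f x_j = x_j (g_j⁻¹ f g_j) + f' in H, where f' is the derivative for x_j, so f'
becomes 0 in H. Nothing is known yet about injectivity of H₁ → H, but k[G] → H is injective, since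
distinct group-like elements are independent. So it suffices to place f' in k[G]. Let c be the
functional w a ↦ χ^j(a)⁻¹ c_w on G⟨X⟩, with c_w = α_ij for w = x_i and c_w = 0 for all other words.
Then f' = (c ⊗ id)Δ(f) - (id ⊗ c)Δ(f) g_j (`rightDerWord_eq`), which would vanish in H₁ if c
descended to H₁. If c agrees with a functional on H₁ for words shorter than r, then for f of length
at most r the derivative equals the sum of the f_w c_w (1 - g_w g_j), f_w being the coefficients of
f (`toEnv_rightDer_eq`). Its vanishing in k[G] forces c(f) = 0, once the irrelevant α_ij with g_i
g_j = 1 are replaced by 0, so c descends on words of length r too, and the induction continues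
(`toEnv_rightDer_eq_zero`). Left derivatives reduce to right ones by exchanging the families, using
homogeneity.

Vanishing derivatives imply the rest. The derivatives descend to skew derivations, realised as the
corner entries of triangular 2 × 2 representations of H₁ and H₂. By means of them H acts on H₂
⊗_{k[G]} H₁ through x_i (a ⊗ b) = D_i(a) ⊗ b + σ_i(a) ⊗ x_i b. Acting on 1 ⊗ 1 inverts
multiplication, whence the isomorphism (`Glue.mulEquiv`). It yields linear retractions of H onto H₁
and H₂ that kill the variables of the other family (`fstProj`, `sndProj`). Sorting a word that
contains a letter of the other family and retracting it lowers its degree, so hardness is inherited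
(`IsHard.map`).

Finally the retractions are coalgebra maps, and the part of z made of ordered products with both
families present can be recovered from the (sndProj ⊗ fstProj)-image of Δ(z) (`mixedPart_eq`). For a
skew primitive z this part is zero, so z is a sum of skew primitives from H₁ and H₂ (`skewPrim_eq`).
-/

noncomputable section

/-! ### Group elements and characters of words. -/

namespace QuantumVars

section

variable {k G ι : Type*} [Field k] [CommGroup G] (V : QuantumVars k G ι)

@[simp] theorem gWord_nil : V.gWord [] = 1 := rfl

@[simp] theorem gWord_cons (i : ι) (w : List ι) : V.gWord (i :: w) = V.g i * V.gWord w := by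
  simp [gWord]

@[simp] theorem χWord_nil : V.χWord [] = 1 := rfl

@[simp] theorem χWord_cons (i : ι) (w : List ι) : V.χWord (i :: w) = V.χ i * V.χWord w := by
  simp [χWord]

end

end QuantumVars

/-! ### Universal properties and spanning sets of enveloping algebras; the retraction onto the group
part. -/

section EnvApi

variable {k G ι : Type*} [Field k] [CommGroup G]

namespace Env

section

variable (V : QuantumVars k G ι) (R : Set (FreeAlgebra k (G ⊕ ι)))

/-- The universal property of `Env V R`. -/
def lift {T : Type*} [Ring T] [Algebra k T] (γ : G →* T) (x : ι → T)
    (hx : ∀ i a, x i * γ a = (V.χ i a : k) • (γ a * x i))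
    (hR : ∀ r ∈ R, FreeAlgebra.lift k (Sum.elim γ x) r = 0) : Env V R →ₐ[k] T :=
  RingQuot.liftAlgHom k
    ⟨FreeAlgebra.lift k (Sum.elim γ x), by
      intro a b h
      cases h with
      | one => simp
      | mul a b => simp
      | skew i a => simp [hx]
      | rel r hr => rw [hR _ hr, map_zero]⟩

section

variable {V R} {T : Type*} [Ring T] [Algebra k T] {γ : G →* T} {x : ι → T}
    {hx : ∀ i a, x i * γ a = (V.χ i a : k) • (γ a * x i)}
    {hR : ∀ r ∈ R, FreeAlgebra.lift k (Sum.elim γ x) r = 0}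

@[simp] theorem lift_grp (a : G) : lift V R γ x hx hR (grp V R a) = γ a := by
  refine (RingQuot.liftAlgHom_mkAlgHom_apply k _ _ _).trans ?_
  simp

@[simp] theorem lift_gen (i : ι) : lift V R γ x hx hR (gen V R i) = x i := by
  refine (RingQuot.liftAlgHom_mkAlgHom_apply k _ _ _).trans ?_
  simp

end

section

variable {κ : Type*} {V} {V' : QuantumVars k G κ} {R} {R' : Set (FreeAlgebra k (G ⊕ κ))}
    {φ : ι → κ} {hχ : ∀ i, V'.χ (φ i) = V.χ i}
    {hR : ∀ r ∈ R, FreeAlgebra.lift k (Sum.elim (grp V' R') (fun i => gen V' R' (φ i))) r = 0}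

@[simp] theorem map_grp (a : G) : map φ hχ hR (grp V R a) = grp V' R' a := by
  refine (RingQuot.liftAlgHom_mkAlgHom_apply k _ _ _).trans ?_
  simp

@[simp] theorem map_gen (i : ι) : map φ hχ hR (gen V R i) = gen V' R' (φ i) := by
  refine (RingQuot.liftAlgHom_mkAlgHom_apply k _ _ _).trans ?_
  simp

end

theorem proj_surjective : Function.Surjective (proj V R) :=
  RingQuot.mkAlgHom_surjective k (EnvRel V R)

variable {V R}

@[elab_as_elim]
theorem induction {P : Env V R → Prop} (algebraMap : ∀ c : k, P (algebraMap k _ c))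
    (add : ∀ a b, P a → P b → P (a + b)) (mul : ∀ a b, P a → P b → P (a * b))
    (grp : ∀ a, P (grp V R a)) (gen : ∀ i, P (gen V R i)) (a : Env V R) : P a := by
  obtain ⟨f, rfl⟩ := proj_surjective V R a
  induction f using FreeAlgebra.induction with
  | grade0 c => rw [AlgHom.commutes]; exact algebraMap c
  | grade1 x => rcases x with a | i
                · exact grp a
                · exact gen i
  | mul a b ha hb => rw [map_mul]; exact mul _ _ ha hb
  | add a b ha hb => rw [map_add]; exact add _ _ ha hb

theorem algHom_ext {T : Type*} [Semiring T] [Algebra k T] {f g : Env V R →ₐ[k] T}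
    (hgrp : ∀ a, f (grp V R a) = g (grp V R a)) (hgen : ∀ i, f (gen V R i) = g (gen V R i)) :
    f = g := by
  ext a
  induction a using induction with
  | algebraMap c => simp
  | add a b ha hb => simp [ha, hb]
  | mul a b ha hb => simp [ha, hb]
  | grp a => exact hgrp a
  | gen i => exact hgen i

variable (V R)

/-- The group `G` inside `Env V R`. -/
def grpHom : G →* Env V R where
  toFun := grp V R
  map_one' := grp_one V R
  map_mul' := grp_mul V R

@[simp] theorem grpHom_apply (a : G) : grpHom V R a = grp V R a := rfl

/-- The value of a word in the quantum variables. -/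
def word (w : List ι) : Env V R := (w.map (gen V R)).prod

@[simp] theorem word_nil : word V R [] = 1 := rfl

@[simp] theorem word_cons (i : ι) (w : List ι) :
    word V R (i :: w) = gen V R i * word V R w := by
  simp [word]

theorem word_append (v w : List ι) : word V R (v ++ w) = word V R v * word V R w := by
  simp [word]

theorem word_mul_grp (w : List ι) (a : G) :
    word V R w * grp V R a = (V.χWord w a : k) • (grp V R a * word V R w) := by
  induction w with
  | nil => simp
  | cons i w ih =>
    rw [word_cons, mul_assoc, ih, mul_smul_comm, ← mul_assoc, gen_mul_grp, smul_mul_assoc,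
      smul_smul, mul_assoc]
    simp [mul_comm]

theorem grp_mul_word (w : List ι) (a : G) :
    grp V R a * word V R w = (((V.χWord w a)⁻¹ : kˣ) : k) • (word V R w * grp V R a) := by
  rw [word_mul_grp, smul_smul]
  simp

theorem grp_mul_gen (i : ι) (a : G) :
    grp V R a * gen V R i = (((V.χ i a)⁻¹ : kˣ) : k) • (gen V R i * grp V R a) := by
  rw [gen_mul_grp, smul_smul]
  simp

theorem grp_mul_grp_inv (a : G) : grp V R a * grp V R a⁻¹ = 1 := by
  rw [← grp_mul, mul_inv_cancel, grp_one]

theorem grp_inv_mul_grp (a : G) : grp V R a⁻¹ * grp V R a = 1 := by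
  rw [← grp_mul, inv_mul_cancel, grp_one]

/-- A subspace containing `1` and stable under left multiplication by the generators is the whole
algebra. -/
theorem eq_top_of_mul_mem {N : Submodule k (Env V R)} (h1 : 1 ∈ N)
    (hgrp : ∀ a, ∀ x ∈ N, grp V R a * x ∈ N) (hgen : ∀ i, ∀ x ∈ N, gen V R i * x ∈ N) :
    N = ⊤ := by
  have key : ∀ a : Env V R, ∀ x ∈ N, a * x ∈ N := by
    intro a
    induction a using induction with
    | algebraMap c => intro x hx; rw [← Algebra.smul_def]; exact N.smul_mem c hx
    | add a b ha hb => intro x hx; rw [add_mul]; exact N.add_mem (ha x hx) (hb x hx)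
    | mul a b ha hb => intro x hx; rw [mul_assoc]; exact ha _ (hb x hx)
    | grp a => exact hgrp a
    | gen i => exact hgen i
  refine eq_top_iff.2 fun a _ => ?_
  simpa using key a 1 h1

theorem span_word_mul_grp :
    Submodule.span k {t | ∃ w a, t = word V R w * grp V R a} = ⊤ := by
  refine eq_top_of_mul_mem V R (Submodule.subset_span ⟨[], 1, by simp [grp_one]⟩) ?_ ?_
  · intro a x hx
    induction hx using Submodule.span_induction with
    | mem x h =>
      obtain ⟨w, b, rfl⟩ := h
      rw [← mul_assoc, grp_mul_word, smul_mul_assoc, mul_assoc, ← grp_mul]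
      exact Submodule.smul_mem _ _ (Submodule.subset_span ⟨_, _, rfl⟩)
    | zero => simp
    | add x y _ _ hx hy => rw [mul_add]; exact Submodule.add_mem _ hx hy
    | smul c x _ hx => rw [mul_smul_comm]; exact Submodule.smul_mem _ _ hx
  · intro i x hx
    induction hx using Submodule.span_induction with
    | mem x h =>
      obtain ⟨w, b, rfl⟩ := h
      rw [← mul_assoc, ← word_cons]
      exact Submodule.subset_span ⟨_, _, rfl⟩
    | zero => simp
    | add x y _ _ hx hy => rw [mul_add]; exact Submodule.add_mem _ hx hy
    | smul c x _ hx => rw [mul_smul_comm]; exact Submodule.smul_mem _ _ hx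

theorem span_grp_mul_word :
    Submodule.span k {t | ∃ a w, t = grp V R a * word V R w} = ⊤ := by
  rw [eq_top_iff, ← span_word_mul_grp, Submodule.span_le]
  rintro _ ⟨w, a, rfl⟩
  rw [word_mul_grp]
  exact Submodule.smul_mem _ _ (Submodule.subset_span ⟨_, _, rfl⟩)

/-- The value of a noncommutative polynomial. -/
def polyEval : FreeAlgebra k ι →ₐ[k] Env V R := FreeAlgebra.lift k (gen V R)

@[simp] theorem polyEval_ι (i : ι) : polyEval V R (FreeAlgebra.ι k i) = gen V R i := by
  simp [polyEval]

@[simp] theorem polyEval_word (w : List ι) :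
    polyEval V R (w.map (FreeAlgebra.ι k)).prod = word V R w := by
  rw [map_list_prod, List.map_map, word]
  congr 2
  ext i
  simp

theorem polyEval_eq_proj (f : FreeAlgebra k ι) : polyEval V R f = proj V R (polyEmb k G ι f) := by
  rw [← AlgHom.comp_apply]
  congr 1
  ext i
  simp [polyEmb, gen]

/-- The device by which relations are checked in universal properties: a substitution that extends
to an enveloping algebra in which f is zero must itself kill f. -/
theorem algHom_polyEval {T : Type*} [Ring T] [Algebra k T] (φ : Env V R →ₐ[k] T)
    (f : FreeAlgebra k ι) : φ (polyEval V R f) = FreeAlgebra.lift k (fun i => φ (gen V R i)) f := by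
  rw [← AlgHom.comp_apply]
  congr 1
  ext i
  simp

end

end Env

namespace Quant

variable {V : QuantumVars k G ι} {F : Set (FreeAlgebra k ι)}

theorem polyEval_eq_zero {f : FreeAlgebra k ι} (hf : f ∈ F) :
    Env.polyEval V (polyEmb k G ι '' F) f = 0 := by
  rw [Env.polyEval_eq_proj]
  exact Env.proj_rel _ _ _ ⟨f, hf, rfl⟩

omit [CommGroup G] in
theorem lift_polyEmb {T : Type*} [Ring T] [Algebra k T] (γ : G → T) (x : ι → T)
    (f : FreeAlgebra k ι) :
    FreeAlgebra.lift k (Sum.elim γ x) (polyEmb k G ι f) = FreeAlgebra.lift k x f := by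
  rw [← AlgHom.comp_apply]
  congr 1
  ext i
  simp [polyEmb]

/-- The universal property of `⟨X ‖ F⟩`. -/
def lift {T : Type*} [Ring T] [Algebra k T] (γ : G →* T) (x : ι → T)
    (hx : ∀ i a, x i * γ a = (V.χ i a : k) • (γ a * x i))
    (hF : ∀ f ∈ F, FreeAlgebra.lift k x f = 0) : Quant V F →ₐ[k] T :=
  Env.lift V _ γ x hx (by
    rintro _ ⟨f, hf, rfl⟩
    rw [lift_polyEmb, hF f hf])

variable {T : Type*} [Ring T] [Algebra k T] {γ : G →* T} {x : ι → T}
    {hx : ∀ i a, x i * γ a = (V.χ i a : k) • (γ a * x i)}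
    {hF : ∀ f ∈ F, FreeAlgebra.lift k x f = 0}

@[simp] theorem lift_grp (a : G) : lift γ x hx hF (Env.grp V _ a) = γ a := Env.lift_grp a

@[simp] theorem lift_gen (i : ι) : lift γ x hx hF (Env.gen V _ i) = x i := Env.lift_gen i

end Quant

/-- The universal property of the free enveloping algebra. -/
def FreeEnv.lift {V : QuantumVars k G ι} {T : Type*} [Ring T] [Algebra k T] (γ : G →* T)
    (x : ι → T) (hx : ∀ i a, x i * γ a = (V.χ i a : k) • (γ a * x i)) : FreeEnv V →ₐ[k] T :=
  Env.lift V ∅ γ x hx (fun _ hr => absurd hr (Set.notMem_empty _))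

@[simp] theorem FreeEnv.lift_grp {V : QuantumVars k G ι} {T : Type*} [Ring T] [Algebra k T]
    {γ : G →* T} {x : ι → T} {hx : ∀ i a, x i * γ a = (V.χ i a : k) • (γ a * x i)} (a : G) :
    FreeEnv.lift γ x hx (Env.grp V _ a) = γ a := Env.lift_grp a

@[simp] theorem FreeEnv.lift_gen {V : QuantumVars k G ι} {T : Type*} [Ring T] [Algebra k T]
    {γ : G →* T} {x : ι → T} {hx : ∀ i a, x i * γ a = (V.χ i a : k) • (γ a * x i)} (i : ι) :
    FreeEnv.lift γ x hx (Env.gen V _ i) = x i := Env.lift_gen i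

@[simp] theorem FreeEnv.toEnv_grp (V : QuantumVars k G ι) (R : Set (FreeAlgebra k (G ⊕ ι)))
    (a : G) : FreeEnv.toEnv V R (Env.grp V ∅ a) = Env.grp V R a := Env.map_grp a

@[simp] theorem FreeEnv.toEnv_gen (V : QuantumVars k G ι) (R : Set (FreeAlgebra k (G ⊕ ι)))
    (i : ι) : FreeEnv.toEnv V R (Env.gen V ∅ i) = Env.gen V R i := Env.map_gen i

theorem Env.algHom_word {V : QuantumVars k G ι} {R : Set (FreeAlgebra k (G ⊕ ι))}
    {T : Type*} [Semiring T] [Algebra k T] (φ : Env V R →ₐ[k] T) (w : List ι) :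
    φ (Env.word V R w) = (w.map (fun i => φ (Env.gen V R i))).prod := by
  rw [Env.word, map_list_prod, List.map_map]
  rfl

@[simp] theorem FreeEnv.toEnv_word (V : QuantumVars k G ι) (R : Set (FreeAlgebra k (G ⊕ ι)))
    (w : List ι) : FreeEnv.toEnv V R (Env.word V ∅ w) = Env.word V R w := by
  rw [Env.algHom_word]
  simp [Env.word]

theorem FreeEnv.toEnv_polyEval (V : QuantumVars k G ι) (R : Set (FreeAlgebra k (G ⊕ ι)))
    (f : FreeAlgebra k ι) :
    FreeEnv.toEnv V R (Env.polyEval V ∅ f) = Env.polyEval V R f := by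
  rw [Env.algHom_polyEval]
  simp [Env.polyEval]

namespace CharHopf

variable {V : QuantumVars k G ι} {R : Set (FreeAlgebra k (G ⊕ ι))}

-- Applying ε to the counit axiom for a ⊗ a shows that ε(a) is idempotent, and it is invertible
-- because a is.
@[simp] theorem counit_grp (S : CharHopf V R) (a : G) : S.counit (Env.grp V R a) = 1 := by
  have h1 : ∀ a, S.counit (Env.grp V R a) * S.counit (Env.grp V R a) =
      S.counit (Env.grp V R a) := fun a => by
    have h := S.rTensor_counit_comul (Env.grp V R a)
    rw [S.comul_grp] at h
    simpa using congrArg (LinearMap.mul' k k ∘ S.counit.toLinearMap.lTensor k) h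
  have h2 : S.counit (Env.grp V R a) * S.counit (Env.grp V R a⁻¹) = 1 := by
    rw [← map_mul, Env.grp_mul_grp_inv, map_one]
  have h3 := h1 a
  have h4 : S.counit (Env.grp V R a) ≠ 0 := left_ne_zero_of_mul_eq_one h2
  exact mul_left_cancel₀ h4 (by rw [h3, mul_one])

@[simp] theorem counit_gen (S : CharHopf V R) (i : ι) : S.counit (Env.gen V R i) = 0 := by
  have h := S.rTensor_counit_comul (Env.gen V R i)
  rw [S.comul_gen] at h
  simpa using congrArg (LinearMap.mul' k k ∘ S.counit.toLinearMap.lTensor k) h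

end CharHopf

/-- The relations of a character Hopf algebra have no constant term. -/
theorem CharHopf.lift_zero_eq_zero {V : QuantumVars k G ι} {F : Set (FreeAlgebra k ι)}
    (S : CharHopf V (polyEmb k G ι '' F)) {T : Type*} [Ring T] [Algebra k T]
    {f : FreeAlgebra k ι} (hf : f ∈ F) : FreeAlgebra.lift k (fun _ => (0 : T)) f = 0 := by
  have h : FreeAlgebra.lift k (fun _ : ι => (0 : T)) =
      (Algebra.ofId k T).comp (S.counit.comp (Env.polyEval V _)) := by
    ext i
    simp
  rw [h]
  simp [Quant.polyEval_eq_zero hf]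

/-- The homomorphism `x ↦ 0` extending a homomorphism on the group. -/
def CharHopf.grpLift {V : QuantumVars k G ι} {F : Set (FreeAlgebra k ι)}
    (S : CharHopf V (polyEmb k G ι '' F)) {T : Type*} [Ring T] [Algebra k T] (γ : G →* T) :
    Quant V F →ₐ[k] T :=
  Quant.lift γ (fun _ => 0) (fun _ _ => by simp) (fun _ hf => S.lift_zero_eq_zero hf)

section

variable {V : QuantumVars k G ι} {F : Set (FreeAlgebra k ι)}
    (S : CharHopf V (polyEmb k G ι '' F)) {T : Type*} [Ring T] [Algebra k T] (γ : G →* T)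

@[simp] theorem CharHopf.grpLift_grp (a : G) : S.grpLift γ (Env.grp V _ a) = γ a :=
  Quant.lift_grp a

@[simp] theorem CharHopf.grpLift_gen (i : ι) : S.grpLift γ (Env.gen V _ i) = 0 :=
  Quant.lift_gen i

theorem CharHopf.grpLift_word {w : List ι} (hw : w ≠ []) : S.grpLift γ (Env.word V _ w) = 0 := by
  cases w with
  | nil => exact absurd rfl hw
  | cons i w => simp

/-- The relations F have no constant term, so sending the variables to zero maps the algebra onto
k[G], where G is visible. The relations of the glued algebra involve G, so this argument does not
apply there directly. -/
theorem CharHopf.grp_injective (S : CharHopf V (polyEmb k G ι '' F)) :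
    Function.Injective (Env.grp V (polyEmb k G ι '' F)) := by
  intro a b h
  have h' := congrArg (S.grpLift (MonoidAlgebra.of k G)) h
  rw [S.grpLift_grp, S.grpLift_grp] at h'
  exact MonoidAlgebra.of_injective h'

end

end EnvApi

/-! ### Character Hopf structures from their values on generators. -/

section HopfStructure

variable {k G ι : Type*} [Field k] [CommGroup G]

namespace Env

variable (V : QuantumVars k G ι) (R : Set (FreeAlgebra k (G ⊕ ι)))

/-- The diagonal embedding `a ↦ a ⊗ a` of the group. -/
def grpDiag : G →* Env V R ⊗[k] Env V R where
  toFun := fun a => grp _ _ a ⊗ₜ grp _ _ a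
  map_one' := by simp [grp_one, Algebra.TensorProduct.one_def]
  map_mul' := by simp [grp_mul]

@[simp] theorem grpDiag_apply (a : G) : grpDiag V R a = grp _ _ a ⊗ₜ grp _ _ a := rfl

/-- Commutativity of G lets a pass the factor g_i, so both summands acquire the same scalar χ^i(a).
-/
theorem skewPrim_mul_grpDiag (i : ι) (a : G) :
    (gen V R i ⊗ₜ[k] 1 + grp V R (V.g i) ⊗ₜ gen V R i) * grpDiag V R a =
    (V.χ i a : k) • (grpDiag V R a * (gen V R i ⊗ₜ[k] 1 + grp V R (V.g i) ⊗ₜ gen V R i)) := by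
  simp only [grpDiag_apply, add_mul, mul_add, Algebra.TensorProduct.tmul_mul_tmul,
    gen_mul_grp, one_mul, mul_one, smul_add, TensorProduct.smul_tmul',
    TensorProduct.tmul_smul, ← grp_mul, mul_comm]

end Env

namespace CharHopf

variable {V : QuantumVars k G ι} {R : Set (FreeAlgebra k (G ⊕ ι))}

/-- The Hopf algebra in the sense of Mathlib given by a character Hopf algebra structure. -/
@[reducible]
def toHopfAlgebra (S : CharHopf V R) : HopfAlgebra k (Env V R) where
  comul := S.comul.toLinearMap
  counit := S.counit.toLinearMap
  coassoc := S.coassoc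
  rTensor_counit_comp_comul := LinearMap.ext S.rTensor_counit_comul
  lTensor_counit_comp_comul := LinearMap.ext S.lTensor_counit_comul
  counit_one := map_one S.counit
  mul_compr₂_counit := by ext; simp
  comul_one := map_one S.comul
  mul_compr₂_comul := by ext; simp
  antipode := S.antipode
  mul_antipode_rTensor_comul := LinearMap.ext S.mul_antipode_rTensor_comul
  mul_antipode_lTensor_comul := LinearMap.ext S.mul_antipode_lTensor_comul

/-- Distinct group-like elements of a coalgebra over a field are independent, so an embedding of G
is already an embedding of k[G]. -/
theorem linearIndependent_grp (S : CharHopf V R) (hinj : Function.Injective (Env.grp V R)) :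
    LinearIndependent k (Env.grp V R) := by
  let _ := S.toHopfAlgebra
  have h := (linearIndepOn_isGroupLikeElem (R := k) (A := Env V R))
  have h2 := h.linearIndependent
  refine h2.comp (fun a => ⟨Env.grp V R a, S.counit_grp a, S.comul_grp a⟩) ?_
  intro a b hab
  exact hinj (congrArg Subtype.val hab)

/-- The antipode as a homomorphism to the opposite algebra. -/
def antipodeOp (S : CharHopf V R) : Env V R →ₐ[k] (Env V R)ᵐᵒᵖ :=
  letI := S.toHopfAlgebra
  HopfAlgebra.antipodeAlgHomOp k (Env V R)

theorem antipodeOp_apply (S : CharHopf V R) (a : Env V R) :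
    S.antipodeOp a = MulOpposite.op (S.antipode a) := rfl

theorem antipode_grp (S : CharHopf V R) (a : G) :
    S.antipode (Env.grp V R a) = Env.grp V R a⁻¹ := by
  have h := S.mul_antipode_rTensor_comul (Env.grp V R a)
  rw [S.comul_grp, S.counit_grp, map_one, LinearMap.rTensor_tmul, LinearMap.mul'_apply] at h
  calc S.antipode (Env.grp V R a) =
      S.antipode (Env.grp V R a) * Env.grp V R a * Env.grp V R a⁻¹ := by
        rw [mul_assoc, Env.grp_mul_grp_inv, mul_one]
    _ = Env.grp V R a⁻¹ := by rw [h, one_mul]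

theorem antipode_gen (S : CharHopf V R) (i : ι) :
    S.antipode (Env.gen V R i) = - (Env.grp V R (V.g i)⁻¹ * Env.gen V R i) := by
  have h := S.mul_antipode_rTensor_comul (Env.gen V R i)
  rw [S.comul_gen, S.counit_gen, map_zero, map_add, map_add, LinearMap.rTensor_tmul,
    LinearMap.rTensor_tmul, LinearMap.mul'_apply, LinearMap.mul'_apply, antipode_grp, mul_one] at h
  exact eq_neg_of_add_eq_zero_left h

theorem mul'_rTensor_mul_tmul {A : Type*} [Ring A] [Algebra k A] {s : A →ₗ[k] A}
    (hs : ∀ a b, s (a * b) = s b * s a) (t : A ⊗[k] A) (x y : A) :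
    LinearMap.mul' k A (s.rTensor A (t * x ⊗ₜ y)) =
      s x * LinearMap.mul' k A (s.rTensor A t) * y := by
  induction t with
  | zero => simp
  | tmul a b => simp [hs, mul_assoc]
  | add a b ha hb => simp [add_mul, mul_add, ha, hb]

theorem mul'_lTensor_tmul_mul {A : Type*} [Ring A] [Algebra k A] {s : A →ₗ[k] A}
    (hs : ∀ a b, s (a * b) = s b * s a) (t : A ⊗[k] A) (x y : A) :
    LinearMap.mul' k A (s.lTensor A (x ⊗ₜ y * t)) =
      x * LinearMap.mul' k A (s.lTensor A t) * s y := by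
  induction t with
  | zero => simp
  | tmul a b => simp [hs, mul_assoc]
  | add a b ha hb => simp [add_mul, mul_add, ha, hb]

/-- For an anti-multiplicative s the contribution of t stands in the middle of the product. There it
is a scalar, so it can be pulled out. Hence the antipode identity passes from two elements to their
product and need only be verified on generators. -/
theorem mul'_rTensor_mul {A : Type*} [Ring A] [Algebra k A] {s : A →ₗ[k] A}
    (hs : ∀ a b, s (a * b) = s b * s a) {t u : A ⊗[k] A} {c d : k}
    (ht : LinearMap.mul' k A (s.rTensor A t) = algebraMap k A c)
    (hu : LinearMap.mul' k A (s.rTensor A u) = algebraMap k A d) :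
    LinearMap.mul' k A (s.rTensor A (t * u)) = algebraMap k A (c * d) := by
  have h : ∀ v, LinearMap.mul' k A (s.rTensor A (t * v)) =
      c • LinearMap.mul' k A (s.rTensor A v) := by
    intro v
    induction v with
    | zero => simp
    | tmul x y =>
      rw [mul'_rTensor_mul_tmul hs, ht, ← Algebra.commutes, Algebra.smul_def]
      simp [mul_assoc]
    | add a b ha hb => simp [mul_add, ha, hb]
  rw [h, hu, map_mul, Algebra.smul_def]

theorem mul'_lTensor_mul {A : Type*} [Ring A] [Algebra k A] {s : A →ₗ[k] A}
    (hs : ∀ a b, s (a * b) = s b * s a) {t u : A ⊗[k] A} {c d : k}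
    (ht : LinearMap.mul' k A (s.lTensor A t) = algebraMap k A c)
    (hu : LinearMap.mul' k A (s.lTensor A u) = algebraMap k A d) :
    LinearMap.mul' k A (s.lTensor A (t * u)) = algebraMap k A (c * d) := by
  have h : ∀ v, LinearMap.mul' k A (s.lTensor A (v * u)) =
      d • LinearMap.mul' k A (s.lTensor A v) := by
    intro v
    induction v with
    | zero => simp
    | tmul x y =>
      rw [mul'_lTensor_tmul_mul hs, hu, ← Algebra.commutes, Algebra.smul_def]
      simp [mul_assoc]
    | add a b ha hb => simp [add_mul, ha, hb]
  rw [h, ht, mul_comm c d, map_mul, Algebra.smul_def]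

/-- A character Hopf algebra structure can be checked on generators. -/
def ofGenerators (Δ : Env V R →ₐ[k] Env V R ⊗[k] Env V R) (ε : Env V R →ₐ[k] k)
    (σ : Env V R →ₐ[k] (Env V R)ᵐᵒᵖ)
    (Δ_grp : ∀ a, Δ (Env.grp V R a) = Env.grp V R a ⊗ₜ[k] Env.grp V R a)
    (Δ_gen : ∀ i, Δ (Env.gen V R i) =
      Env.gen V R i ⊗ₜ[k] 1 + Env.grp V R (V.g i) ⊗ₜ[k] Env.gen V R i)
    (ε_grp : ∀ a, ε (Env.grp V R a) = 1) (ε_gen : ∀ i, ε (Env.gen V R i) = 0)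
    (σ_grp : ∀ a, σ (Env.grp V R a) = MulOpposite.op (Env.grp V R a⁻¹))
    (σ_gen : ∀ i, σ (Env.gen V R i) =
      MulOpposite.op (-(Env.grp V R (V.g i)⁻¹ * Env.gen V R i))) : CharHopf V R where
  comul := Δ
  counit := ε
  antipode := (MulOpposite.opLinearEquiv k).symm.toLinearMap ∘ₗ σ.toLinearMap
  coassoc := by
    have h : ((Algebra.TensorProduct.assoc k k k (Env V R) (Env V R) (Env V R)).toAlgHom.comp
        (Algebra.TensorProduct.map Δ (AlgHom.id k _))).comp Δ =
        (Algebra.TensorProduct.map (AlgHom.id k _) Δ).comp Δ := by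
      refine Env.algHom_ext (fun a => ?_) (fun i => ?_)
      · simp [Δ_grp]
      · simp [Δ_gen, Δ_grp, TensorProduct.add_tmul, TensorProduct.tmul_add, add_assoc,
          Algebra.TensorProduct.one_def]
    ext a
    exact DFunLike.congr_fun h a
  rTensor_counit_comul a := by
    have h : (Algebra.TensorProduct.map ε (AlgHom.id k _)).comp Δ =
        Algebra.TensorProduct.includeRight := by
      refine Env.algHom_ext (fun a => ?_) (fun i => ?_)
      · simp [Δ_grp, ε_grp]
      · simp [Δ_gen, ε_gen, ε_grp]
    exact DFunLike.congr_fun h a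
  lTensor_counit_comul a := by
    have h : (Algebra.TensorProduct.map (AlgHom.id k _) ε).comp Δ =
        Algebra.TensorProduct.includeLeft := by
      refine Env.algHom_ext (fun a => ?_) (fun i => ?_)
      · simp [Δ_grp, ε_grp]
      · simp [Δ_gen, ε_gen]
    exact DFunLike.congr_fun h a
  mul_antipode_rTensor_comul a := by
    induction a using Env.induction with
    | algebraMap c => simp [Algebra.algebraMap_eq_smul_one, Algebra.TensorProduct.one_def]
    | add a b ha hb => simp only [map_add, ha, hb]
    | mul a b ha hb =>
      rw [map_mul Δ, map_mul ε]
      exact mul'_rTensor_mul (fun a b => by simp) ha hb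
    | grp a => simp [Δ_grp, σ_grp, ε_grp, Env.grp_inv_mul_grp]
    | gen i => simp [Δ_gen, σ_gen, σ_grp, ε_gen]
  mul_antipode_lTensor_comul a := by
    induction a using Env.induction with
    | algebraMap c => simp [Algebra.algebraMap_eq_smul_one, Algebra.TensorProduct.one_def]
    | add a b ha hb => simp only [map_add, ha, hb]
    | mul a b ha hb =>
      rw [map_mul Δ, map_mul ε]
      exact mul'_lTensor_mul (fun a b => by simp) ha hb
    | grp a => simp [Δ_grp, σ_grp, ε_grp, Env.grp_mul_grp_inv]
    | gen i => simp [Δ_gen, σ_gen, ε_gen, ← mul_assoc, Env.grp_mul_grp_inv]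
  comul_grp := Δ_grp
  comul_gen := Δ_gen

end CharHopf

end HopfStructure

/-! ### The Hopf structure of the glued algebra. -/

section GlueApi

variable {k G ι₁ ι₂ : Type*} [Field k] [CommGroup G]
  {V₁ : QuantumVars k G ι₁} {V₂ : QuantumVars k G ι₂} {F₁ : Set (FreeAlgebra k ι₁)}
  {F₂ : Set (FreeAlgebra k ι₂)} {α : ι₁ → ι₂ → k}

namespace Glue

/-- The universal property of the glued algebra. -/
def lift {T : Type*} [Ring T] [Algebra k T] (γ : G →* T) (x : ι₁ → T) (y : ι₂ → T)
    (hx : ∀ i a, x i * γ a = (V₁.χ i a : k) • (γ a * x i))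
    (hy : ∀ j a, y j * γ a = (V₂.χ j a : k) • (γ a * y j))
    (hF₁ : ∀ f ∈ F₁, FreeAlgebra.lift k x f = 0) (hF₂ : ∀ f ∈ F₂, FreeAlgebra.lift k y f = 0)
    (hxy : ∀ i j, x i * y j - (V₁.χ i (V₂.g j) : k) • (y j * x i) =
      α i j • (1 - γ (V₁.g i * V₂.g j))) : Glue V₁ V₂ F₁ F₂ α →ₐ[k] T :=
  Env.lift _ _ γ (fun i => Sum.elim x y (ofLex i))
    (fun i => by
      rcases i with i | j
      · exact hx i
      · exact hy j)
    (by
      rintro _ ((⟨f, hf, rfl⟩ | ⟨f, hf, rfl⟩) | ⟨i, j, rfl⟩)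
      · rw [← hF₁ f hf, ← AlgHom.comp_apply]
        congr 1
        ext i
        simp [Sum.inlₗ]
      · rw [← hF₂ f hf, ← AlgHom.comp_apply]
        congr 1
        ext i
        simp [Sum.inrₗ]
      · have h := sub_eq_zero.2 (hxy i j)
        simpa [Sum.inlₗ, Sum.inrₗ] using h)

section

variable {T : Type*} [Ring T] [Algebra k T] {γ : G →* T} {x : ι₁ → T} {y : ι₂ → T}
    {hx : ∀ i a, x i * γ a = (V₁.χ i a : k) • (γ a * x i)}
    {hy : ∀ j a, y j * γ a = (V₂.χ j a : k) • (γ a * y j)}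
    {hF₁ : ∀ f ∈ F₁, FreeAlgebra.lift k x f = 0} {hF₂ : ∀ f ∈ F₂, FreeAlgebra.lift k y f = 0}
    {hxy : ∀ i j, x i * y j - (V₁.χ i (V₂.g j) : k) • (y j * x i) =
      α i j • (1 - γ (V₁.g i * V₂.g j))}

@[simp] theorem lift_grp (a : G) : lift γ x y hx hy hF₁ hF₂ hxy (Env.grp _ _ a) = γ a :=
  Env.lift_grp a

@[simp] theorem lift_inl (i : ι₁) :
    lift γ x y hx hy hF₁ hF₂ hxy (Env.gen _ _ (Sum.inlₗ i)) = x i :=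
  Env.lift_gen (Sum.inlₗ i)

@[simp] theorem lift_inr (j : ι₂) :
    lift γ x y hx hy hF₁ hF₂ hxy (Env.gen _ _ (Sum.inrₗ j)) = y j :=
  Env.lift_gen (Sum.inrₗ j)

end

variable (V₁ V₂ F₁ F₂ α)

@[simp] theorem inl_grp (a : G) : glueInl V₁ V₂ F₁ F₂ α (Env.grp _ _ a) = Env.grp _ _ a :=
  Env.map_grp a

@[simp] theorem inr_grp (a : G) : glueInr V₁ V₂ F₁ F₂ α (Env.grp _ _ a) = Env.grp _ _ a :=
  Env.map_grp a

@[simp] theorem inl_gen (i : ι₁) :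
    glueInl V₁ V₂ F₁ F₂ α (Env.gen _ _ i) = Env.gen _ _ (Sum.inlₗ i) := Env.map_gen i

@[simp] theorem inr_gen (j : ι₂) :
    glueInr V₁ V₂ F₁ F₂ α (Env.gen _ _ j) = Env.gen _ _ (Sum.inrₗ j) := Env.map_gen j

theorem gen_mul_gen (i : ι₁) (j : ι₂) :
    Env.gen (glueVars V₁ V₂) (glueRel V₁ V₂ F₁ F₂ α) (Sum.inlₗ i) * Env.gen _ _ (Sum.inrₗ j) =
      (V₁.χ i (V₂.g j) : k) • (Env.gen _ _ (Sum.inrₗ j) * Env.gen _ _ (Sum.inlₗ i)) +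
        α i j • (1 - Env.grp _ _ (V₁.g i * V₂.g j)) := by
  have h := Env.proj_rel (glueVars V₁ V₂) (glueRel V₁ V₂ F₁ F₂ α) _ (Or.inr ⟨i, j, rfl⟩)
  simp only [map_sub, map_mul, map_smul, map_one] at h
  rw [sub_eq_zero, sub_eq_iff_eq_add'] at h
  exact h

theorem gen_inl_mul_grp (i : ι₁) (a : G) :
    Env.gen (glueVars V₁ V₂) (glueRel V₁ V₂ F₁ F₂ α) (Sum.inlₗ i) * Env.grp _ _ a =
      (V₁.χ i a : k) • (Env.grp _ _ a * Env.gen _ _ (Sum.inlₗ i)) :=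
  Env.gen_mul_grp _ _ _ _

theorem gen_inr_mul_grp (j : ι₂) (a : G) :
    Env.gen (glueVars V₁ V₂) (glueRel V₁ V₂ F₁ F₂ α) (Sum.inrₗ j) * Env.grp _ _ a =
      (V₂.χ j a : k) • (Env.grp _ _ a * Env.gen _ _ (Sum.inrₗ j)) :=
  Env.gen_mul_grp _ _ _ _

/-- This makes Δ respect F₃. Of the mixed terms, X gY ⊗ Y cancels by the commutation rule alone and
gX Y ⊗ X by p_ij p_ji = 1. The two pure commutators then telescope: α(1 - g) ⊗ 1 + g ⊗ α(1 - g) =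
α(1 ⊗ 1 - g ⊗ g) with g = g_i g_j. -/
theorem skewPrim_commutator (hp : ∀ i j, V₁.χ i (V₂.g j) * V₂.χ j (V₁.g i) = 1)
    (i : ι₁) (j : ι₂) {X Y gX gY : Glue V₁ V₂ F₁ F₂ α} (hX : X = Env.gen _ _ (Sum.inlₗ i))
    (hY : Y = Env.gen _ _ (Sum.inrₗ j)) (hgX : gX = Env.grp _ _ (V₁.g i))
    (hgY : gY = Env.grp _ _ (V₂.g j)) :
    (X ⊗ₜ[k] 1 + gX ⊗ₜ X) * (Y ⊗ₜ[k] 1 + gY ⊗ₜ Y) -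
      (V₁.χ i (V₂.g j) : k) • ((Y ⊗ₜ[k] 1 + gY ⊗ₜ Y) * (X ⊗ₜ[k] 1 + gX ⊗ₜ X)) =
      α i j • (1 - Env.grpDiag (glueVars V₁ V₂) (glueRel V₁ V₂ F₁ F₂ α) (V₁.g i * V₂.g j)) := by
  have h1 : X * Y = (V₁.χ i (V₂.g j) : k) • (Y * X) + α i j • (1 - gX * gY) := by
    rw [hX, hY, hgX, hgY, gen_mul_gen, Env.grp_mul]
  have h2 : X * gY = (V₁.χ i (V₂.g j) : k) • (gY * X) := by
    rw [hX, hgY, gen_inl_mul_grp]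
  have h3 : (V₁.χ i (V₂.g j) : k) • (Y * gX) = gX * Y := by
    rw [hY, hgX, gen_inr_mul_grp, smul_smul, ← Units.val_mul, hp, Units.val_one, one_smul]
  have h4 : gX * gY = gY * gX := by rw [hgX, hgY, ← Env.grp_mul, mul_comm, Env.grp_mul]
  have h5 : Env.grpDiag (glueVars V₁ V₂) (glueRel V₁ V₂ F₁ F₂ α) (V₁.g i * V₂.g j) = (gX * gY) ⊗ₜ (gX * gY) := by
    rw [Env.grpDiag_apply, Env.grp_mul, hgX, hgY]
  rw [h5, Algebra.TensorProduct.one_def]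
  simp only [add_mul, mul_add, Algebra.TensorProduct.tmul_mul_tmul, one_mul, mul_one, smul_add,
    smul_sub, h1, h2, TensorProduct.add_tmul, TensorProduct.tmul_add, TensorProduct.sub_tmul,
    TensorProduct.tmul_sub, TensorProduct.tmul_smul, ← TensorProduct.smul_tmul']
  rw [← h4, TensorProduct.smul_tmul' (V₁.χ i (V₂.g j) : k) (Y * gX), h3]
  abel

variable {V₁ V₂ F₁ F₂}

/-- The comultiplication of the glued algebra. -/
def comul (S₁ : CharHopf V₁ (polyEmb k G ι₁ '' F₁)) (S₂ : CharHopf V₂ (polyEmb k G ι₂ '' F₂))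
    (hp : ∀ i j, V₁.χ i (V₂.g j) * V₂.χ j (V₁.g i) = 1) :
    Glue V₁ V₂ F₁ F₂ α →ₐ[k] Glue V₁ V₂ F₁ F₂ α ⊗[k] Glue V₁ V₂ F₁ F₂ α :=
  lift (Env.grpDiag (glueVars V₁ V₂) (glueRel V₁ V₂ F₁ F₂ α))
    (fun i => Env.gen _ _ (Sum.inlₗ i) ⊗ₜ 1 +
      Env.grp _ _ (V₁.g i) ⊗ₜ Env.gen _ _ (Sum.inlₗ i))
    (fun j => Env.gen _ _ (Sum.inrₗ j) ⊗ₜ 1 +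
      Env.grp _ _ (V₂.g j) ⊗ₜ Env.gen _ _ (Sum.inrₗ j))
    (fun i => Env.skewPrim_mul_grpDiag _ _ (Sum.inlₗ i))
    (fun j => Env.skewPrim_mul_grpDiag _ _ (Sum.inrₗ j))
    (fun f hf => by
      -- On the first family the prescribed values are those of the comultiplication of H₁ followed
      -- by the natural map, and this composite kills f because f = 0 in H₁.
      have h := Env.algHom_polyEval _ _ ((Algebra.TensorProduct.map (glueInl V₁ V₂ F₁ F₂ α)
        (glueInl V₁ V₂ F₁ F₂ α)).comp S₁.comul) f
      rw [Quant.polyEval_eq_zero hf, map_zero] at h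
      rw [h]
      simp [S₁.comul_gen])
    (fun f hf => by
      have h := Env.algHom_polyEval _ _ ((Algebra.TensorProduct.map (glueInr V₁ V₂ F₁ F₂ α)
        (glueInr V₁ V₂ F₁ F₂ α)).comp S₂.comul) f
      rw [Quant.polyEval_eq_zero hf, map_zero] at h
      rw [h]
      simp [S₂.comul_gen])
    (fun i j => skewPrim_commutator V₁ V₂ F₁ F₂ α hp i j rfl rfl rfl rfl)

/-- The counit of the glued algebra. -/
def counit (S₁ : CharHopf V₁ (polyEmb k G ι₁ '' F₁)) (S₂ : CharHopf V₂ (polyEmb k G ι₂ '' F₂)) :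
    Glue V₁ V₂ F₁ F₂ α →ₐ[k] k :=
  lift 1 (fun _ => 0) (fun _ => 0) (by simp) (by simp) (fun _ hf => S₁.lift_zero_eq_zero hf)
    (fun _ hf => S₂.lift_zero_eq_zero hf) (by simp)

-- F₃ for the antipode, which reverses products: the signs of the two factors -g⁻¹x cancel, and
-- pulling g_i⁻¹g_j⁻¹ to the front leaves the negative of the original relation, so 1 - g_i g_j
-- turns into 1 - g_i⁻¹g_j⁻¹.
variable (F₁ F₂) in
theorem antipode_commutator (hp : ∀ i j, V₁.χ i (V₂.g j) * V₂.χ j (V₁.g i) = 1)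
    (i : ι₁) (j : ι₂) {X Y gX gY : Glue V₁ V₂ F₁ F₂ α} (hX : X = Env.gen _ _ (Sum.inlₗ i))
    (hY : Y = Env.gen _ _ (Sum.inrₗ j)) (hgX : gX = Env.grp _ _ (V₁.g i)⁻¹)
    (hgY : gY = Env.grp _ _ (V₂.g j)⁻¹) :
    (gY * Y) * (gX * X) - (V₁.χ i (V₂.g j) : k) • ((gX * X) * (gY * Y)) =
      α i j • (1 - gX * gY) := by
  have h1 : X * Y = (V₁.χ i (V₂.g j) : k) • (Y * X) + α i j •
      (1 - Env.grp _ _ (V₁.g i * V₂.g j)) := by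
    rw [hX, hY, gen_mul_gen]
  have h2 : (V₁.χ i (V₂.g j) : k) • (X * gY) = gY * X := by
    rw [hX, hgY, gen_inl_mul_grp, smul_smul, map_inv, ← Units.val_mul]
    simp
  have h3 : Y * gX = (V₁.χ i (V₂.g j) : k) • (gX * Y) := by
    rw [hY, hgX, gen_inr_mul_grp, map_inv, eq_inv_of_mul_eq_one_left (hp i j)]
  have h4 : gX * gY = gY * gX := by rw [hgX, hgY, ← Env.grp_mul, mul_comm, Env.grp_mul]
  have h5 : gX * gY * Env.grp _ _ (V₁.g i * V₂.g j) = 1 := by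
    rw [hgX, hgY, ← Env.grp_mul, ← Env.grp_mul, mul_comm (V₁.g i), ← mul_inv_rev,
      inv_mul_cancel, Env.grp_one]
  calc (gY * Y) * (gX * X) - (V₁.χ i (V₂.g j) : k) • ((gX * X) * (gY * Y))
      = gY * (Y * gX) * X - gX * ((V₁.χ i (V₂.g j) : k) • (X * gY)) * Y := by
        simp only [mul_assoc, mul_smul_comm, smul_mul_assoc]
    _ = gX * gY * ((V₁.χ i (V₂.g j) : k) • (Y * X) - X * Y) := by
        rw [h2, h3, mul_sub, h4]
        simp only [mul_assoc, mul_smul_comm, smul_mul_assoc, ← h4]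
        rw [← mul_assoc gY gX, ← h4]
        simp only [mul_assoc]
    _ = α i j • (1 - gX * gY) := by
        rw [h1, sub_add_cancel_left, mul_neg, mul_smul_comm, mul_sub, h5, mul_one, ← smul_neg,
          neg_sub]

/-- The inversion of the group, with values in the opposite algebra. -/
def grpInvOp (V : QuantumVars k G ι₁) (R : Set (FreeAlgebra k (G ⊕ ι₁))) : G →* (Env V R)ᵐᵒᵖ where
  toFun := fun a => MulOpposite.op (Env.grp V R a⁻¹)
  map_one' := by simp [Env.grp_one]
  map_mul' := fun a b => by rw [mul_inv_rev, Env.grp_mul, MulOpposite.op_mul]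

theorem grpInvOp_apply (V : QuantumVars k G ι₁) (R : Set (FreeAlgebra k (G ⊕ ι₁))) (a : G) :
    grpInvOp V R a = MulOpposite.op (Env.grp V R a⁻¹) := rfl

theorem op_mul_grpInvOp (V : QuantumVars k G ι₁) (R : Set (FreeAlgebra k (G ⊕ ι₁))) (i : ι₁)
    (a : G) : MulOpposite.op (-(Env.grp V R (V.g i)⁻¹ * Env.gen V R i)) * grpInvOp V R a =
      (V.χ i a : k) • (grpInvOp V R a *
        MulOpposite.op (-(Env.grp V R (V.g i)⁻¹ * Env.gen V R i))) := by
  rw [grpInvOp_apply, ← MulOpposite.op_mul, ← MulOpposite.op_mul, ← MulOpposite.op_smul]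
  congr 1
  rw [mul_neg, neg_mul, smul_neg, mul_assoc, Env.gen_mul_grp, mul_smul_comm, smul_smul, map_inv,
    ← Units.val_mul, mul_inv_cancel, Units.val_one, one_smul, ← mul_assoc, ← mul_assoc,
    ← Env.grp_mul, ← Env.grp_mul, mul_comm a⁻¹]

/-- The antipode of the glued algebra, as a homomorphism to the opposite algebra. -/
def antipodeOp (S₁ : CharHopf V₁ (polyEmb k G ι₁ '' F₁)) (S₂ : CharHopf V₂ (polyEmb k G ι₂ '' F₂))
    (hp : ∀ i j, V₁.χ i (V₂.g j) * V₂.χ j (V₁.g i) = 1) :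
    Glue V₁ V₂ F₁ F₂ α →ₐ[k] (Glue V₁ V₂ F₁ F₂ α)ᵐᵒᵖ :=
  lift (grpInvOp _ _)
    (fun i => MulOpposite.op (-(Env.grp _ _ (V₁.g i)⁻¹ * Env.gen _ _ (Sum.inlₗ i))))
    (fun j => MulOpposite.op (-(Env.grp _ _ (V₂.g j)⁻¹ * Env.gen _ _ (Sum.inrₗ j))))
    (fun i => op_mul_grpInvOp _ _ (Sum.inlₗ i))
    (fun j => op_mul_grpInvOp _ _ (Sum.inrₗ j))
    (fun f hf => by
      have h := Env.algHom_polyEval _ _ ((AlgHom.op (glueInl V₁ V₂ F₁ F₂ α)).comp S₁.antipodeOp) f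
      rw [Quant.polyEval_eq_zero hf, map_zero] at h
      rw [h]
      simp [S₁.antipodeOp_apply, S₁.antipode_gen])
    (fun f hf => by
      have h := Env.algHom_polyEval _ _ ((AlgHom.op (glueInr V₁ V₂ F₁ F₂ α)).comp S₂.antipodeOp) f
      rw [Quant.polyEval_eq_zero hf, map_zero] at h
      rw [h]
      simp [S₂.antipodeOp_apply, S₂.antipode_gen])
    (fun i j => by
      have h := antipode_commutator F₁ F₂ α hp i j rfl rfl rfl rfl
      rw [grpInvOp_apply, ← MulOpposite.op_mul, ← MulOpposite.op_mul, ← MulOpposite.op_smul,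
        ← MulOpposite.op_sub, neg_mul_neg, neg_mul_neg, h, ← Env.grp_mul, mul_inv_rev,
        mul_comm (V₁.g i)⁻¹]
      rfl)

/-- The character Hopf algebra structure of the glued algebra. -/
def charHopf (S₁ : CharHopf V₁ (polyEmb k G ι₁ '' F₁)) (S₂ : CharHopf V₂ (polyEmb k G ι₂ '' F₂))
    (hp : ∀ i j, V₁.χ i (V₂.g j) * V₂.χ j (V₁.g i) = 1) :
    CharHopf (glueVars V₁ V₂) (glueRel V₁ V₂ F₁ F₂ α) :=
  CharHopf.ofGenerators (comul α S₁ S₂ hp) (counit α S₁ S₂) (antipodeOp α S₁ S₂ hp)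
    (fun a => lift_grp a)
    (fun i => by
      rcases i with i | j
      · exact lift_inl i
      · exact lift_inr j)
    (fun a => lift_grp a)
    (fun i => by
      rcases i with i | j
      · exact lift_inl i
      · exact lift_inr j)
    (fun a => lift_grp a)
    (fun i => by
      rcases i with i | j
      · exact lift_inl i
      · exact lift_inr j)

/-- `Δ` is compatible with the homomorphism from the first algebra, for every character Hopf
algebra structure. -/
theorem comul_inl (S : CharHopf (glueVars V₁ V₂) (glueRel V₁ V₂ F₁ F₂ α))
    (S₁ : CharHopf V₁ (polyEmb k G ι₁ '' F₁)) (b : Quant V₁ F₁) :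
    S.comul (glueInl V₁ V₂ F₁ F₂ α b) = Algebra.TensorProduct.map (glueInl V₁ V₂ F₁ F₂ α)
      (glueInl V₁ V₂ F₁ F₂ α) (S₁.comul b) := by
  have h : S.comul.comp (glueInl V₁ V₂ F₁ F₂ α) = (Algebra.TensorProduct.map
      (glueInl V₁ V₂ F₁ F₂ α) (glueInl V₁ V₂ F₁ F₂ α)).comp S₁.comul := by
    refine Env.algHom_ext (fun a => ?_) (fun i => ?_)
    · simp [S.comul_grp, S₁.comul_grp]
    · simp [S.comul_gen, S₁.comul_gen]
      rfl
  exact DFunLike.congr_fun h b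

theorem comul_inr (S : CharHopf (glueVars V₁ V₂) (glueRel V₁ V₂ F₁ F₂ α))
    (S₂ : CharHopf V₂ (polyEmb k G ι₂ '' F₂)) (b : Quant V₂ F₂) :
    S.comul (glueInr V₁ V₂ F₁ F₂ α b) = Algebra.TensorProduct.map (glueInr V₁ V₂ F₁ F₂ α)
      (glueInr V₁ V₂ F₁ F₂ α) (S₂.comul b) := by
  have h : S.comul.comp (glueInr V₁ V₂ F₁ F₂ α) = (Algebra.TensorProduct.map
      (glueInr V₁ V₂ F₁ F₂ α) (glueInr V₁ V₂ F₁ F₂ α)).comp S₂.comul := by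
    refine Env.algHom_ext (fun a => ?_) (fun i => ?_)
    · simp [S.comul_grp, S₂.comul_grp]
    · simp [S.comul_gen, S₂.comul_gen]
      rfl
  exact DFunLike.congr_fun h b

end Glue
end GlueApi

/-! ### Contraction of a tensor factor with a functional. -/

section Contraction

variable {k A : Type*} [Field k] [Ring A] [Algebra k A]

/-- Contraction of the left tensor factor with a functional. -/
def leftContract (ψ : A →ₗ[k] k) : A ⊗[k] A →ₗ[k] A :=
  (TensorProduct.lid k A).toLinearMap ∘ₗ ψ.rTensor A

/-- Contraction of the right tensor factor with a functional. -/
def rightContract (ψ : A →ₗ[k] k) : A ⊗[k] A →ₗ[k] A :=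
  (TensorProduct.rid k A).toLinearMap ∘ₗ ψ.lTensor A

@[simp] theorem leftContract_tmul (ψ : A →ₗ[k] k) (a b : A) :
    leftContract ψ (a ⊗ₜ b) = ψ a • b := by simp [leftContract]

@[simp] theorem rightContract_tmul (ψ : A →ₗ[k] k) (a b : A) :
    rightContract ψ (a ⊗ₜ b) = ψ b • a := by simp [rightContract]

theorem leftContract_tmul_mul (ψ : A →ₗ[k] k) (a b : A) (t : A ⊗[k] A) :
    leftContract ψ (a ⊗ₜ b * t) = b * leftContract (ψ ∘ₗ LinearMap.mulLeft k a) t := by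
  induction t with
  | zero => simp
  | tmul x y => simp
  | add x y hx hy => simp [mul_add, hx, hy]

theorem rightContract_tmul_mul (ψ : A →ₗ[k] k) (a b : A) (t : A ⊗[k] A) :
    rightContract ψ (a ⊗ₜ b * t) = a * rightContract (ψ ∘ₗ LinearMap.mulLeft k b) t := by
  induction t with
  | zero => simp
  | tmul x y => simp
  | add x y hx hy => simp [mul_add, hx, hy]

theorem leftContract_smul (c : k) (ψ : A →ₗ[k] k) (t : A ⊗[k] A) :
    leftContract (c • ψ) t = c • leftContract ψ t := by
  simp [leftContract, LinearMap.rTensor_smul]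

theorem rightContract_smul (c : k) (ψ : A →ₗ[k] k) (t : A ⊗[k] A) :
    rightContract (c • ψ) t = c • rightContract ψ t := by
  simp [rightContract, LinearMap.lTensor_smul]

theorem leftContract_sub (ψ φ : A →ₗ[k] k) (t : A ⊗[k] A) :
    leftContract (ψ - φ) t = leftContract ψ t - leftContract φ t := by
  simp [leftContract, LinearMap.rTensor_sub]

theorem rightContract_sub (ψ φ : A →ₗ[k] k) (t : A ⊗[k] A) :
    rightContract (ψ - φ) t = rightContract ψ t - rightContract φ t := by
  simp [rightContract, LinearMap.lTensor_sub]

/-- Contraction with a functional that factors through q can be computed after q, where relations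
have become zero. -/
theorem map_leftContract {B : Type*} [Ring B] [Algebra k B] (q : A →ₐ[k] B) (ψ : B →ₗ[k] k)
    (t : A ⊗[k] A) : q (leftContract (ψ ∘ₗ q.toLinearMap) t) =
      leftContract ψ (Algebra.TensorProduct.map q q t) := by
  induction t with
  | zero => simp
  | tmul x y => simp
  | add x y hx hy => simp only [map_add, hx, hy]

theorem map_rightContract {B : Type*} [Ring B] [Algebra k B] (q : A →ₐ[k] B) (ψ : B →ₗ[k] k)
    (t : A ⊗[k] A) : q (rightContract (ψ ∘ₗ q.toLinearMap) t) =
      rightContract ψ (Algebra.TensorProduct.map q q t) := by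
  induction t with
  | zero => simp
  | tmul x y => simp
  | add x y hx hy => simp only [map_add, hx, hy]

/-- Over a field, a linear map factors through another one if it vanishes on its kernel. -/
theorem LinearMap.exists_comp_eq_of_ker_le {M N P : Type*} [AddCommGroup M] [AddCommGroup N]
    [AddCommGroup P] [Module k M] [Module k N] [Module k P] {f : M →ₗ[k] N} {g : M →ₗ[k] P}
    (h : LinearMap.ker f ≤ LinearMap.ker g) : ∃ e : N →ₗ[k] P, e ∘ₗ f = g := by
  obtain ⟨l, hl⟩ := LinearMap.exists_leftInverse_of_injective
    ((LinearMap.ker f).liftQ f le_rfl) (Submodule.ker_liftQ_eq_bot _ _ _ le_rfl)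
  refine ⟨(LinearMap.ker f).liftQ g h ∘ₗ l, LinearMap.ext fun x => ?_⟩
  have := DFunLike.congr_fun hl (Submodule.Quotient.mk x)
  simp only [LinearMap.comp_apply, Submodule.liftQ_apply, LinearMap.id_apply] at this ⊢
  rw [this, Submodule.liftQ_apply]

end Contraction

/-! ### Words as a basis of the free algebra, and the filtration by length. -/

section Monomials

variable {k ι : Type*} [Field k]

theorem FreeAlgebra.basisFreeMonoid_ofList (w : List ι) :
    FreeAlgebra.basisFreeMonoid k ι (FreeMonoid.ofList w) = (w.map (FreeAlgebra.ι k)).prod := by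
  simp [FreeAlgebra.basisFreeMonoid, FreeAlgebra.equivMonoidAlgebraFreeMonoid,
    FreeMonoid.lift_apply]

theorem FreeAlgebra.span_words :
    Submodule.span k (Set.range fun w : List ι => (w.map (FreeAlgebra.ι k)).prod) = ⊤ := by
  rw [← (FreeAlgebra.basisFreeMonoid k ι).span_eq]
  congr 1
  ext t
  constructor
  · rintro ⟨w, rfl⟩
    exact ⟨FreeMonoid.ofList w, FreeAlgebra.basisFreeMonoid_ofList w⟩
  · rintro ⟨w, rfl⟩
    exact ⟨FreeMonoid.toList w, (FreeAlgebra.basisFreeMonoid_ofList (FreeMonoid.toList w)).symm⟩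

theorem FreeAlgebra.linearMap_ext_words {M : Type*} [AddCommMonoid M] [Module k M]
    {f g : FreeAlgebra k ι →ₗ[k] M}
    (h : ∀ w : List ι, f (w.map (FreeAlgebra.ι k)).prod = g (w.map (FreeAlgebra.ι k)).prod) :
    f = g :=
  LinearMap.ext_on_range FreeAlgebra.span_words h

theorem FreeAlgebra.constr_word {M : Type*} [AddCommGroup M] [Module k M]
    (φ : FreeMonoid ι → M) (w : List ι) :
    (FreeAlgebra.basisFreeMonoid k ι).constr k φ (w.map (FreeAlgebra.ι k)).prod =
      φ (FreeMonoid.ofList w) := by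
  rw [← FreeAlgebra.basisFreeMonoid_ofList, Module.Basis.constr_basis]

variable (k ι) in
/-- Noncommutative polynomials that involve only words of length at most `r`. -/
def FreeAlgebra.lengthLE (r : ℕ) : Submodule k (FreeAlgebra k ι) :=
  Submodule.span k {t | ∃ w : List ι, w.length ≤ r ∧ t = (w.map (FreeAlgebra.ι k)).prod}

theorem FreeAlgebra.exists_mem_lengthLE (f : FreeAlgebra k ι) :
    ∃ r, f ∈ FreeAlgebra.lengthLE k ι r := by
  have hf : f ∈ Submodule.span k (Set.range fun w : List ι => (w.map (FreeAlgebra.ι k)).prod) := by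
    rw [FreeAlgebra.span_words]
    trivial
  have mono : ∀ {r s}, r ≤ s → FreeAlgebra.lengthLE k ι r ≤ FreeAlgebra.lengthLE k ι s :=
    fun h => Submodule.span_mono fun _ ⟨w, hw, e⟩ => ⟨w, hw.trans h, e⟩
  induction hf using Submodule.span_induction with
  | mem x h =>
    obtain ⟨w, rfl⟩ := h
    exact ⟨w.length, Submodule.subset_span ⟨w, le_rfl, rfl⟩⟩
  | zero => exact ⟨0, Submodule.zero_mem _⟩
  | add x y _ _ hx hy =>
    obtain ⟨r, hr⟩ := hx
    obtain ⟨s, hs⟩ := hy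
    exact ⟨max r s, Submodule.add_mem _ (mono (le_max_left _ _) hr) (mono (le_max_right _ _) hs)⟩
  | smul c x _ hx =>
    obtain ⟨r, hr⟩ := hx
    exact ⟨r, Submodule.smul_mem _ _ hr⟩

/-- Two linear maps that agree on the words of length at most `r` agree on `lengthLE r`. -/
theorem FreeAlgebra.linearMap_eq_of_mem_lengthLE {M : Type*} [AddCommMonoid M] [Module k M]
    {f g : FreeAlgebra k ι →ₗ[k] M} {r : ℕ} (h : ∀ w : List ι, w.length ≤ r →
      f (w.map (FreeAlgebra.ι k)).prod = g (w.map (FreeAlgebra.ι k)).prod) {x : FreeAlgebra k ι}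
    (hx : x ∈ FreeAlgebra.lengthLE k ι r) : f x = g x := by
  refine LinearMap.eqOn_span (s := {t | ∃ w : List ι, w.length ≤ r ∧
    t = (w.map (FreeAlgebra.ι k)).prod}) ?_ hx
  rintro _ ⟨w, hw, rfl⟩
  exact h w hw

end Monomials

/-! ### The comultiplication on words, contracted or with the variables killed on one side. -/

section FreeComul

variable {k G ι : Type*} [Field k] [CommGroup G]

namespace FreeEnv

variable (V : QuantumVars k G ι)

/-- The comultiplication of the free enveloping algebra. -/
def comul : FreeEnv V →ₐ[k] FreeEnv V ⊗[k] FreeEnv V :=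
  FreeEnv.lift (Env.grpDiag V ∅)
    (fun i => Env.gen V ∅ i ⊗ₜ 1 + Env.grp V ∅ (V.g i) ⊗ₜ Env.gen V ∅ i)
    (Env.skewPrim_mul_grpDiag V ∅)

@[simp] theorem comul_grp (a : G) : comul V (Env.grp V ∅ a) = Env.grp V ∅ a ⊗ₜ Env.grp V ∅ a :=
  FreeEnv.lift_grp a

@[simp] theorem comul_gen (i : ι) : comul V (Env.gen V ∅ i) =
    Env.gen V ∅ i ⊗ₜ 1 + Env.grp V ∅ (V.g i) ⊗ₜ Env.gen V ∅ i :=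
  FreeEnv.lift_gen i

theorem map_toEnv_comul {R : Set (FreeAlgebra k (G ⊕ ι))} (S : CharHopf V R) (a : FreeEnv V) :
    Algebra.TensorProduct.map (toEnv V R) (toEnv V R) (comul V a) = S.comul (toEnv V R a) := by
  have h : (Algebra.TensorProduct.map (toEnv V R) (toEnv V R)).comp (comul V) =
      S.comul.comp (toEnv V R) := by
    refine Env.algHom_ext (fun a => ?_) (fun i => ?_)
    · simp [S.comul_grp]
    · simp [S.comul_gen]
  exact DFunLike.congr_fun h a

variable {V}

theorem leftContract_comul_cons (ψ : FreeEnv V →ₗ[k] k) (i : ι) (w : List ι) :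
    leftContract ψ (comul V (Env.word V ∅ (i :: w))) =
      leftContract (ψ ∘ₗ LinearMap.mulLeft k (Env.gen V ∅ i)) (comul V (Env.word V ∅ w)) +
      Env.gen V ∅ i * leftContract (ψ ∘ₗ LinearMap.mulLeft k (Env.grp V ∅ (V.g i)))
        (comul V (Env.word V ∅ w)) := by
  rw [Env.word_cons, map_mul, comul_gen, add_mul, map_add, leftContract_tmul_mul,
    leftContract_tmul_mul, one_mul]

theorem rightContract_comul_cons (ψ : FreeEnv V →ₗ[k] k) (i : ι) (w : List ι) :
    rightContract ψ (comul V (Env.word V ∅ (i :: w))) =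
      Env.gen V ∅ i * rightContract ψ (comul V (Env.word V ∅ w)) +
      Env.grp V ∅ (V.g i) * rightContract (ψ ∘ₗ LinearMap.mulLeft k (Env.gen V ∅ i))
        (comul V (Env.word V ∅ w)) := by
  rw [Env.word_cons, map_mul, comul_gen, add_mul, map_add, rightContract_tmul_mul,
    rightContract_tmul_mul, LinearMap.mulLeft_one, LinearMap.comp_id]

/-- In Δ(w) every left factor other than that of w ⊗ 1 is, up to scalars, a shorter word times a
group element, so only w ⊗ 1 survives the contraction. -/
theorem leftContract_comul_word {w : List ι} {ψ : FreeEnv V →ₗ[k] k}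
    (h : ∀ u a, u.length < w.length → ψ (Env.word V ∅ u * Env.grp V ∅ a) = 0) :
    leftContract ψ (comul V (Env.word V ∅ w)) = ψ (Env.word V ∅ w) • 1 := by
  induction w generalizing ψ with
  | nil => simp [Algebra.TensorProduct.one_def]
  | cons i w ih =>
    have h0 : ∀ u a, u.length < w.length + 1 → ψ (Env.grp V ∅ a * Env.word V ∅ u) = 0 := by
      intro u a hu
      rw [Env.grp_mul_word, map_smul, h u a (by simpa using hu), smul_zero]
    rw [leftContract_comul_cons, ih, ih]
    · simp [h0]
    · intro u a hu
      rw [LinearMap.comp_apply, LinearMap.mulLeft_apply, ← mul_assoc, Env.grp_mul_word,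
        smul_mul_assoc, mul_assoc, ← Env.grp_mul, map_smul, h _ _ (by simp; omega), smul_zero]
    · intro u a hu
      rw [LinearMap.comp_apply, LinearMap.mulLeft_apply, ← mul_assoc, ← Env.word_cons]
      exact h _ _ (by simpa using hu)

/-- Here the surviving term is g_w ⊗ w, all other right factors being shorter words. -/
theorem rightContract_comul_word {w : List ι} {ψ : FreeEnv V →ₗ[k] k}
    (h : ∀ u a, u.length < w.length → ψ (Env.word V ∅ u * Env.grp V ∅ a) = 0) :
    rightContract ψ (comul V (Env.word V ∅ w)) =
      ψ (Env.word V ∅ w) • Env.grp V ∅ (V.gWord w) := by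
  induction w generalizing ψ with
  | nil => simp [Algebra.TensorProduct.one_def, Env.grp_one]
  | cons i w ih =>
    have h0 : ψ (Env.word V ∅ w) = 0 := by
      simpa [Env.grp_one] using h w 1 (by simp)
    rw [rightContract_comul_cons, ih, ih]
    · simp [h0, Env.grp_mul]
    · intro u a hu
      rw [LinearMap.comp_apply, LinearMap.mulLeft_apply, ← mul_assoc, ← Env.word_cons]
      exact h _ _ (by simpa using hu)
    · intro u a hu
      exact h u a (by simp; omega)

end FreeEnv

namespace CharHopf

variable {V : QuantumVars k G ι} {F : Set (FreeAlgebra k ι)}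

/-- For a homomorphism `γ` on `G`, the linear map `w a ↦ w a γ(a)`, for words `w` and `a ∈ G`. -/
def twist (S : CharHopf V (polyEmb k G ι '' F)) (γ : G →* Quant V F) : Quant V F →ₗ[k] Quant V F :=
  LinearMap.mul' k _ ∘ₗ
    (Algebra.TensorProduct.map (AlgHom.id k _) (S.grpLift γ)).toLinearMap ∘ₗ S.comul.toLinearMap

/-- All terms of Δ(w) except w ⊗ 1 have a variable in the right factor. -/
theorem map_grpLift_comul_word (S : CharHopf V (polyEmb k G ι '' F)) {T : Type*} [Ring T]
    [Algebra k T] (γ : G →* T) (w : List ι) :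
    Algebra.TensorProduct.map (AlgHom.id k (Quant V F)) (S.grpLift γ) (S.comul (Env.word V _ w)) =
      Env.word V _ w ⊗ₜ 1 := by
  induction w with
  | nil => simp [Algebra.TensorProduct.one_def]
  | cons i w ih => simp [ih, S.comul_gen]

theorem twist_word_mul_grp (S : CharHopf V (polyEmb k G ι '' F)) (γ : G →* Quant V F)
    (w : List ι) (a : G) : S.twist γ (Env.word V _ w * Env.grp V _ a) =
      Env.word V _ w * Env.grp V _ a * γ a := by
  rw [twist, LinearMap.comp_apply, LinearMap.comp_apply, AlgHom.toLinearMap_apply,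
    AlgHom.toLinearMap_apply, map_mul, map_mul, map_grpLift_comul_word, S.comul_grp]
  simp

/-- All terms of Δ(w) except g_w ⊗ w have a variable in the left factor. This recovers g_w from the
value of w in the quotient. -/
theorem map_grpLift_comul_word' (S : CharHopf V (polyEmb k G ι '' F)) {T : Type*} [Ring T]
    [Algebra k T] (γ : G →* T) (w : List ι) :
    Algebra.TensorProduct.map (S.grpLift γ) (AlgHom.id k (Quant V F)) (S.comul (Env.word V _ w)) =
      γ (V.gWord w) ⊗ₜ Env.word V _ w := by
  induction w with
  | nil => simp [Algebra.TensorProduct.one_def]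
  | cons i w ih => simp [ih, S.comul_gen]

end CharHopf

end FreeComul

/-! ### Derivatives as contractions of the comultiplication, and their vanishing when the group
stays independent. -/

section Derivatives

variable {k G ι₁ ι₂ : Type*} [Field k] [CommGroup G]
  (V₁ : QuantumVars k G ι₁) (V₂ : QuantumVars k G ι₂) (α : ι₁ → ι₂ → k)

theorem rightDer_word (j : ι₂) (w : List ι₁) :
    rightDer V₁ V₂ α j (w.map (FreeAlgebra.ι k)).prod = rightDerWord V₁ V₂ α j w :=
  FreeAlgebra.constr_word _ _

theorem leftDer_word (i : ι₁) (w : List ι₂) :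
    leftDer V₁ V₂ α i (w.map (FreeAlgebra.ι k)).prod = leftDerWord V₁ V₂ α i w :=
  FreeAlgebra.constr_word _ _

/-- The derivatives depend only on the coefficients `α i j` with `g i g j ≠ 1`. -/
theorem rightDer_congr {α β : ι₁ → ι₂ → k} {j : ι₂}
    (h : ∀ i, V₁.g i * V₂.g j ≠ 1 → α i j = β i j) :
    rightDer V₁ V₂ α j = rightDer V₁ V₂ β j := by
  refine FreeAlgebra.linearMap_ext_words fun w => ?_
  rw [rightDer_word, rightDer_word]
  induction w with
  | nil => rfl
  | cons i w ih =>
    rw [rightDerWord, rightDerWord, ih]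
    by_cases hg : V₁.g i * V₂.g j = 1
    · simp [hg, Env.grp_one]
    · rw [h i hg]

/-- The inverse of the character of `x j`, as a homomorphism to `k`. -/
def invChar (j : ι₂) : G →* k := (Units.coeHom k).comp (V₂.χ j)⁻¹

theorem invChar_apply (j : ι₂) (a : G) : invChar V₂ j a = (((V₂.χ j a)⁻¹ : kˣ) : k) := rfl

variable {V₁ V₂ α}

/-- The triangular representation `a ↦ diag(1, χ_j(a)⁻¹)`, `x i ↦ α i j E₁₂`. -/
def triangularRep {j : ι₂} (hα : ∀ i, V₁.χ i * V₂.χ j ≠ 1 → α i j = 0) :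
    FreeEnv V₁ →ₐ[k] Matrix (Fin 2) (Fin 2) k :=
  FreeEnv.lift
    { toFun := fun a => !![1, 0; 0, invChar V₂ j a]
      map_one' := by simp [Matrix.one_fin_two]
      map_mul' := fun a b => by simp }
    (fun i => !![0, α i j; 0, 0])
    (fun i a => by
      -- The corner entry must obey the rule x_i a = χ^i(a) a x_i. Where α_ij ≠ 0 the characters
      -- satisfy χ^i = (χ^j)⁻¹.
      have h : α i j * invChar V₂ j a = (V₁.χ i a : k) * α i j := by
        by_cases h : V₁.χ i * V₂.χ j = 1
        · have h' : V₁.χ i a * V₂.χ j a = 1 := DFunLike.congr_fun h a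
          rw [eq_inv_of_mul_eq_one_left h', invChar_apply, mul_comm]
        · simp [hα i h]
      ext p q
      fin_cases p <;> fin_cases q <;> simp [h])

variable {j : ι₂} (hα : ∀ i, V₁.χ i * V₂.χ j ≠ 1 → α i j = 0)

/-- The functional `w a ↦ χ_j(a)⁻¹ c_w`, where `c_w = α i j` for `w = x i` and `c_w = 0` for other
words. -/
def linCoeff : FreeEnv V₁ →ₗ[k] k where
  toFun b := triangularRep hα b 0 1
  map_add' := by simp
  map_smul' := by simp

/-- The homomorphism to `k` extending `χ_j⁻¹` by `x i ↦ 0`. -/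
def diagCoeff : FreeEnv V₁ →ₗ[k] k where
  toFun b := triangularRep hα b 1 1
  map_add' := by simp
  map_smul' := by simp

theorem linCoeff_one : linCoeff hα 1 = 0 := by simp [linCoeff]

theorem linCoeff_grp_mul (a : G) (b : FreeEnv V₁) :
    linCoeff hα (Env.grp V₁ ∅ a * b) = linCoeff hα b := by
  simp [linCoeff, triangularRep, Matrix.mul_apply]

theorem linCoeff_gen_mul (i : ι₁) (b : FreeEnv V₁) :
    linCoeff hα (Env.gen V₁ ∅ i * b) = α i j * diagCoeff hα b := by
  simp [linCoeff, diagCoeff, triangularRep, Matrix.mul_apply]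

theorem diagCoeff_one : diagCoeff hα 1 = 1 := by simp [diagCoeff]

theorem diagCoeff_grp_mul (a : G) (b : FreeEnv V₁) :
    diagCoeff hα (Env.grp V₁ ∅ a * b) = invChar V₂ j a * diagCoeff hα b := by
  simp [diagCoeff, triangularRep, Matrix.mul_apply]

theorem diagCoeff_gen_mul (i : ι₁) (b : FreeEnv V₁) :
    diagCoeff hα (Env.gen V₁ ∅ i * b) = 0 := by
  simp [diagCoeff, triangularRep, Matrix.mul_apply]

theorem diagCoeff_grp (a : G) : diagCoeff hα (Env.grp V₁ ∅ a) = invChar V₂ j a := by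
  simpa [diagCoeff_one] using diagCoeff_grp_mul hα a 1

theorem diagCoeff_word_cons (i : ι₁) (w : List ι₁) :
    diagCoeff hα (Env.word V₁ ∅ (i :: w)) = 0 := by
  rw [Env.word_cons, diagCoeff_gen_mul]

theorem linCoeff_word_mul_grp (w : List ι₁) (a : G) :
    linCoeff hα (Env.word V₁ ∅ w * Env.grp V₁ ∅ a) =
      linCoeff hα (Env.word V₁ ∅ w) * invChar V₂ j a := by
  cases w with
  | nil =>
    have h := linCoeff_grp_mul hα a 1
    rw [mul_one] at h
    simp [h, linCoeff_one]
  | cons i w =>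
    rw [Env.word_cons, mul_assoc, linCoeff_gen_mul, linCoeff_gen_mul, mul_assoc]
    congr 1
    cases w with
    | nil => simp [diagCoeff_grp, diagCoeff_one]
    | cons i w => rw [Env.word_cons, mul_assoc, diagCoeff_gen_mul, diagCoeff_gen_mul, zero_mul]

/-- Only one-letter words have a nonzero coefficient, so the condition on letters is enough. -/
theorem linCoeff_word_eq_zero (hα1 : ∀ i, V₁.g i * V₂.g j = 1 → α i j = 0) {w : List ι₁}
    (hw : V₁.gWord w * V₂.g j = 1) : linCoeff hα (Env.word V₁ ∅ w) = 0 := by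
  cases w with
  | nil => exact linCoeff_one hα
  | cons i w =>
    rw [Env.word_cons, linCoeff_gen_mul]
    cases w with
    | nil => rw [hα1 i (by simpa using hw), zero_mul]
    | cons i w => rw [diagCoeff_word_cons, mul_zero]

theorem χWord_apply_eq (hp : ∀ i, V₁.χ i (V₂.g j) * V₂.χ j (V₁.g i) = 1) (w : List ι₁) :
    V₁.χWord w (V₂.g j) = (V₂.χ j (V₁.gWord w))⁻¹ := by
  induction w with
  | nil => simp
  | cons i w ih =>
    simp [ih, eq_inv_of_mul_eq_one_left (hp i), mul_comm]

/-- Only g_w ⊗ w contributes, with the scalar χ^j(g_w)⁻¹. By p_ij p_ji = 1 this is the factor p(w,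
x_j) in the Leibniz rule of the derivative. -/
theorem leftContract_diagCoeff (hp : ∀ i, V₁.χ i (V₂.g j) * V₂.χ j (V₁.g i) = 1) (w : List ι₁) :
    leftContract (diagCoeff hα) (FreeEnv.comul V₁ (Env.word V₁ ∅ w)) =
      (V₁.χWord w (V₂.g j) : k) • Env.word V₁ ∅ w := by
  induction w with
  | nil => simp [Algebra.TensorProduct.one_def, diagCoeff_one]
  | cons i w ih =>
    have h1 : diagCoeff hα ∘ₗ LinearMap.mulLeft k (Env.gen V₁ ∅ i) = (0 : k) • diagCoeff hα := by
      ext b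
      simp [diagCoeff_gen_mul]
    have h2 : diagCoeff hα ∘ₗ LinearMap.mulLeft k (Env.grp V₁ ∅ (V₁.g i)) =
        (V₁.χ i (V₂.g j) : k) • diagCoeff hα := by
      ext b
      simp [diagCoeff_grp_mul, invChar_apply, eq_inv_of_mul_eq_one_left (hp i)]
    rw [FreeEnv.leftContract_comul_cons, h1, h2, leftContract_smul, leftContract_smul, ih]
    simp [smul_smul]

theorem rightContract_diagCoeff (w : List ι₁) :
    rightContract (diagCoeff hα) (FreeEnv.comul V₁ (Env.word V₁ ∅ w)) = Env.word V₁ ∅ w := by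
  induction w with
  | nil => simp [Algebra.TensorProduct.one_def, diagCoeff_one]
  | cons i w ih =>
    have h1 : diagCoeff hα ∘ₗ LinearMap.mulLeft k (Env.gen V₁ ∅ i) = (0 : k) • diagCoeff hα := by
      ext b
      simp [diagCoeff_gen_mul]
    rw [FreeEnv.rightContract_comul_cons, h1, rightContract_smul, ih]
    simp

/-- The partial derivative is a difference of two contractions of the comultiplication. -/
theorem rightDerWord_eq (hp : ∀ i, V₁.χ i (V₂.g j) * V₂.χ j (V₁.g i) = 1) (w : List ι₁) :
    rightDerWord V₁ V₂ α j w =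
      leftContract (linCoeff hα) (FreeEnv.comul V₁ (Env.word V₁ ∅ w)) -
        rightContract (linCoeff hα) (FreeEnv.comul V₁ (Env.word V₁ ∅ w)) *
          Env.grp V₁ ∅ (V₂.g j) := by
  induction w with
  | nil => simp [rightDerWord, Algebra.TensorProduct.one_def, linCoeff_one]
  | cons i w ih =>
    have h1 : linCoeff hα ∘ₗ LinearMap.mulLeft k (Env.gen V₁ ∅ i) = α i j • diagCoeff hα := by
      ext b
      simp [linCoeff_gen_mul]
    have h2 : linCoeff hα ∘ₗ LinearMap.mulLeft k (Env.grp V₁ ∅ (V₁.g i)) = linCoeff hα := by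
      ext b
      simp [linCoeff_grp_mul]
    rw [FreeEnv.rightContract_comul_cons, FreeEnv.leftContract_comul_cons, h1, h2,
      rightContract_smul, leftContract_smul, leftContract_diagCoeff hα hp, rightContract_diagCoeff,
      rightDerWord, ih, ← Env.word, Env.grp_mul, add_mul]
    simp only [mul_smul_comm, smul_mul_assoc, mul_assoc, sub_mul, one_mul, mul_sub,
      Env.word_mul_grp, smul_sub, smul_smul, mul_comm (α i j)]
    abel

variable {F₁ : Set (FreeAlgebra k ι₁)}

/-- The relation `x i y = p y x i + α (1 - g i g j)` for all letters gives the derivative of a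
polynomial as a skew commutator. -/
theorem rightDer_eq_commutator {T : Type*} [Ring T] [Algebra k T] (θ : Quant V₁ F₁ →ₐ[k] T) {y : T}
    (hy : ∀ i, θ (Env.gen V₁ _ i) * y = (V₁.χ i (V₂.g j) : k) • (y * θ (Env.gen V₁ _ i)) +
      α i j • (1 - θ (Env.grp V₁ _ (V₁.g i * V₂.g j)))) (f : FreeAlgebra k ι₁) :
    θ (Env.polyEval V₁ _ f) * y =
      y * θ (Env.grp V₁ _ (V₂.g j)⁻¹ * Env.polyEval V₁ _ f * Env.grp V₁ _ (V₂.g j)) +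
        θ (FreeEnv.toEnv V₁ (polyEmb k G ι₁ '' F₁) (rightDer V₁ V₂ α j f)) := by
  have hw : ∀ w : List ι₁, θ (Env.word V₁ _ w) * y =
      (V₁.χWord w (V₂.g j) : k) • (y * θ (Env.word V₁ _ w)) +
        θ (FreeEnv.toEnv V₁ (polyEmb k G ι₁ '' F₁) (rightDerWord V₁ V₂ α j w)) := by
    intro w
    induction w with
    | nil => simp [rightDerWord]
    | cons i w ih =>
      rw [Env.word_cons, map_mul, mul_assoc, ih, mul_add, mul_smul_comm, ← mul_assoc, hy,
        rightDerWord, ← Env.word]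
      simp only [map_add, map_sub, map_one, map_mul, map_smul, FreeEnv.toEnv_grp,
        FreeEnv.toEnv_word, FreeEnv.toEnv_gen, add_mul, smul_add, smul_mul_assoc, smul_smul,
        mul_assoc, QuantumVars.χWord_cons, MonoidHom.mul_apply, Units.val_mul]
      rw [mul_comm (V₁.χ i (V₂.g j) : k), add_assoc]
  -- The scalar χ^w(g_j) is conjugation of w by g_j. In this form both sides are linear in f, so the
  -- formula passes from words to all polynomials without homogeneity.
  have h : LinearMap.mulRight k y ∘ₗ θ.toLinearMap ∘ₗ
      (Env.polyEval V₁ (polyEmb k G ι₁ '' F₁)).toLinearMap =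
      LinearMap.mulLeft k y ∘ₗ θ.toLinearMap ∘ₗ LinearMap.mulRight k (Env.grp V₁ _ (V₂.g j)) ∘ₗ
      LinearMap.mulLeft k (Env.grp V₁ _ (V₂.g j)⁻¹) ∘ₗ
      (Env.polyEval V₁ (polyEmb k G ι₁ '' F₁)).toLinearMap +
      θ.toLinearMap ∘ₗ (FreeEnv.toEnv V₁ (polyEmb k G ι₁ '' F₁)).toLinearMap ∘ₗ
      rightDer V₁ V₂ α j := by
    refine FreeAlgebra.linearMap_ext_words fun w => ?_
    simp only [LinearMap.comp_apply, LinearMap.add_apply, LinearMap.mulRight_apply,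
      LinearMap.mulLeft_apply, AlgHom.toLinearMap_apply, rightDer_word, Env.polyEval_word]
    rw [hw, mul_assoc, Env.word_mul_grp, mul_smul_comm, ← mul_assoc, Env.grp_inv_mul_grp, one_mul,
      map_smul, mul_smul_comm]
  exact DFunLike.congr_fun h f

/-- The values at words of the functional `linCoeff`, multiplied by `1 - g_w g_j`. -/
def groupPart : FreeAlgebra k ι₁ →ₗ[k] (G →₀ k) :=
  (FreeAlgebra.basisFreeMonoid k ι₁).constr k (fun w =>
    linCoeff hα (Env.word V₁ ∅ (FreeMonoid.toList w)) •
      (Finsupp.single 1 1 - Finsupp.single (V₁.gWord (FreeMonoid.toList w) * V₂.g j) 1))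

theorem groupPart_word (w : List ι₁) : groupPart hα (w.map (FreeAlgebra.ι k)).prod =
    linCoeff hα (Env.word V₁ ∅ w) •
      (Finsupp.single 1 1 - Finsupp.single (V₁.gWord w * V₂.g j) 1) :=
  FreeAlgebra.constr_word _ _

/-- For words with nonzero coefficient the element g_w g_j differs from 1, so the second summand of
1 - g_w g_j does not disturb the coefficient at 1. -/
theorem groupPart_apply_one (hα1 : ∀ i, V₁.g i * V₂.g j = 1 → α i j = 0) (f : FreeAlgebra k ι₁) :
    groupPart hα f 1 = linCoeff hα (Env.polyEval V₁ ∅ f) := by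
  have h : Finsupp.lapply 1 ∘ₗ groupPart hα =
      linCoeff hα ∘ₗ (Env.polyEval V₁ ∅).toLinearMap := by
    refine FreeAlgebra.linearMap_ext_words fun w => ?_
    simp only [LinearMap.comp_apply, AlgHom.toLinearMap_apply, Env.polyEval_word, groupPart_word]
    by_cases hw : V₁.gWord w * V₂.g j = 1
    · simp [linCoeff_word_eq_zero hα hα1 hw]
    · simp [hw]
  exact DFunLike.congr_fun h f

/-- If the functional `linCoeff` descends to the quotient on words of length less than `r`, then the
derivatives of the relations of length at most `r` lie in the group algebra. -/
theorem toEnv_rightDer_eq (S₁ : CharHopf V₁ (polyEmb k G ι₁ '' F₁))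
    (hp : ∀ i, V₁.χ i (V₂.g j) * V₂.χ j (V₁.g i) = 1) {r : ℕ} (φ : Quant V₁ F₁ →ₗ[k] k)
    (hφ : ∀ u a, u.length < r → φ (Env.word V₁ _ u * Env.grp V₁ _ a) =
      linCoeff hα (Env.word V₁ ∅ u * Env.grp V₁ ∅ a)) {f : FreeAlgebra k ι₁}
    (hf : f ∈ FreeAlgebra.lengthLE k ι₁ r) (hf0 : Env.polyEval V₁ (polyEmb k G ι₁ '' F₁) f = 0) :
    FreeEnv.toEnv V₁ (polyEmb k G ι₁ '' F₁) (rightDer V₁ V₂ α j f) =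
      Finsupp.linearCombination k (Env.grp V₁ (polyEmb k G ι₁ '' F₁)) (groupPart hα f) := by
  set q := FreeEnv.toEnv V₁ (polyEmb k G ι₁ '' F₁) with hq
  -- The defect of φ as a descent of the functional. It vanishes on words shorter than r, so its
  -- contractions on words of length at most r have a single term.
  set ψ : FreeEnv V₁ →ₗ[k] k := φ ∘ₗ q.toLinearMap - linCoeff hα with hψ
  have hψ0 : ∀ u a, u.length < r → ψ (Env.word V₁ ∅ u * Env.grp V₁ ∅ a) = 0 := by
    intro u a hu
    simp [hψ, hq, hφ u a hu]
  have hL : ∀ w : List ι₁, w.length ≤ r →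
      q (leftContract (linCoeff hα) (FreeEnv.comul V₁ (Env.word V₁ ∅ w))) =
      leftContract φ (S₁.comul (Env.word V₁ _ w)) - φ (Env.word V₁ _ w) • 1 +
        linCoeff hα (Env.word V₁ ∅ w) • 1 := by
    intro w hw
    have h := FreeEnv.leftContract_comul_word (w := w) (ψ := ψ)
      (fun u a hu => hψ0 u a (hu.trans_le hw))
    rw [hψ, leftContract_sub] at h
    have h' := congrArg q h
    rw [map_sub, map_leftContract, FreeEnv.map_toEnv_comul V₁ S₁] at h'
    rw [sub_eq_iff_eq_add, ← sub_eq_iff_eq_add'] at h'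
    rw [← h']
    simp only [hq, LinearMap.sub_apply, LinearMap.comp_apply, AlgHom.toLinearMap_apply,
      FreeEnv.toEnv_word, map_smul, map_sub, map_one, sub_smul]
    abel
  -- The single term contains φ(w) g_w, and g_w depends on the word. Rewritten as a contraction of
  -- Δ(w) with the variables killed on the left, it becomes a linear function of the value of w in
  -- H₁.
  have hR : ∀ w : List ι₁, w.length ≤ r →
      q (rightContract (linCoeff hα) (FreeEnv.comul V₁ (Env.word V₁ ∅ w))) =
      rightContract φ (S₁.comul (Env.word V₁ _ w)) -
        rightContract φ (Algebra.TensorProduct.map (S₁.grpLift (Env.grpHom V₁ (polyEmb k G ι₁ '' F₁)))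
          (AlgHom.id k (Quant V₁ F₁)) (S₁.comul (Env.word V₁ _ w))) +
        linCoeff hα (Env.word V₁ ∅ w) • Env.grp V₁ _ (V₁.gWord w) := by
    intro w hw
    have h := FreeEnv.rightContract_comul_word (w := w) (ψ := ψ)
      (fun u a hu => hψ0 u a (hu.trans_le hw))
    rw [hψ, rightContract_sub] at h
    have h' := congrArg q h
    rw [map_sub, map_rightContract, FreeEnv.map_toEnv_comul V₁ S₁] at h'
    rw [sub_eq_iff_eq_add, ← sub_eq_iff_eq_add'] at h'
    rw [← h', S₁.map_grpLift_comul_word']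
    simp only [hq, LinearMap.sub_apply, LinearMap.comp_apply, AlgHom.toLinearMap_apply,
      FreeEnv.toEnv_word, map_smul, map_sub, FreeEnv.toEnv_grp, sub_smul, rightContract_tmul,
      Env.grpHom_apply]
    abel
  set P := Env.polyEval V₁ (polyEmb k G ι₁ '' F₁) with hP
  -- All summands except the last factor through evaluation in H₁ and hence vanish at f.
  have key := FreeAlgebra.linearMap_eq_of_mem_lengthLE (r := r)
    (f := q.toLinearMap ∘ₗ rightDer V₁ V₂ α j)
    (g := leftContract φ ∘ₗ S₁.comul.toLinearMap ∘ₗ P.toLinearMap -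
      (LinearMap.toSpanSingleton k _ 1 ∘ₗ φ ∘ₗ P.toLinearMap) -
      LinearMap.mulRight k (Env.grp V₁ _ (V₂.g j)) ∘ₗ
        (rightContract φ ∘ₗ S₁.comul.toLinearMap ∘ₗ P.toLinearMap -
        rightContract φ ∘ₗ (Algebra.TensorProduct.map (S₁.grpLift (Env.grpHom V₁ (polyEmb k G ι₁ '' F₁)))
          (AlgHom.id k (Quant V₁ F₁))).toLinearMap ∘ₗ S₁.comul.toLinearMap ∘ₗ P.toLinearMap) +
      Finsupp.linearCombination k (Env.grp V₁ (polyEmb k G ι₁ '' F₁)) ∘ₗ groupPart hα)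
    (fun w hw => by
      simp only [LinearMap.comp_apply, LinearMap.add_apply, LinearMap.sub_apply,
        AlgHom.toLinearMap_apply, rightDer_word, LinearMap.mulRight_apply, groupPart_word,
        LinearMap.toSpanSingleton_apply]
      rw [rightDerWord_eq hα hp, map_sub, map_mul, hL w hw, hR w hw, hP, Env.polyEval_word, hq,
        FreeEnv.toEnv_grp, map_smul, map_sub, Finsupp.linearCombination_single,
        Finsupp.linearCombination_single, one_smul, one_smul, Env.grp_one, Env.grp_mul, add_mul,
        smul_sub, smul_mul_assoc]
      abel) hf
  simpa [hf0] using key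

/-- If the coefficient functional kills the relations of length at most r, it factors through the
values of such polynomials in H₁ and extends linearly. The Hopf structure then gives control over
words multiplied by group elements. -/
theorem exists_extend_linCoeff (S₁ : CharHopf V₁ (polyEmb k G ι₁ '' F₁)) {r : ℕ}
    (h : ∀ f ∈ FreeAlgebra.lengthLE k ι₁ r, Env.polyEval V₁ (polyEmb k G ι₁ '' F₁) f = 0 →
      linCoeff hα (Env.polyEval V₁ ∅ f) = 0) :
    ∃ φ : Quant V₁ F₁ →ₗ[k] k, ∀ u a, u.length ≤ r →
      φ (Env.word V₁ _ u * Env.grp V₁ _ a) =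
        linCoeff hα (Env.word V₁ ∅ u * Env.grp V₁ ∅ a) := by
  obtain ⟨e, he⟩ := LinearMap.exists_comp_eq_of_ker_le
    (f := (Env.polyEval V₁ (polyEmb k G ι₁ '' F₁)).toLinearMap ∘ₗ
      (FreeAlgebra.lengthLE k ι₁ r).subtype)
    (g := linCoeff hα ∘ₗ (Env.polyEval V₁ ∅).toLinearMap ∘ₗ
      (FreeAlgebra.lengthLE k ι₁ r).subtype)
    (fun x hx => h x x.2 hx)
  -- With this choice the twist sends w a to χ^j(a)⁻¹ w: it removes the group element and leaves the
  -- scalar by which the coefficient functional depends on it.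
  let γ : G →* Quant V₁ F₁ :=
    { toFun := fun a => invChar V₂ j a • Env.grp V₁ _ a⁻¹
      map_one' := by simp [Env.grp_one]
      map_mul' := fun a b => by
        rw [map_mul, mul_inv, Env.grp_mul, smul_mul_smul_comm] }
  refine ⟨e ∘ₗ S₁.twist γ, fun u a hu => ?_⟩
  have hu' := DFunLike.congr_fun he ⟨(u.map (FreeAlgebra.ι k)).prod,
    Submodule.subset_span ⟨u, hu, rfl⟩⟩
  simp only [LinearMap.comp_apply, AlgHom.toLinearMap_apply, Submodule.subtype_apply,
    Env.polyEval_word] at hu'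
  rw [LinearMap.comp_apply, S₁.twist_word_mul_grp, linCoeff_word_mul_grp, ← hu']
  simp [γ, mul_assoc, Env.grp_mul_grp_inv, mul_comm]

/-- If in some algebra `y` satisfies the commutation relations with the `x i` and the group stays
linearly independent, then the derivatives of all relations vanish, provided that `α i j = 0`
whenever `g i g j = 1`. -/
theorem toEnv_rightDer_eq_zero_of_reduced (S₁ : CharHopf V₁ (polyEmb k G ι₁ '' F₁))
    (hp : ∀ i, V₁.χ i (V₂.g j) * V₂.χ j (V₁.g i) = 1)
    (hα : ∀ i, V₁.χ i * V₂.χ j ≠ 1 → α i j = 0)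
    (hα1 : ∀ i, V₁.g i * V₂.g j = 1 → α i j = 0)
    {T : Type*} [Ring T] [Algebra k T] (θ : Quant V₁ F₁ →ₐ[k] T) {y : T}
    (hy : ∀ i, θ (Env.gen V₁ _ i) * y = (V₁.χ i (V₂.g j) : k) • (y * θ (Env.gen V₁ _ i)) +
      α i j • (1 - θ (Env.grp V₁ _ (V₁.g i * V₂.g j))))
    (hind : LinearIndependent k (fun a => θ (Env.grp V₁ _ a))) {f : FreeAlgebra k ι₁}
    (hf : Env.polyEval V₁ (polyEmb k G ι₁ '' F₁) f = 0) :
    FreeEnv.toEnv V₁ (polyEmb k G ι₁ '' F₁) (rightDer V₁ V₂ α j f) = 0 := by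
  have step : ∀ r, (∃ φ : Quant V₁ F₁ →ₗ[k] k, ∀ u a, u.length < r →
      φ (Env.word V₁ _ u * Env.grp V₁ _ a) =
        linCoeff hα (Env.word V₁ ∅ u * Env.grp V₁ ∅ a)) →
      ∀ f ∈ FreeAlgebra.lengthLE k ι₁ r, Env.polyEval V₁ (polyEmb k G ι₁ '' F₁) f = 0 →
      groupPart hα f = 0 ∧
        FreeEnv.toEnv V₁ (polyEmb k G ι₁ '' F₁) (rightDer V₁ V₂ α j f) = 0 := by
    rintro r ⟨φ, hφ⟩ f hfr hf0
    have h1 := toEnv_rightDer_eq hα S₁ hp φ hφ hfr hf0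
    have h2 := rightDer_eq_commutator θ hy f
    -- For f = 0 in H₁ the commutator formula leaves only θ(f') = 0. Since f' lies in k[G],
    -- independence of the group elements in T makes its coefficients vanish.
    rw [hf0, map_zero, zero_mul, mul_zero, zero_mul, map_zero, mul_zero, zero_add] at h2
    have h3 : groupPart hα f = 0 := by
      rw [linearIndependent_iff] at hind
      refine hind _ ?_
      rw [h2, h1, Finsupp.linearCombination_apply, Finsupp.linearCombination_apply,
        map_finsuppSum]
      simp
    exact ⟨h3, by rw [h1, h3, map_zero]⟩
  have all : ∀ r, ∃ φ : Quant V₁ F₁ →ₗ[k] k, ∀ u a, u.length < r →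
      φ (Env.word V₁ _ u * Env.grp V₁ _ a) =
        linCoeff hα (Env.word V₁ ∅ u * Env.grp V₁ ∅ a) := by
    intro r
    induction r with
    | zero => exact ⟨0, fun u a hu => absurd hu (Nat.not_lt_zero _)⟩
    | succ r ih =>
      -- The coefficient at 1 of the vanishing group part is the value of the functional at f, so it
      -- kills the relations of length r as well.
      obtain ⟨φ, hφ⟩ := exists_extend_linCoeff hα S₁ (r := r) (fun f hf hf0 => by
        rw [← groupPart_apply_one hα hα1, (step r ih f hf hf0).1, Finsupp.zero_apply])
      exact ⟨φ, fun u a hu => hφ u a (Nat.lt_succ_iff.1 hu)⟩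
  obtain ⟨r, hr⟩ := FreeAlgebra.exists_mem_lengthLE f
  exact (step r (all r) f hr hf).2

/-- If in some algebra `y` satisfies the commutation relations with the `x i` and the group stays
linearly independent, then the derivatives of all relations vanish. -/
theorem toEnv_rightDer_eq_zero (S₁ : CharHopf V₁ (polyEmb k G ι₁ '' F₁))
    (hp : ∀ i, V₁.χ i (V₂.g j) * V₂.χ j (V₁.g i) = 1)
    (hα : ∀ i, V₁.χ i * V₂.χ j ≠ 1 → α i j = 0)
    {T : Type*} [Ring T] [Algebra k T] (θ : Quant V₁ F₁ →ₐ[k] T) {y : T}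
    (hy : ∀ i, θ (Env.gen V₁ _ i) * y = (V₁.χ i (V₂.g j) : k) • (y * θ (Env.gen V₁ _ i)) +
      α i j • (1 - θ (Env.grp V₁ _ (V₁.g i * V₂.g j))))
    (hind : LinearIndependent k (fun a => θ (Env.grp V₁ _ a))) {f : FreeAlgebra k ι₁}
    (hf : Env.polyEval V₁ (polyEmb k G ι₁ '' F₁) f = 0) :
    FreeEnv.toEnv V₁ (polyEmb k G ι₁ '' F₁) (rightDer V₁ V₂ α j f) = 0 := by
  classical
  -- Where g_i g_j = 1 the term α_ij (1 - g_i g_j) is zero anyway, so neither the relations nor the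
  -- derivatives change.
  let β : ι₁ → ι₂ → k := fun i j => if V₁.g i * V₂.g j = 1 then 0 else α i j
  have hβ : ∀ i, V₁.g i * V₂.g j ≠ 1 → α i j = β i j := fun i h => (if_neg h).symm
  rw [rightDer_congr V₁ V₂ hβ]
  refine toEnv_rightDer_eq_zero_of_reduced (y := y) S₁ hp (fun i h => ?_) (fun i h => if_pos h) θ
    (fun i => ?_) hind hf
  · simp [β, hα i h]
  · rw [hy]
    by_cases h : V₁.g i * V₂.g j = 1
    · simp [h, Env.grp_one]
    · rw [hβ i h]

/-- Exchange of the two families: on homogeneous polynomials the derivative `leftDer` is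
proportional to `rightDer` for the exchanged families. -/
theorem leftDerWord_eq_rightDerWord (i : ι₁)
    (hp : ∀ j, V₁.χ i (V₂.g j) * V₂.χ j (V₁.g i) = 1) (w : List ι₂) :
    leftDerWord V₁ V₂ α i w = -(V₁.χ i (V₂.gWord w) : k) •
      rightDerWord V₂ V₁ (fun j i => -(V₂.χ j (V₁.g i) : k) * α i j) i w := by
  induction w with
  | nil => simp [leftDerWord, rightDerWord]
  | cons j w ih =>
    have h1 := χWord_apply_eq (V₁ := V₂) (V₂ := V₁) (j := i)
      (fun j => by rw [mul_comm]; exact hp j) w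
    have h2 : (V₁.χ i (V₂.g j) : k) * (V₂.χ j (V₁.g i) : k) = 1 := by
      rw [← Units.val_mul, hp, Units.val_one]
    have h3 : (V₁.χ i (V₂.gWord w) : k) * (V₂.χWord w (V₁.g i) : k) = 1 := by
      rw [h1, ← Units.val_mul, mul_inv_cancel, Units.val_one]
    rw [leftDerWord, ih, rightDerWord, smul_add, mul_comm (V₂.g j)]
    simp only [smul_mul_assoc, mul_smul_comm, smul_smul, QuantumVars.gWord_cons, map_mul,
      Units.val_mul]
    congr 2
    · linear_combination (-α i j * (V₁.χ i (V₂.gWord w) : k) * (V₂.χWord w (V₁.g i) : k)) * h2 -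
        α i j * h3
    · ring

/-- The factor -χ^i(g_w) relating the two derivatives on a word w depends only on g_w, hence is
common to all words of a homogeneous polynomial. -/
theorem leftDer_eq_smul_rightDer (i : ι₁) (hp : ∀ j, V₁.χ i (V₂.g j) * V₂.χ j (V₁.g i) = 1)
    {f : FreeAlgebra k ι₂} (hf : V₂.IsHomogeneous f) :
    ∃ c : kˣ, leftDer V₁ V₂ α i f = (c : k) •
      rightDer V₂ V₁ (fun j i => -(V₂.χ j (V₁.g i) : k) * α i j) i f := by
  obtain ⟨a, ψ, hf⟩ := hf
  refine ⟨-(V₁.χ i a), ?_⟩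
  induction hf using Submodule.span_induction with
  | mem x h =>
    obtain ⟨w, rfl, -, rfl⟩ := h
    rw [leftDer_word, rightDer_word, leftDerWord_eq_rightDerWord i hp, Units.val_neg]
  | zero => simp
  | add x y _ _ hx hy => rw [map_add, map_add, smul_add, hx, hy]
  | smul c x _ hx => rw [map_smul, map_smul, hx, smul_comm]

end Derivatives

/-! ### Necessity of the conditions on the derivatives. -/

section Embedding

variable {k G ι₁ ι₂ : Type*} [Field k] [CommGroup G]
  {V₁ : QuantumVars k G ι₁} {V₂ : QuantumVars k G ι₂} {F₁ : Set (FreeAlgebra k ι₁)}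
  {F₂ : Set (FreeAlgebra k ι₂)} {α : ι₁ → ι₂ → k}

/-- If the group embeds in the glued algebra, then the derivatives of the relations vanish. -/
theorem derivativesVanish_of_injective (hF₂ : ∀ h ∈ F₂, V₂.IsHomogeneous h)
    (S₁ : CharHopf V₁ (polyEmb k G ι₁ '' F₁)) (S₂ : CharHopf V₂ (polyEmb k G ι₂ '' F₂))
    (hp : ∀ i j, V₁.χ i (V₂.g j) * V₂.χ j (V₁.g i) = 1)
    (hα : ∀ i j, V₁.χ i * V₂.χ j ≠ 1 → α i j = 0)
    (S : CharHopf (glueVars V₁ V₂) (glueRel V₁ V₂ F₁ F₂ α))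
    (hinj : Function.Injective (Env.grp (glueVars V₁ V₂) (glueRel V₁ V₂ F₁ F₂ α))) :
    DerivativesVanish V₁ V₂ F₁ F₂ α := by
  have hind := S.linearIndependent_grp hinj
  refine ⟨fun i h hh => ?_, fun j f hf => ?_⟩
  · obtain ⟨c, hc⟩ := leftDer_eq_smul_rightDer (α := α) i (fun j => hp i j) (hF₂ h hh)
    rw [hc, map_smul]
    -- With the families exchanged, F₃ reads x_j x_i = p_ji x_i x_j - p_ji α_ij (1 - g_i g_j), after
    -- multiplication by p_ji = p_ij⁻¹. This explains the new coefficients.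
    have h0 : FreeEnv.toEnv V₂ (polyEmb k G ι₂ '' F₂)
        (rightDer V₂ V₁ (fun j i => -(V₂.χ j (V₁.g i) : k) * α i j) i h) = 0 := by
      refine toEnv_rightDer_eq_zero (y := Env.gen _ _ (Sum.inlₗ i)) S₂
        (fun j => by rw [mul_comm]; exact hp i j) ?_ (glueInr V₁ V₂ F₁ F₂ α) ?_ ?_
        (Quant.polyEval_eq_zero hh)
      · intro j hj
        rw [hα i j (fun h => hj (MonoidHom.ext fun a =>
          (mul_comm _ _).trans (DFunLike.congr_fun h a))), mul_zero]
      · intro j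
        have h2 : (V₂.χ j (V₁.g i) : k) * (V₁.χ i (V₂.g j) : k) = 1 := by
          rw [← Units.val_mul, mul_comm, hp, Units.val_one]
        rw [Glue.inr_gen, Glue.gen_mul_gen, Glue.inr_grp, smul_add, smul_smul, h2, one_smul,
          smul_smul, mul_comm (V₂.g j), neg_mul, neg_smul, add_neg_cancel_right]
      · simpa using hind
    rw [h0, smul_zero]
  · refine toEnv_rightDer_eq_zero (y := Env.gen _ _ (Sum.inrₗ j)) S₁ (fun i => hp i j)
      (fun i => hα i j) (glueInl V₁ V₂ F₁ F₂ α) (fun i => ?_) ?_ (Quant.polyEval_eq_zero hf)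
    · rw [Glue.inl_gen, Glue.gen_mul_gen, Glue.inl_grp]
    · simpa using hind

end Embedding

/-! ### Skew derivations as corner entries of triangular representations. -/

section TriangularDerivations

variable {k G ι₁ ι₂ : Type*} [Field k] [CommGroup G]
  {V₁ : QuantumVars k G ι₁} {V₂ : QuantumVars k G ι₂} {F₁ : Set (FreeAlgebra k ι₁)}
  {F₂ : Set (FreeAlgebra k ι₂)} {α : ι₁ → ι₂ → k}

theorem coeff_mul_char (hα : ∀ i j, V₁.χ i * V₂.χ j ≠ 1 → α i j = 0) (i : ι₁) (j : ι₂) (a : G) :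
    α i j * ((V₁.χ i a : k) * (V₂.χ j a : k)) = α i j := by
  by_cases h : V₁.χ i * V₂.χ j = 1
  · have h' : V₁.χ i a * V₂.χ j a = 1 := DFunLike.congr_fun h a
    rw [← Units.val_mul, h', Units.val_one, mul_one]
  · rw [hα i j h, zero_mul]

section Left

variable (V₂) in
/-- The action of the group in `leftTri`. -/
def leftTriGrp (R₂ : Set (FreeAlgebra k (G ⊕ ι₂))) (χ : G →* kˣ) :
    G →* Matrix (Fin 2) (Fin 2) (Env V₂ R₂) where
  toFun := fun a => !![(χ a : k) • Env.grp V₂ R₂ a, 0; 0, Env.grp V₂ R₂ a]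
  map_one' := by simp [Env.grp_one, Matrix.one_fin_two]
  map_mul' := fun a b => by simp [Env.grp_mul, smul_smul]

variable (V₁ V₂ α) in
/-- The action of a variable in `leftTri`. -/
def leftTriGen (R₂ : Set (FreeAlgebra k (G ⊕ ι₂))) (i : ι₁) (j : ι₂) :
    Matrix (Fin 2) (Fin 2) (Env V₂ R₂) :=
  !![(V₁.χ i (V₂.g j) : k) • Env.gen V₂ R₂ j, α i j • (1 - Env.grp V₂ R₂ (V₁.g i * V₂.g j));
    0, Env.gen V₂ R₂ j]

theorem grp_mul_sub_grp (R₂ : Set (FreeAlgebra k (G ⊕ ι₂))) (a b : G) :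
    (1 - Env.grp V₂ R₂ b) * Env.grp V₂ R₂ a = Env.grp V₂ R₂ a * (1 - Env.grp V₂ R₂ b) := by
  rw [sub_mul, mul_sub, ← Env.grp_mul, ← Env.grp_mul, mul_comm b, one_mul, mul_one]

theorem leftTriGen_mul_leftTriGrp (hα : ∀ i j, V₁.χ i * V₂.χ j ≠ 1 → α i j = 0)
    (R₂ : Set (FreeAlgebra k (G ⊕ ι₂))) (i : ι₁) (j : ι₂) (a : G) :
    leftTriGen V₁ V₂ α R₂ i j * leftTriGrp V₂ R₂ (V₁.χ i) a =
      (V₂.χ j a : k) • (leftTriGrp V₂ R₂ (V₁.χ i) a * leftTriGen V₁ V₂ α R₂ i j) := by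
  have h := coeff_mul_char hα i j a
  ext p q
  fin_cases p <;> fin_cases q <;>
    simp [leftTriGen, leftTriGrp, Env.gen_mul_grp, smul_smul, grp_mul_sub_grp]
  · ring_nf
  · conv_lhs => rw [← h]
    ring_nf

theorem lift_leftTriGen_word (i : ι₁) (w : List ι₂) :
    FreeAlgebra.lift k (leftTriGen V₁ V₂ α (polyEmb k G ι₂ '' F₂) i)
        (w.map (FreeAlgebra.ι k)).prod =
      !![(V₁.χ i (V₂.gWord w) : k) • Env.word V₂ _ w,
        FreeEnv.toEnv V₂ (polyEmb k G ι₂ '' F₂) (leftDerWord V₁ V₂ α i w);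
        0, Env.word V₂ _ w] := by
  induction w with
  | nil => simp [leftDerWord, Matrix.one_fin_two]
  | cons j w ih =>
    rw [List.map_cons, List.prod_cons, map_mul, ih, FreeAlgebra.lift_ι_apply, leftTriGen,
      leftDerWord, ← Env.word]
    simp [smul_smul, mul_comm, add_comm]

/-- The entries at f are f, its derivative, and f with each word w scaled by χ^i(g_w). Homogeneity
makes the last a multiple of f, so all three vanish. -/
theorem lift_leftTriGen_eq_zero {i : ι₁} {f : FreeAlgebra k ι₂} (hf : V₂.IsHomogeneous f)
    (hf0 : Env.polyEval V₂ (polyEmb k G ι₂ '' F₂) f = 0)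
    (hD : FreeEnv.toEnv V₂ (polyEmb k G ι₂ '' F₂) (leftDer V₁ V₂ α i f) = 0) :
    FreeAlgebra.lift k (leftTriGen V₁ V₂ α (polyEmb k G ι₂ '' F₂) i) f = 0 := by
  obtain ⟨c, ψ, hf⟩ := hf
  have h : FreeAlgebra.lift k (leftTriGen V₁ V₂ α (polyEmb k G ι₂ '' F₂) i) f =
      !![(V₁.χ i c : k) • Env.polyEval V₂ (polyEmb k G ι₂ '' F₂) f,
        FreeEnv.toEnv V₂ (polyEmb k G ι₂ '' F₂) (leftDer V₁ V₂ α i f);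
        0, Env.polyEval V₂ (polyEmb k G ι₂ '' F₂) f] := by
    clear hf0 hD
    induction hf using Submodule.span_induction with
    | mem x h =>
      obtain ⟨w, rfl, -, rfl⟩ := h
      rw [lift_leftTriGen_word, leftDer_word, Env.polyEval_word]
    | zero => ext p q; fin_cases p <;> fin_cases q <;> simp
    | add x y _ _ hx hy => rw [map_add, hx, hy]; simp
    | smul c x _ hx =>
      rw [map_smul, hx]
      ext p q
      fin_cases p <;> fin_cases q <;> simp
      exact smul_comm _ _ _
  rw [h, hf0, hD]
  ext p q
  fin_cases p <;> fin_cases q <;> simp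

/-- The triangular representation whose off-diagonal entry is the left derivative. -/
def leftTri (hF₂ : ∀ h ∈ F₂, V₂.IsHomogeneous h)
    (hα : ∀ i j, V₁.χ i * V₂.χ j ≠ 1 → α i j = 0)
    (hD : DerivativesVanish V₁ V₂ F₁ F₂ α) (i : ι₁) :
    Quant V₂ F₂ →ₐ[k] Matrix (Fin 2) (Fin 2) (Quant V₂ F₂) :=
  Quant.lift (leftTriGrp V₂ _ (V₁.χ i)) (leftTriGen V₁ V₂ α _ i)
    (leftTriGen_mul_leftTriGrp hα _ i)
    (fun f hf => lift_leftTriGen_eq_zero (hF₂ f hf) (Quant.polyEval_eq_zero hf) (hD.1 i f hf))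

variable (hF₂ : ∀ h ∈ F₂, V₂.IsHomogeneous h) (hα : ∀ i j, V₁.χ i * V₂.χ j ≠ 1 → α i j = 0)
  (hD : DerivativesVanish V₁ V₂ F₁ F₂ α) (i : ι₁)

theorem leftTri_one_zero_and_one_one (a : Quant V₂ F₂) :
    leftTri hF₂ hα hD i a 1 0 = 0 ∧ leftTri hF₂ hα hD i a 1 1 = a := by
  induction a using Env.induction with
  | algebraMap c => simp [Matrix.algebraMap_matrix_apply]
  | add a b ha hb => simp [ha, hb]
  | mul a b ha hb => simp [Matrix.mul_apply, ha, hb]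
  | grp a => simp [leftTri, leftTriGrp]
  | gen j => simp [leftTri, leftTriGen]

/-- The left skew derivation of the second algebra. -/
def leftD : Quant V₂ F₂ →ₗ[k] Quant V₂ F₂ where
  toFun a := leftTri hF₂ hα hD i a 0 1
  map_add' := by simp
  map_smul' := by simp

/-- The automorphism of the second algebra belonging to `leftD`. -/
def leftσ : Quant V₂ F₂ →ₗ[k] Quant V₂ F₂ where
  toFun a := leftTri hF₂ hα hD i a 0 0
  map_add' := by simp
  map_smul' := by simp

theorem leftD_mul (a b : Quant V₂ F₂) : leftD hF₂ hα hD i (a * b) =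
    leftσ hF₂ hα hD i a * leftD hF₂ hα hD i b + leftD hF₂ hα hD i a * b := by
  simp [leftD, leftσ, Matrix.mul_apply, leftTri_one_zero_and_one_one]

theorem leftσ_mul (a b : Quant V₂ F₂) : leftσ hF₂ hα hD i (a * b) =
    leftσ hF₂ hα hD i a * leftσ hF₂ hα hD i b := by
  simp [leftσ, Matrix.mul_apply, leftTri_one_zero_and_one_one]

@[simp] theorem leftD_algebraMap (c : k) : leftD hF₂ hα hD i (algebraMap k _ c) = 0 := by
  simp [leftD, Matrix.algebraMap_matrix_apply]

@[simp] theorem leftσ_algebraMap (c : k) :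
    leftσ hF₂ hα hD i (algebraMap k _ c) = algebraMap k _ c := by
  simp [leftσ, Matrix.algebraMap_matrix_apply]

@[simp] theorem leftD_one : leftD hF₂ hα hD i 1 = 0 := by
  simpa using leftD_algebraMap hF₂ hα hD i 1

@[simp] theorem leftσ_one : leftσ hF₂ hα hD i 1 = 1 := by
  simpa using leftσ_algebraMap hF₂ hα hD i 1

@[simp] theorem leftD_grp (a : G) : leftD hF₂ hα hD i (Env.grp V₂ _ a) = 0 := by
  simp [leftD, leftTri, leftTriGrp]

@[simp] theorem leftσ_grp (a : G) :
    leftσ hF₂ hα hD i (Env.grp V₂ _ a) = (V₁.χ i a : k) • Env.grp V₂ _ a := by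
  simp [leftσ, leftTri, leftTriGrp]

@[simp] theorem leftD_gen (j : ι₂) : leftD hF₂ hα hD i (Env.gen V₂ _ j) =
    α i j • (1 - Env.grp V₂ _ (V₁.g i * V₂.g j)) := by
  simp [leftD, leftTri, leftTriGen]

@[simp] theorem leftσ_gen (j : ι₂) :
    leftσ hF₂ hα hD i (Env.gen V₂ _ j) = (V₁.χ i (V₂.g j) : k) • Env.gen V₂ _ j := by
  simp [leftσ, leftTri, leftTriGen]

end Left

section Right

variable (V₁) in
/-- The action of the group in `rightTri`. -/
def rightTriGrp (R₁ : Set (FreeAlgebra k (G ⊕ ι₁))) (χ : G →* kˣ) :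
    G →* Matrix (Fin 2) (Fin 2) (Env V₁ R₁) where
  toFun := fun a => !![Env.grp V₁ R₁ a, 0; 0, (((χ a)⁻¹ : kˣ) : k) • Env.grp V₁ R₁ a]
  map_one' := by simp [Env.grp_one, Matrix.one_fin_two]
  map_mul' := fun a b => by simp [Env.grp_mul, smul_smul, mul_comm]

variable (V₁ V₂ α) in
/-- The action of a variable in `rightTri`. -/
def rightTriGen (R₁ : Set (FreeAlgebra k (G ⊕ ι₁))) (j : ι₂) (i : ι₁) :
    Matrix (Fin 2) (Fin 2) (Env V₁ R₁) :=
  !![Env.gen V₁ R₁ i, α i j • (1 - Env.grp V₁ R₁ (V₁.g i * V₂.g j));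
    0, (V₁.χ i (V₂.g j) : k) • Env.gen V₁ R₁ i]

theorem rightTriGen_mul_rightTriGrp (hα : ∀ i j, V₁.χ i * V₂.χ j ≠ 1 → α i j = 0)
    (R₁ : Set (FreeAlgebra k (G ⊕ ι₁))) (j : ι₂) (i : ι₁) (a : G) :
    rightTriGen V₁ V₂ α R₁ j i * rightTriGrp V₁ R₁ (V₂.χ j) a =
      (V₁.χ i a : k) • (rightTriGrp V₁ R₁ (V₂.χ j) a * rightTriGen V₁ V₂ α R₁ j i) := by
  have h : (((V₂.χ j a)⁻¹ : kˣ) : k) * α i j = (V₁.χ i a : k) * α i j := by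
    have h := coeff_mul_char hα i j a
    have h' : (((V₂.χ j a)⁻¹ : kˣ) : k) * (V₂.χ j a : k) = 1 := by simp
    calc (((V₂.χ j a)⁻¹ : kˣ) : k) * α i j
        = (V₁.χ i a : k) * α i j * ((((V₂.χ j a)⁻¹ : kˣ) : k) * (V₂.χ j a : k)) := by
          conv_lhs => rw [← h]
          ring
      _ = (V₁.χ i a : k) * α i j := by rw [h', mul_one]
  ext p q
  fin_cases p <;> fin_cases q <;>
    simp [rightTriGen, rightTriGrp, Env.gen_mul_grp, smul_smul, grp_mul_sub_grp]
  · rw [← Units.val_inv_eq_inv_val, mul_comm (α i j), h]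
  · ring_nf

theorem lift_rightTriGen_word (j : ι₂) (w : List ι₁) :
    FreeAlgebra.lift k (rightTriGen V₁ V₂ α (polyEmb k G ι₁ '' F₁) j)
        (w.map (FreeAlgebra.ι k)).prod =
      !![Env.word V₁ _ w,
        FreeEnv.toEnv V₁ (polyEmb k G ι₁ '' F₁) (rightDerWord V₁ V₂ α j w);
        0, (V₁.χWord w (V₂.g j) : k) • Env.word V₁ _ w] := by
  induction w with
  | nil => simp [rightDerWord, Matrix.one_fin_two]
  | cons i w ih =>
    rw [List.map_cons, List.prod_cons, map_mul, ih, FreeAlgebra.lift_ι_apply, rightTriGen,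
      rightDerWord, ← Env.word]
    simp [smul_smul, mul_comm, add_comm]

/-- Here the scaled diagonal entry carries the factor χ^w(g_j), so it is the common character of the
words of f that is used. -/
theorem lift_rightTriGen_eq_zero {j : ι₂} {f : FreeAlgebra k ι₁} (hf : V₁.IsHomogeneous f)
    (hf0 : Env.polyEval V₁ (polyEmb k G ι₁ '' F₁) f = 0)
    (hD : FreeEnv.toEnv V₁ (polyEmb k G ι₁ '' F₁) (rightDer V₁ V₂ α j f) = 0) :
    FreeAlgebra.lift k (rightTriGen V₁ V₂ α (polyEmb k G ι₁ '' F₁) j) f = 0 := by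
  obtain ⟨c, ψ, hf⟩ := hf
  have h : FreeAlgebra.lift k (rightTriGen V₁ V₂ α (polyEmb k G ι₁ '' F₁) j) f =
      !![Env.polyEval V₁ (polyEmb k G ι₁ '' F₁) f,
        FreeEnv.toEnv V₁ (polyEmb k G ι₁ '' F₁) (rightDer V₁ V₂ α j f);
        0, (ψ (V₂.g j) : k) • Env.polyEval V₁ (polyEmb k G ι₁ '' F₁) f] := by
    clear hf0 hD
    induction hf using Submodule.span_induction with
    | mem x h =>
      obtain ⟨w, -, rfl, rfl⟩ := h
      rw [lift_rightTriGen_word, rightDer_word, Env.polyEval_word]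
    | zero => ext p q; fin_cases p <;> fin_cases q <;> simp
    | add x y _ _ hx hy => rw [map_add, hx, hy]; simp
    | smul c x _ hx =>
      rw [map_smul, hx]
      ext p q
      fin_cases p <;> fin_cases q <;> simp
      exact smul_comm _ _ _
  rw [h, hf0, hD]
  ext p q
  fin_cases p <;> fin_cases q <;> simp

/-- The triangular representation whose off-diagonal entry is the right derivative. -/
def rightTri (hF₁ : ∀ f ∈ F₁, V₁.IsHomogeneous f)
    (hα : ∀ i j, V₁.χ i * V₂.χ j ≠ 1 → α i j = 0)
    (hD : DerivativesVanish V₁ V₂ F₁ F₂ α) (j : ι₂) :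
    Quant V₁ F₁ →ₐ[k] Matrix (Fin 2) (Fin 2) (Quant V₁ F₁) :=
  Quant.lift (rightTriGrp V₁ _ (V₂.χ j)) (rightTriGen V₁ V₂ α _ j)
    (rightTriGen_mul_rightTriGrp hα _ j)
    (fun f hf => lift_rightTriGen_eq_zero (hF₁ f hf) (Quant.polyEval_eq_zero hf) (hD.2 j f hf))

/-- The triangular representation of the free enveloping algebra. -/
def freeRightTri (hα : ∀ i j, V₁.χ i * V₂.χ j ≠ 1 → α i j = 0) (j : ι₂) :
    FreeEnv V₁ →ₐ[k] Matrix (Fin 2) (Fin 2) (FreeEnv V₁) :=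
  FreeEnv.lift (rightTriGrp V₁ _ (V₂.χ j)) (rightTriGen V₁ V₂ α _ j)
    (rightTriGen_mul_rightTriGrp hα _ j)

theorem freeRightTri_zero_zero_and_one_zero (hα : ∀ i j, V₁.χ i * V₂.χ j ≠ 1 → α i j = 0) (j : ι₂)
    (a : FreeEnv V₁) : freeRightTri hα j a 0 0 = a ∧ freeRightTri hα j a 1 0 = 0 := by
  induction a using Env.induction with
  | algebraMap c => simp [Matrix.algebraMap_matrix_apply]
  | add a b ha hb => simp [ha, hb]
  | mul a b ha hb => simp [Matrix.mul_apply, ha, hb]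
  | grp a => simp [freeRightTri, rightTriGrp]
  | gen j => simp [freeRightTri, rightTriGen]

/-- The kernel of the projection to the first algebra is stable under the triangular
representation. -/
theorem toEnv_freeRightTri_eq_zero (hF₁ : ∀ f ∈ F₁, V₁.IsHomogeneous f)
    (hα : ∀ i j, V₁.χ i * V₂.χ j ≠ 1 → α i j = 0)
    (hD : DerivativesVanish V₁ V₂ F₁ F₂ α) (j : ι₂) {a : FreeEnv V₁}
    (ha : FreeEnv.toEnv V₁ (polyEmb k G ι₁ '' F₁) a = 0) (p q : Fin 2) :
    FreeEnv.toEnv V₁ (polyEmb k G ι₁ '' F₁) (freeRightTri hα j a p q) = 0 := by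
  have h : (FreeEnv.toEnv V₁ (polyEmb k G ι₁ '' F₁)).mapMatrix.comp (freeRightTri hα j) =
      (rightTri hF₁ hα hD j).comp (FreeEnv.toEnv V₁ (polyEmb k G ι₁ '' F₁)) := by
    refine Env.algHom_ext (fun b => ?_) (fun i => ?_)
    · ext p q
      fin_cases p <;> fin_cases q <;> simp [freeRightTri, rightTri, rightTriGrp]
    · ext p q
      fin_cases p <;> fin_cases q <;> simp [freeRightTri, rightTri, rightTriGen]
  have h' := congrFun (congrFun (DFunLike.congr_fun h a) p) q
  simpa [ha] using h'

end Right

end TriangularDerivations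

/-! ### The action of the glued algebra on the balanced tensor product, and the multiplication
isomorphism. -/

section BalancedModule

variable {k G ι₁ ι₂ : Type*} [Field k] [CommGroup G]

namespace BalancedTensor

section

variable {V₁ : QuantumVars k G ι₁} {V₂ : QuantumVars k G ι₂}
  {R₁ : Set (FreeAlgebra k (G ⊕ ι₁))} {R₂ : Set (FreeAlgebra k (G ⊕ ι₂))}

theorem tmul_grp_mul (a : Env V₂ R₂) (g : G) (b : Env V₁ R₁) :
    tmul V₁ V₂ R₁ R₂ a (Env.grp V₁ R₁ g * b) = tmul V₁ V₂ R₁ R₂ (a * Env.grp V₂ R₂ g) b :=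
  ((Submodule.Quotient.eq (balancedRel V₁ V₂ R₁ R₂)).2
    (Submodule.subset_span ⟨a, g, b, rfl⟩)).symm

theorem tmul_add (a : Env V₂ R₂) (b c : Env V₁ R₁) :
    tmul V₁ V₂ R₁ R₂ a (b + c) = tmul V₁ V₂ R₁ R₂ a b + tmul V₁ V₂ R₁ R₂ a c := by
  rw [tmul, TensorProduct.tmul_add]
  rfl

theorem add_tmul (a b : Env V₂ R₂) (c : Env V₁ R₁) :
    tmul V₁ V₂ R₁ R₂ (a + b) c = tmul V₁ V₂ R₁ R₂ a c + tmul V₁ V₂ R₁ R₂ b c := by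
  rw [tmul, TensorProduct.add_tmul]
  rfl

theorem tmul_smul (r : k) (a : Env V₂ R₂) (b : Env V₁ R₁) :
    tmul V₁ V₂ R₁ R₂ a (r • b) = r • tmul V₁ V₂ R₁ R₂ a b := by
  rw [tmul, TensorProduct.tmul_smul]
  rfl

theorem smul_tmul (r : k) (a : Env V₂ R₂) (b : Env V₁ R₁) :
    tmul V₁ V₂ R₁ R₂ (r • a) b = r • tmul V₁ V₂ R₁ R₂ a b := by
  rw [tmul, ← TensorProduct.smul_tmul']
  rfl

@[simp] theorem zero_tmul (b : Env V₁ R₁) : tmul V₁ V₂ R₁ R₂ 0 b = 0 := by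
  rw [tmul, TensorProduct.zero_tmul]
  rfl

@[simp] theorem tmul_zero (a : Env V₂ R₂) : tmul V₁ V₂ R₁ R₂ a 0 = 0 := by
  rw [tmul, TensorProduct.tmul_zero]
  rfl

theorem linearMap_ext {P : Type*} [AddCommGroup P] [Module k P]
    {f g : BalancedTensor V₁ V₂ R₁ R₂ →ₗ[k] P}
    (h : ∀ a b, f (tmul V₁ V₂ R₁ R₂ a b) = g (tmul V₁ V₂ R₁ R₂ a b)) : f = g :=
  Submodule.linearMap_qext _ (TensorProduct.ext' h)

variable (V₁ V₂ R₁ R₂) in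
/-- The linear map from the balanced tensor product induced by a balanced map. -/
def lift {P : Type*} [AddCommGroup P] [Module k P] (f : Env V₂ R₂ ⊗[k] Env V₁ R₁ →ₗ[k] P)
    (hf : ∀ a g b, f ((a * Env.grp V₂ R₂ g) ⊗ₜ b) = f (a ⊗ₜ (Env.grp V₁ R₁ g * b))) :
    BalancedTensor V₁ V₂ R₁ R₂ →ₗ[k] P :=
  Submodule.liftQ _ f (by
    rw [balancedRel, Submodule.span_le]
    rintro _ ⟨a, g, b, rfl⟩
    simp [hf])

@[simp] theorem lift_tmul {P : Type*} [AddCommGroup P] [Module k P]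
    (f : Env V₂ R₂ ⊗[k] Env V₁ R₁ →ₗ[k] P)
    (hf : ∀ a g b, f ((a * Env.grp V₂ R₂ g) ⊗ₜ b) = f (a ⊗ₜ (Env.grp V₁ R₁ g * b))) (a b) :
    lift V₁ V₂ R₁ R₂ f hf (tmul V₁ V₂ R₁ R₂ a b) = f (a ⊗ₜ b) := rfl

variable (V₁ V₂ R₁ R₂) in
/-- The linear map `a ⊗ b ↦ [a ⊗ b]`. -/
def mk : Env V₂ R₂ ⊗[k] Env V₁ R₁ →ₗ[k] BalancedTensor V₁ V₂ R₁ R₂ := Submodule.mkQ _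

@[simp] theorem mk_tmul (a : Env V₂ R₂) (b : Env V₁ R₁) :
    mk V₁ V₂ R₁ R₂ (a ⊗ₜ b) = tmul V₁ V₂ R₁ R₂ a b := rfl

variable (V₁ V₂ R₁ R₂) in
/-- Left multiplication by an element of the second algebra. -/
def lmulLinear (a : Env V₂ R₂) : Module.End k (BalancedTensor V₁ V₂ R₁ R₂) :=
  lift V₁ V₂ R₁ R₂ (mk V₁ V₂ R₁ R₂ ∘ₗ (LinearMap.mulLeft k a).rTensor _)
    (fun b g c => by simp [tmul_grp_mul, ← mul_assoc])

@[simp] theorem lmulLinear_tmul (a b : Env V₂ R₂) (c : Env V₁ R₁) :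
    lmulLinear V₁ V₂ R₁ R₂ a (tmul V₁ V₂ R₁ R₂ b c) = tmul V₁ V₂ R₁ R₂ (a * b) c := rfl

variable (V₁ V₂ R₁ R₂) in
/-- Left multiplication by the elements of the second algebra. -/
def lmul : Env V₂ R₂ →ₐ[k] Module.End k (BalancedTensor V₁ V₂ R₁ R₂) :=
  AlgHom.ofLinearMap
    { toFun := lmulLinear V₁ V₂ R₁ R₂
      map_add' := fun a b => linearMap_ext fun x y => by simp [add_mul, add_tmul]
      map_smul' := fun a b => linearMap_ext fun x y => by simp [smul_tmul] }
    (linearMap_ext fun x y => by simp)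
    (fun a b => linearMap_ext fun x y => by simp [mul_assoc])

@[simp] theorem lmul_tmul (a b : Env V₂ R₂) (c : Env V₁ R₁) :
    lmul V₁ V₂ R₁ R₂ a (tmul V₁ V₂ R₁ R₂ b c) = tmul V₁ V₂ R₁ R₂ (a * b) c := rfl

variable (V₁ V₂ R₁ R₂) in
/-- Left multiplication by the elements of the group. -/
def lmulGrp : G →* Module.End k (BalancedTensor V₁ V₂ R₁ R₂) :=
  (lmul V₁ V₂ R₁ R₂).toMonoidHom.comp (Env.grpHom V₂ R₂)

@[simp] theorem lmulGrp_apply (a : G) :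
    lmulGrp V₁ V₂ R₁ R₂ a = lmul V₁ V₂ R₁ R₂ (Env.grp V₂ R₂ a) := rfl

end

end BalancedTensor

namespace Glue

open BalancedTensor

variable {V₁ : QuantumVars k G ι₁} {V₂ : QuantumVars k G ι₂} {F₁ : Set (FreeAlgebra k ι₁)}
  {F₂ : Set (FreeAlgebra k ι₂)} {α : ι₁ → ι₂ → k}

variable (V₁ V₂ F₁ F₂) in
/-- The balanced tensor product of the two algebras. -/
abbrev Bal : Type _ := BalancedTensor V₁ V₂ (polyEmb k G ι₁ '' F₁) (polyEmb k G ι₂ '' F₂)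

variable (hF₁ : ∀ f ∈ F₁, V₁.IsHomogeneous f) (hF₂ : ∀ h ∈ F₂, V₂.IsHomogeneous h)
  (hα : ∀ i j, V₁.χ i * V₂.χ j ≠ 1 → α i j = 0) (hD : DerivativesVanish V₁ V₂ F₁ F₂ α)

/-- The action of `x i`, `i` in the first family, on the balanced tensor product. -/
def actGen (i : ι₁) : Module.End k (Bal V₁ V₂ F₁ F₂) :=
  BalancedTensor.lift _ _ _ _ (mk _ _ _ _ ∘ₗ ((leftD hF₂ hα hD i).rTensor _ +
      TensorProduct.map (leftσ hF₂ hα hD i) (LinearMap.mulLeft k (Env.gen V₁ _ i))))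
    (fun a g b => by
      simp only [LinearMap.comp_apply, LinearMap.add_apply, LinearMap.rTensor_tmul,
        TensorProduct.map_tmul, map_add, mk_tmul, leftD_mul, leftσ_mul, leftD_grp, leftσ_grp,
        mul_zero, zero_add, LinearMap.mulLeft_apply]
      -- The scalar χ^i(g) from σ_i(g) equals the one from moving x_i past g in the right factor.
      rw [tmul_grp_mul, ← mul_assoc, Env.gen_mul_grp, smul_mul_assoc, mul_assoc, tmul_smul,
        tmul_grp_mul, mul_smul_comm, smul_tmul])

theorem actGen_tmul (i : ι₁) (a b) : actGen hF₂ hα hD i (tmul V₁ V₂ _ _ a b) =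
    tmul V₁ V₂ _ _ (leftD hF₂ hα hD i a) b +
      tmul V₁ V₂ _ _ (leftσ hF₂ hα hD i a) (Env.gen V₁ _ i * b) := rfl

theorem actGen_mul_lmul_grp (i : ι₁) (a : G) :
    actGen hF₂ hα hD i * lmul V₁ V₂ _ _ (Env.grp V₂ _ a) =
      (V₁.χ i a : k) • (lmul V₁ V₂ _ _ (Env.grp V₂ _ a) * actGen hF₂ hα hD i) := by
  refine linearMap_ext fun b c => ?_
  simp only [Module.End.mul_apply, LinearMap.smul_apply, lmul_tmul, actGen_tmul, leftD_mul,
    leftσ_mul, leftD_grp, leftσ_grp, zero_mul, add_zero, smul_mul_assoc, smul_tmul, map_add,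
    smul_add]

/-- F₃ holds for the action: it is the twisted Leibniz rule of D_i on x_j a, together with the
values of D_i and σ_i at x_j. -/
theorem actGen_mul_lmul_gen (i : ι₁) (j : ι₂) :
    actGen hF₂ hα hD i * lmul V₁ V₂ _ _ (Env.gen V₂ _ j) =
      (V₁.χ i (V₂.g j) : k) • (lmul V₁ V₂ _ _ (Env.gen V₂ _ j) * actGen hF₂ hα hD i) +
      α i j • (1 - lmul V₁ V₂ _ _ (Env.grp V₂ _ (V₁.g i * V₂.g j))) := by
  refine linearMap_ext fun b c => ?_
  have h : ∀ (x y : Quant V₂ F₂), tmul V₁ V₂ (polyEmb k G ι₁ '' F₁) (polyEmb k G ι₂ '' F₂) (x - y) c =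
      tmul V₁ V₂ _ _ x c - tmul V₁ V₂ _ _ y c := by
    intro x y
    rw [sub_eq_add_neg, ← neg_one_smul k y, add_tmul, smul_tmul, neg_one_smul, sub_eq_add_neg]
  simp only [Module.End.mul_apply, LinearMap.smul_apply, lmul_tmul, actGen_tmul, leftD_mul,
    leftσ_mul, leftD_gen, leftσ_gen, smul_mul_assoc, smul_tmul, map_add, sub_mul, one_mul,
    smul_add, LinearMap.add_apply, LinearMap.sub_apply, add_tmul, Module.End.one_apply, h]
  abel

/-- A commutation rule that holds for the generators holds for the whole free enveloping algebra. -/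
theorem algHom_mul_eq_freeRightTri (hα : ∀ i j, V₁.χ i * V₂.χ j ≠ 1 → α i j = 0) (j : ι₂)
    {T : Type*} [Ring T] [Algebra k T] (φ : FreeEnv V₁ →ₐ[k] T) (y : T)
    (hgrp : ∀ a, φ (Env.grp V₁ ∅ a) * y = (((V₂.χ j a)⁻¹ : kˣ) : k) • (y * φ (Env.grp V₁ ∅ a)))
    (hgen : ∀ i, φ (Env.gen V₁ ∅ i) * y = (V₁.χ i (V₂.g j) : k) • (y * φ (Env.gen V₁ ∅ i)) +
      α i j • (1 - φ (Env.grp V₁ ∅ (V₁.g i * V₂.g j)))) (a : FreeEnv V₁) :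
    φ a * y =
      y * φ (freeRightTri hα j a 1 1) +
        φ (freeRightTri hα j a 0 1) := by
  induction a using Env.induction with
  | algebraMap c =>
    have h0 : freeRightTri (V₁ := V₁) hα j (algebraMap k _ c) 1 1 = algebraMap k _ c := by
      rw [AlgHom.commutes, Matrix.algebraMap_matrix_apply, if_pos rfl]
    have h1 : freeRightTri (V₁ := V₁) hα j (algebraMap k _ c) 0 1 = 0 := by
      rw [AlgHom.commutes, Matrix.algebraMap_matrix_apply, if_neg (by decide)]
    rw [h0, h1, map_zero, add_zero, AlgHom.commutes, Algebra.commutes]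
  | add a b ha hb =>
    have h : ∀ p q, freeRightTri hα j (a + b) p q =
        freeRightTri hα j a p q + freeRightTri hα j b p q := fun p q => by
      rw [map_add, Matrix.add_apply]
    rw [h, h, map_add, map_add, map_add, add_mul, mul_add, ha, hb, add_add_add_comm]
  | mul a b ha hb =>
    have h0 := freeRightTri_zero_zero_and_one_zero hα j a
    have h1 : freeRightTri hα j (a * b) 1 1 = freeRightTri hα j a 1 1 * freeRightTri hα j b 1 1 := by
      rw [map_mul, Matrix.mul_apply, Fin.sum_univ_two, h0.2, zero_mul, zero_add]
    have h2 : freeRightTri hα j (a * b) 0 1 =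
        a * freeRightTri hα j b 0 1 + freeRightTri hα j a 0 1 * freeRightTri hα j b 1 1 := by
      rw [map_mul, Matrix.mul_apply, Fin.sum_univ_two, h0.1]
    rw [h1, h2, map_mul, map_add, map_mul, map_mul, map_mul, mul_assoc, hb, mul_add, ← mul_assoc,
      ha, add_mul, mul_assoc, add_assoc, add_comm (_ * _) (φ a * _)]
  | grp a =>
    have h : freeRightTri hα j (Env.grp V₁ ∅ a) = rightTriGrp V₁ ∅ (V₂.χ j) a :=
      FreeEnv.lift_grp a
    have h0 : rightTriGrp V₁ ∅ (V₂.χ j) a 1 1 = (((V₂.χ j a)⁻¹ : kˣ) : k) • Env.grp V₁ ∅ a := rfl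
    have h1 : rightTriGrp V₁ ∅ (V₂.χ j) a 0 1 = 0 := rfl
    rw [h, h0, h1, hgrp, map_smul, map_zero, add_zero, mul_smul_comm]
  | gen i =>
    have h : freeRightTri hα j (Env.gen V₁ ∅ i) = rightTriGen V₁ V₂ α ∅ j i :=
      FreeEnv.lift_gen i
    have h0 : rightTriGen V₁ V₂ α ∅ j i 1 1 = (V₁.χ i (V₂.g j) : k) • Env.gen V₁ ∅ i := rfl
    have h1 : rightTriGen V₁ V₂ α ∅ j i 0 1 = α i j • (1 - Env.grp V₁ ∅ (V₁.g i * V₂.g j)) := rfl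
    rw [h, h0, h1, hgen, map_smul, map_smul, map_sub, map_one, mul_smul_comm]

/-- The action of the free enveloping algebra of the first family on the balanced tensor
product. -/
def freeAct : FreeEnv V₁ →ₐ[k] Module.End k (Bal V₁ V₂ F₁ F₂) :=
  FreeEnv.lift (lmulGrp V₁ V₂ _ _) (actGen hF₂ hα hD)
    (actGen_mul_lmul_grp hF₂ hα hD)

theorem freeAct_grp (a : G) :
    freeAct hF₂ hα hD (Env.grp V₁ ∅ a) = lmul V₁ V₂ _ _ (Env.grp V₂ _ a) :=
  FreeEnv.lift_grp a

theorem freeAct_gen (i : ι₁) :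
    freeAct hF₂ hα hD (Env.gen V₁ ∅ i) = actGen hF₂ hα hD i :=
  FreeEnv.lift_gen i

theorem freeAct_mul_lmul (j : ι₂) (a : FreeEnv V₁) :
    freeAct hF₂ hα hD a * lmul V₁ V₂ _ _ (Env.gen V₂ _ j) =
      lmul V₁ V₂ _ _ (Env.gen V₂ _ j) * freeAct hF₂ hα hD (freeRightTri hα j a 1 1) +
        freeAct hF₂ hα hD (freeRightTri hα j a 0 1) := by
  refine algHom_mul_eq_freeRightTri hα j _ _ (fun a => ?_) (fun i => ?_) a
  · rw [freeAct_grp, ← map_mul, Env.grp_mul_gen, map_smul, map_mul]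
  · rw [freeAct_gen, freeAct_grp, actGen_mul_lmul_gen]

/-- Since D_i(1) = 0 and σ_i(1) = 1, the action on 1 ⊗ b is left multiplication in H₁, so relations
of H₁ act trivially there. -/
theorem freeAct_one_tmul (a : FreeEnv V₁) (b : Quant V₁ F₁) :
    freeAct hF₂ hα hD a (tmul V₁ V₂ _ _ 1 b) =
      tmul V₁ V₂ _ _ 1 (FreeEnv.toEnv V₁ (polyEmb k G ι₁ '' F₁) a * b) := by
  induction a using Env.induction generalizing b with
  | algebraMap c =>
    rw [AlgHom.commutes, AlgHom.commutes, ← Algebra.smul_def, tmul_smul]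
    rfl
  | add a b ha hb => simp [ha, hb, add_mul, tmul_add]
  | mul a b ha hb => simp [ha, hb, mul_assoc]
  | grp a => rw [freeAct_grp, lmul_tmul, FreeEnv.toEnv_grp, tmul_grp_mul, one_mul, mul_one]
  | gen i => rw [freeAct_gen, actGen_tmul, FreeEnv.toEnv_gen, leftD_one, leftσ_one, zero_tmul, zero_add]

include hF₁ in
/-- The relations of the first algebra act by zero. -/
theorem freeAct_eq_zero {a : FreeEnv V₁} (ha : FreeEnv.toEnv V₁ (polyEmb k G ι₁ '' F₁) a = 0) :
    freeAct hF₂ hα hD a = 0 := by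
  -- The left factors x for which the whole kernel of G⟨X⟩ → H₁ annihilates every x ⊗ b. Quantifying
  -- over the whole kernel is what permits induction on x: passing a group element multiplies a on
  -- the right, and passing x_j replaces a by two entries of its triangular matrix, all of which
  -- stay in the kernel.
  let N : Submodule k (Quant V₂ F₂) :=
    { carrier := {x | ∀ a : FreeEnv V₁, FreeEnv.toEnv V₁ (polyEmb k G ι₁ '' F₁) a = 0 →
        ∀ b, freeAct hF₂ hα hD a (tmul V₁ V₂ _ _ x b) = 0}
      zero_mem' := fun a _ b => by simp
      add_mem' := fun hx hy a ha b => by rw [add_tmul, map_add, hx a ha, hy a ha, add_zero]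
      smul_mem' := fun c x hx a ha b => by rw [smul_tmul, map_smul, hx a ha, smul_zero] }
  have hN : N = ⊤ := by
    refine Env.eq_top_of_mul_mem _ _ ?_ ?_ ?_
    · intro a ha b
      rw [freeAct_one_tmul, ha, zero_mul, tmul_zero]
    · intro g x hx a ha b
      have h := hx (a * Env.grp V₁ ∅ g) (by rw [map_mul, ha, zero_mul]) b
      rwa [map_mul, Module.End.mul_apply, freeAct_grp, lmul_tmul] at h
    · intro j x hx a ha b
      have h := DFunLike.congr_fun (freeAct_mul_lmul hF₂ hα hD j a) (tmul V₁ V₂ _ _ x b)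
      simp only [Module.End.mul_apply, LinearMap.add_apply, lmul_tmul] at h
      rw [h, hx _ (toEnv_freeRightTri_eq_zero hF₁ hα hD j ha 1 1),
        hx _ (toEnv_freeRightTri_eq_zero hF₁ hα hD j ha 0 1), map_zero, add_zero]
  refine linearMap_ext fun x b => ?_
  have hx : x ∈ N := hN ▸ Submodule.mem_top
  exact hx a ha b

/-- The action of the glued algebra on the balanced tensor product. -/
def act : Glue V₁ V₂ F₁ F₂ α →ₐ[k] Module.End k (Bal V₁ V₂ F₁ F₂) :=
  Glue.lift (lmulGrp V₁ V₂ _ _) (actGen hF₂ hα hD)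
    (fun j => lmul V₁ V₂ _ _ (Env.gen V₂ _ j))
    (actGen_mul_lmul_grp hF₂ hα hD)
    (fun j a => by simp [← map_mul, Env.gen_mul_grp])
    (fun f hf => by
      have h := Env.algHom_polyEval V₁ ∅ (freeAct hF₂ hα hD) f
      rw [freeAct_eq_zero hF₁ hF₂ hα hD] at h
      · rw [h]
        congr
        funext i
        exact (freeAct_gen hF₂ hα hD i).symm
      · rw [FreeEnv.toEnv_polyEval, Quant.polyEval_eq_zero hf])
    (fun f hf => by
      rw [← Env.algHom_polyEval, Quant.polyEval_eq_zero hf, map_zero])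
    (fun i j => by
      rw [actGen_mul_lmul_gen, add_sub_cancel_left]
      rfl)

theorem act_grp (a : G) :
    act hF₁ hF₂ hα hD (Env.grp _ _ a) = lmul V₁ V₂ _ _ (Env.grp V₂ _ a) :=
  Glue.lift_grp a

theorem act_gen_inl (i : ι₁) :
    act hF₁ hF₂ hα hD (Env.gen _ _ (Sum.inlₗ i)) = actGen hF₂ hα hD i :=
  Glue.lift_inl i

theorem act_gen_inr (j : ι₂) :
    act hF₁ hF₂ hα hD (Env.gen _ _ (Sum.inrₗ j)) = lmul V₁ V₂ _ _ (Env.gen V₂ _ j) :=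
  Glue.lift_inr j

theorem act_inr (a : Quant V₂ F₂) :
    act hF₁ hF₂ hα hD (glueInr V₁ V₂ F₁ F₂ α a) = lmul V₁ V₂ _ _ a := by
  have h : (act hF₁ hF₂ hα hD).comp (glueInr V₁ V₂ F₁ F₂ α) = lmul V₁ V₂ _ _ :=
    Env.algHom_ext (fun a => by simp [act_grp]) (fun j => by simp [act_gen_inr])
  exact DFunLike.congr_fun h a

theorem act_inl_one_tmul (a b : Quant V₁ F₁) :
    act hF₁ hF₂ hα hD (glueInl V₁ V₂ F₁ F₂ α a) (tmul V₁ V₂ _ _ 1 b) =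
      tmul V₁ V₂ _ _ 1 (a * b) := by
  induction a using Env.induction generalizing b with
  | algebraMap c =>
    rw [AlgHom.commutes, AlgHom.commutes, ← Algebra.smul_def, tmul_smul]
    rfl
  | add a b ha hb => simp [ha, hb, add_mul, tmul_add]
  | mul a b ha hb => simp [ha, hb, mul_assoc]
  | grp a => simp [act_grp, tmul_grp_mul]
  | gen i => simp [act_gen_inl, actGen_tmul]

/-- Acting on 1 ⊗ 1 is a left inverse of the multiplication map. -/
theorem act_inr_mul_inl (a : Quant V₂ F₂) (b : Quant V₁ F₁) :
    act hF₁ hF₂ hα hD (glueInr V₁ V₂ F₁ F₂ α a * glueInl V₁ V₂ F₁ F₂ α b)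
      (tmul V₁ V₂ _ _ 1 1) = tmul V₁ V₂ _ _ a b := by
  rw [map_mul, Module.End.mul_apply, act_inl_one_tmul, act_inr, lmul_tmul, mul_one, mul_one]

variable (V₁ V₂ F₁ F₂ α) in
/-- The linear map `a ⊗ b ↦ a b`. -/
def mulMap : Bal V₁ V₂ F₁ F₂ →ₗ[k] Glue V₁ V₂ F₁ F₂ α :=
  BalancedTensor.lift _ _ _ _ (LinearMap.mul' k _ ∘ₗ (Algebra.TensorProduct.map
      (glueInr V₁ V₂ F₁ F₂ α) (glueInl V₁ V₂ F₁ F₂ α)).toLinearMap)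
    (fun a g b => by simp [mul_assoc])

@[simp] theorem mulMap_tmul (a b) : mulMap V₁ V₂ F₁ F₂ α (tmul V₁ V₂ _ _ a b) =
    glueInr V₁ V₂ F₁ F₂ α a * glueInl V₁ V₂ F₁ F₂ α b := rfl

/-- The straightening rule in H. It is modelled by the action of x_i and makes the multiplication
map intertwine that action with left multiplication. -/
theorem gen_inl_mul_inr (i : ι₁) (a : Quant V₂ F₂) :
    Env.gen _ _ (Sum.inlₗ i) * glueInr V₁ V₂ F₁ F₂ α a =
      glueInr V₁ V₂ F₁ F₂ α (leftD hF₂ hα hD i a) +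
        glueInr V₁ V₂ F₁ F₂ α (leftσ hF₂ hα hD i a) * Env.gen _ _ (Sum.inlₗ i) := by
  induction a using Env.induction with
  | algebraMap c =>
    rw [leftD_algebraMap, leftσ_algebraMap, AlgHom.commutes, map_zero, zero_add, Algebra.commutes]
  | add a b ha hb =>
    simp only [map_add, mul_add, add_mul, ha, hb]
    abel
  | mul a b ha hb =>
    rw [leftD_mul, leftσ_mul, map_mul, ← mul_assoc, ha, add_mul, mul_assoc _ _ (glueInr _ _ _ _ _ b),
      hb, map_add, map_mul, map_mul, map_mul]
    noncomm_ring
  | grp a => simp [gen_inl_mul_grp]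
  | gen j =>
    rw [inr_gen, gen_mul_gen, leftD_gen, leftσ_gen]
    simp [add_comm]

-- The image contains 1 and, by straightening, is stable under left multiplication by all
-- generators.
include hF₂ hα hD in
theorem mulMap_surjective : Function.Surjective (mulMap V₁ V₂ F₁ F₂ α) := by
  rw [← LinearMap.range_eq_top]
  refine Env.eq_top_of_mul_mem _ _ ⟨tmul V₁ V₂ _ _ 1 1, by simp⟩ ?_ ?_
  · rintro a _ ⟨x, rfl⟩
    refine ⟨lmul V₁ V₂ _ _ (Env.grp V₂ _ a) x, ?_⟩
    have h : mulMap V₁ V₂ F₁ F₂ α ∘ₗ lmul V₁ V₂ _ _ (Env.grp V₂ _ a) =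
        LinearMap.mulLeft k (Env.grp _ _ a) ∘ₗ mulMap V₁ V₂ F₁ F₂ α :=
      linearMap_ext fun b c => by simp [mul_assoc]
    exact DFunLike.congr_fun h x
  · rintro i _ ⟨x, rfl⟩
    rcases i with i | j
    · refine ⟨actGen hF₂ hα hD i x, ?_⟩
      have h : mulMap V₁ V₂ F₁ F₂ α ∘ₗ actGen hF₂ hα hD i =
          LinearMap.mulLeft k (Env.gen _ _ (Sum.inlₗ i)) ∘ₗ mulMap V₁ V₂ F₁ F₂ α :=
        linearMap_ext fun b c => by
          simp only [LinearMap.comp_apply, actGen_tmul, map_add, mulMap_tmul,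
            LinearMap.mulLeft_apply]
          rw [← mul_assoc, gen_inl_mul_inr hF₂ hα hD, add_mul, map_mul, inl_gen, mul_assoc]
      exact DFunLike.congr_fun h x
    · refine ⟨lmul V₁ V₂ _ _ (Env.gen V₂ _ j) x, ?_⟩
      have h : mulMap V₁ V₂ F₁ F₂ α ∘ₗ lmul V₁ V₂ _ _ (Env.gen V₂ _ j) =
          LinearMap.mulLeft k (Env.gen _ _ (Sum.inrₗ j)) ∘ₗ mulMap V₁ V₂ F₁ F₂ α :=
        linearMap_ext fun b c => by simp [mul_assoc]
      exact DFunLike.congr_fun h x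

include hF₁ hF₂ hα hD in
theorem mulMap_injective : Function.Injective (mulMap V₁ V₂ F₁ F₂ α) := by
  let r : Glue V₁ V₂ F₁ F₂ α →ₗ[k] Bal V₁ V₂ F₁ F₂ :=
    LinearMap.applyₗ (tmul V₁ V₂ _ _ 1 1) ∘ₗ (act hF₁ hF₂ hα hD).toLinearMap
  have h : r ∘ₗ mulMap V₁ V₂ F₁ F₂ α = LinearMap.id :=
    linearMap_ext fun a b => act_inr_mul_inl hF₁ hF₂ hα hD a b
  exact Function.LeftInverse.injective (g := r) (DFunLike.congr_fun h)

/-- Multiplication is an isomorphism from the balanced tensor product to the glued algebra. -/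
def mulEquiv : Bal V₁ V₂ F₁ F₂ ≃ₗ[k] Glue V₁ V₂ F₁ F₂ α :=
  LinearEquiv.ofBijective (mulMap V₁ V₂ F₁ F₂ α)
    ⟨mulMap_injective hF₁ hF₂ hα hD, mulMap_surjective hF₂ hα hD⟩

@[simp] theorem mulEquiv_tmul (a b) : mulEquiv hF₁ hF₂ hα hD (tmul V₁ V₂ _ _ a b) =
    glueInr V₁ V₂ F₁ F₂ α a * glueInl V₁ V₂ F₁ F₂ α b := rfl

@[simp] theorem mulEquiv_symm_mul (a b) : (mulEquiv hF₁ hF₂ hα hD).symm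
    (glueInr V₁ V₂ F₁ F₂ α a * glueInl V₁ V₂ F₁ F₂ α b) = tmul V₁ V₂ _ _ a b := by
  rw [LinearEquiv.symm_apply_eq, mulEquiv_tmul]

theorem mulEquiv_lact (g : G) (t) :
    mulEquiv hF₁ hF₂ hα hD (lact V₁ V₂ _ _ g t) = Env.grp _ _ g * mulEquiv hF₁ hF₂ hα hD t := by
  have h : (mulEquiv hF₁ hF₂ hα hD).toLinearMap ∘ₗ lact V₁ V₂ _ _ g =
      LinearMap.mulLeft k (Env.grp _ _ g) ∘ₗ (mulEquiv hF₁ hF₂ hα hD).toLinearMap :=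
    linearMap_ext fun a b => by
      change mulEquiv hF₁ hF₂ hα hD (tmul V₁ V₂ _ _ (Env.grp V₂ _ g * a) b) =
        Env.grp _ _ g * mulEquiv hF₁ hF₂ hα hD (tmul V₁ V₂ _ _ a b)
      simp [mul_assoc]
  exact DFunLike.congr_fun h t

theorem mulEquiv_ract (g : G) (t) :
    mulEquiv hF₁ hF₂ hα hD (ract V₁ V₂ _ _ g t) = mulEquiv hF₁ hF₂ hα hD t * Env.grp _ _ g := by
  have h : (mulEquiv hF₁ hF₂ hα hD).toLinearMap ∘ₗ ract V₁ V₂ _ _ g =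
      LinearMap.mulRight k (Env.grp _ _ g) ∘ₗ (mulEquiv hF₁ hF₂ hα hD).toLinearMap :=
    linearMap_ext fun a b => by
      change mulEquiv hF₁ hF₂ hα hD (tmul V₁ V₂ _ _ a (b * Env.grp V₁ _ g)) =
        mulEquiv hF₁ hF₂ hα hD (tmul V₁ V₂ _ _ a b) * Env.grp _ _ g
      simp [mul_assoc]
  exact DFunLike.congr_fun h t

end Glue

end BalancedModule

/-! ### Standard words and super-letters under monotone renaming of the variables. -/

section SuperLetterMaps

variable {ι κ : Type*}

theorem FreeMagma.word_map (f : ι → κ) (a : FreeMagma ι) :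
    (FreeMagma.map f a).word = a.word.map f := by
  induction a using FreeMagma.recOnMul with
  | ih1 i => rfl
  | ih2 a b ha hb =>
    change (FreeMagma.map f a).word ++ (FreeMagma.map f b).word = (a.word ++ b.word).map f
    rw [ha, hb, List.map_append]

theorem FreeMagma.exists_map_eq (f : ι → κ) (a : FreeMagma κ) (h : ∀ x ∈ a.word, x ∈ Set.range f) :
    ∃ b, FreeMagma.map f b = a := by
  induction a using FreeMagma.recOnMul with
  | ih1 i =>
    obtain ⟨j, rfl⟩ := h i (List.mem_singleton.2 rfl)
    exact ⟨.of j, rfl⟩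
  | ih2 a b ha hb =>
    obtain ⟨a', rfl⟩ := ha (fun x hx => h x (List.mem_append_left _ hx))
    obtain ⟨b', rfl⟩ := hb (fun x hx => h x (List.mem_append_right _ hx))
    exact ⟨a' * b', map_mul _ _ _⟩

variable [LinearOrder ι] [LinearOrder κ] {f : ι → κ} (hf : StrictMono f)

include hf

theorem wordGT_map {u v : List ι} : WordGT (u.map f) (v.map f) ↔ WordGT u v := by
  unfold WordGT
  constructor
  · intro h
    induction u generalizing v with
    | nil =>
      cases v with
      | nil => cases h
      | cons j v => exact .nil
    | cons i u ih =>
      cases v with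
      | nil => cases h
      | cons j v =>
        rw [List.map_cons, List.map_cons, List.cons_lex_cons_iff] at h
        rw [List.cons_lex_cons_iff]
        rcases h with h | ⟨h, h'⟩
        · exact .inl (hf.lt_iff_lt.1 h)
        · exact .inr ⟨hf.injective h, ih h'⟩
  · intro h
    induction h with
    | nil => exact .nil
    | rel h => exact .rel (hf h)
    | cons _ ih => exact .cons ih

theorem isStandard_map {u : List ι} : IsStandard (u.map f) ↔ IsStandard u := by
  unfold IsStandard
  rw [Ne, List.map_eq_nil_iff]
  refine and_congr Iff.rfl ⟨fun h v w hv hw he => ?_, fun h v w hv hw he => ?_⟩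
  · have h' := h (v.map f) (w.map f) (by simpa using hv) (by simpa using hw) (by simp [he])
    rwa [← List.map_append, ← List.map_append, wordGT_map hf] at h'
  · obtain ⟨v, w, rfl, rfl, rfl⟩ := List.map_eq_append_iff.1 he
    rw [← List.map_append, ← List.map_append, wordGT_map hf]
    exact h v w (by simpa using hv) (by simpa using hw) rfl

theorem isSuperLetter_map {a : FreeMagma ι} :
    IsSuperLetter (FreeMagma.map f a) ↔ IsSuperLetter a := by
  have key : ∀ a b : FreeMagma ι, (∀ a₁ a₂, FreeMagma.map f a = .mul a₁ a₂ →
      ¬ WordGT a₂.word (FreeMagma.map f b).word) ↔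
        ∀ a₁ a₂, a = .mul a₁ a₂ → ¬ WordGT a₂.word b.word := by
    intro a b
    constructor
    · rintro h a₁ a₂ rfl
      have h' := h _ _ rfl
      change ¬ WordGT (FreeMagma.map f a₂).word _ at h'
      rwa [FreeMagma.word_map, FreeMagma.word_map, wordGT_map hf] at h'
    · intro h a₁ a₂ he
      rcases a with i | ⟨c₁, c₂⟩
      · cases he
      · injection he with h₁ h₂
        subst h₂
        change ¬ WordGT (FreeMagma.map f c₂).word _
        rw [FreeMagma.word_map, FreeMagma.word_map, wordGT_map hf]
        exact h _ _ rfl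
  constructor
  · intro h
    induction a using FreeMagma.recOnMul with
    | ih1 i => exact .of i
    | ih2 a b ha hb =>
      change IsSuperLetter (.mul (FreeMagma.map f a) (FreeMagma.map f b)) at h
      cases h with
      | mul _ _ h₁ h₂ h₃ h₄ h₅ h₆ =>
        rw [FreeMagma.word_map] at h₃ h₄ h₅
        rw [FreeMagma.word_map] at h₅
        exact .mul a b (ha h₁) (hb h₂) ((isStandard_map hf).1 h₃) ((isStandard_map hf).1 h₄)
          ((wordGT_map hf).1 h₅) ((key a b).1 h₆)
  · intro h
    induction h with
    | of i => exact .of _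
    | mul a b _ _ h₃ h₄ h₅ h₆ h₁ h₂ =>
      rw [← isStandard_map hf, ← FreeMagma.word_map] at h₃ h₄
      rw [← wordGT_map hf, ← FreeMagma.word_map, ← FreeMagma.word_map] at h₅
      exact .mul _ _ h₁ h₂ h₃ h₄ h₅ ((key a b).2 h₆)

end SuperLetterMaps

/-! ### Degrees of words and super-words. -/

section WordDegrees

variable {ι κ D : Type*} [AddCommGroup D] (d : ι → D)

@[simp] theorem wordDeg_nil : wordDeg d [] = 0 := rfl

@[simp] theorem wordDeg_cons (i : ι) (u : List ι) : wordDeg d (i :: u) = d i + wordDeg d u := by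
  simp [wordDeg]

@[simp] theorem wordDeg_append (u v : List ι) :
    wordDeg d (u ++ v) = wordDeg d u + wordDeg d v := by
  simp [wordDeg]

theorem wordDeg_perm {u v : List ι} (h : u.Perm v) : wordDeg d u = wordDeg d v :=
  (h.map d).sum_eq

theorem wordDeg_map (d : κ → D) (f : ι → κ) (u : List ι) :
    wordDeg d (u.map f) = wordDeg (fun i => d (f i)) u := by
  simp [wordDeg, Function.comp_def]

theorem wordDeg_nonneg [LinearOrder D] [IsOrderedAddMonoid D] {d : ι → D} (hd : ∀ i, 0 < d i)
    (u : List ι) : 0 ≤ wordDeg d u :=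
  List.sum_nonneg (by simpa using fun i _ => (hd i).le)

theorem superWordDeg_eq (W : List (FreeMagma ι)) :
    superWordDeg d W = wordDeg d (W.flatMap FreeMagma.word) := by
  induction W with
  | nil => rfl
  | cons a W ih =>
    rw [List.flatMap_cons, wordDeg_append, ← ih]
    simp [superWordDeg]

end WordDegrees

/-! ### Values of super-words, and inheritance of hardness along a retraction. -/

section SuperValues

variable {k G ι κ : Type*} [Field k] [CommGroup G]
  (V : QuantumVars k G ι) (R : Set (FreeAlgebra k (G ⊕ ι)))

theorem mul_mem_span_word_perm {x y : Env V R} {u v : List ι}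
    (hx : x ∈ Submodule.span k {t | ∃ w, w.Perm u ∧ t = Env.word V R w})
    (hy : y ∈ Submodule.span k {t | ∃ w, w.Perm v ∧ t = Env.word V R w}) :
    x * y ∈ Submodule.span k {t | ∃ w, w.Perm (u ++ v) ∧ t = Env.word V R w} := by
  have h := Submodule.mul_mem_mul hx hy
  rw [Submodule.span_mul_span] at h
  refine Submodule.span_mono ?_ h
  rintro _ ⟨_, ⟨w, hw, rfl⟩, _, ⟨w', hw', rfl⟩, rfl⟩
  exact ⟨w ++ w', hw.append hw', (Env.word_append ..).symm⟩

/-- A skew commutator only permutes letters. Degrees and the presence of a given letter can thus be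
read off from any word in the expansion. -/
theorem superValue_mem_span (a : FreeMagma ι) :
    superValue V R a ∈ Submodule.span k {t | ∃ w, w.Perm a.word ∧ t = Env.word V R w} := by
  induction a using FreeMagma.recOnMul with
  | ih1 i => exact Submodule.subset_span ⟨[i], .refl _, by simp [superValue]⟩
  | ih2 a b ha hb =>
    refine Submodule.sub_mem _ (mul_mem_span_word_perm V R ha hb)
      (Submodule.smul_mem _ _ (Submodule.span_mono ?_ (mul_mem_span_word_perm V R hb ha)))
    rintro _ ⟨w, hw, rfl⟩
    exact ⟨w, hw.trans List.perm_append_comm, rfl⟩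

theorem superWordValue_mem_span (W : List (FreeMagma ι)) :
    superWordValue V R W ∈
      Submodule.span k {t | ∃ w, w.Perm (W.flatMap FreeMagma.word) ∧ t = Env.word V R w} := by
  induction W with
  | nil => exact Submodule.subset_span ⟨[], .refl _, by simp [superWordValue]⟩
  | cons a W ih =>
    have h : superWordValue V R (a :: W) = superValue V R a * superWordValue V R W := by
      simp [superWordValue]
    rw [h, List.flatMap_cons]
    exact mul_mem_span_word_perm V R (superValue_mem_span V R a) ih

theorem superWordValue_map_of (w : List ι) :
    superWordValue V R (w.map FreeMagma.of) = Env.word V R w := by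
  simp only [superWordValue, List.map_map, Env.word]
  rfl

theorem superWordDeg_map_of {D : Type*} [AddCommGroup D] (d : ι → D) (w : List ι) :
    superWordDeg d (w.map FreeMagma.of) = wordDeg d w := by
  simp [superWordDeg, wordDeg, Function.comp_def, FreeMagma.word]

variable {V R} {V' : QuantumVars k G κ} {R' : Set (FreeAlgebra k (G ⊕ κ))} {f : ι → κ}
  (hg : ∀ i, V'.g (f i) = V.g i) (hχ : ∀ i, V'.χ (f i) = V.χ i)

include hg hχ in
theorem QuantumVars.p_map (u v : List ι) : V'.p (u.map f) (v.map f) = V.p u v := by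
  simp [QuantumVars.p, QuantumVars.gWord, QuantumVars.χWord, Function.comp_def, hg, hχ]

variable (φ : Env V R →ₐ[k] Env V' R') (hφ : ∀ i, φ (Env.gen V R i) = Env.gen V' R' (f i))

include hg hχ hφ

theorem superValue_map (a : FreeMagma ι) :
    superValue V' R' (FreeMagma.map f a) = φ (superValue V R a) := by
  induction a using FreeMagma.recOnMul with
  | ih1 i => exact (hφ i).symm
  | ih2 a b ha hb =>
    change superValue V' R' (.mul (FreeMagma.map f a) (FreeMagma.map f b)) =
      φ (superValue V R (.mul a b))
    rw [superValue, superValue, ha, hb, FreeMagma.word_map, FreeMagma.word_map,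
      QuantumVars.p_map hg hχ, map_sub, map_smul, map_mul, map_mul]

theorem superWordValue_map (W : List (FreeMagma ι)) :
    superWordValue V' R' (W.map (FreeMagma.map f)) = φ (superWordValue V R W) := by
  simp only [superWordValue, map_list_prod, List.map_map]
  congr 1
  exact List.map_congr_left fun a _ => superValue_map hg hχ φ hφ a

/-- Hard super-letters stay hard under an embedding that has a retraction which lowers the degrees
of the words that contain a new letter. -/
theorem IsHard.map [LinearOrder ι] [LinearOrder κ] (hf : StrictMono f)
    {D : Type*} [AddCommGroup D] [LinearOrder D] (d : κ → D)
    (E : Env V' R' →ₗ[k] Env V R) (hE : ∀ a, E (φ a) = a)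
    (hEgrp : ∀ h a, E (Env.grp V' R' h * a) = Env.grp V R h * E a)
    (hEword : ∀ w : List κ, (∃ x ∈ w, x ∉ Set.range f) → E (Env.word V' R' w) ∈
      Submodule.span k {t | ∃ h v, wordDeg (fun i => d (f i)) v < wordDeg d w ∧
        t = Env.grp V R h * Env.word V R v})
    {u : FreeMagma ι} (hu : IsHard V R (fun i => d (f i)) u) :
    IsHard V' R' d (FreeMagma.map f u) := by
  refine ⟨(isSuperLetter_map hf).2 hu.1, fun hmem => hu.2 ?_⟩
  -- Applying the retraction to a hypothetical expression of the image of u gives an expression of u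
  -- itself. It remains to see that each term is again of an allowed kind.
  have hmem' := Submodule.mem_map_of_mem (f := E) hmem
  rw [superValue_map hg hχ φ hφ, hE, Submodule.map_span] at hmem'
  set B : Set (Env V R) := {t | ∃ (h : G) (W : List (FreeMagma ι)), (∀ a ∈ W, IsSuperLetter a) ∧
    superWordDeg (fun i => d (f i)) W < wordDeg (fun i => d (f i)) u.word ∧
      t = Env.grp V R h * superWordValue V R W} with hB
  have hdeg : wordDeg d (FreeMagma.map f u).word = wordDeg (fun i => d (f i)) u.word := by
    rw [FreeMagma.word_map, wordDeg_map]
  have hdegW : ∀ W : List (FreeMagma ι), superWordDeg d (W.map (FreeMagma.map f)) =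
      superWordDeg (fun i => d (f i)) W := fun W => by
    simp [superWordDeg, Function.comp_def, FreeMagma.word_map, wordDeg_map]
  -- Super-words with a new letter retract to combinations of G-super-words of strictly smaller
  -- degree, so even those of the degree of u fall into the lower part.
  have hlow : ∀ (h : G) (W : List (FreeMagma κ)),
      superWordDeg d W ≤ wordDeg d (FreeMagma.map f u).word →
      (∃ a ∈ W, ∃ x ∈ a.word, x ∉ Set.range f) →
      E (Env.grp V' R' h * superWordValue V' R' W) ∈ Submodule.span k B := by
    rintro h W hW ⟨a, ha, x, hx, hxf⟩
    have h1 := superWordValue_mem_span V' R' W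
    rw [hEgrp]
    generalize superWordValue V' R' W = z at h1
    induction h1 using Submodule.span_induction with
    | mem y hy =>
      obtain ⟨w, hw, rfl⟩ := hy
      have h2 := hEword w ⟨x, hw.mem_iff.2 (List.mem_flatMap.2 ⟨a, ha, hx⟩), hxf⟩
      rw [wordDeg_perm d hw, ← superWordDeg_eq] at h2
      generalize E (Env.word V' R' w) = z at h2
      induction h2 using Submodule.span_induction with
      | mem y hy =>
        obtain ⟨h', v, hv, rfl⟩ := hy
        refine Submodule.subset_span ⟨h * h', v.map FreeMagma.of, ?_, ?_, ?_⟩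
        · intro b hb
          obtain ⟨i, -, rfl⟩ := List.mem_map.1 hb
          exact .of i
        · rw [superWordDeg_map_of, ← hdeg]
          exact hv.trans_le hW
        · rw [superWordValue_map_of, Env.grp_mul, mul_assoc]
      | zero => simp
      | add x y _ _ hx hy => rw [mul_add]; exact Submodule.add_mem _ hx hy
      | smul c x _ hx => rw [mul_smul_comm]; exact Submodule.smul_mem _ _ hx
    | zero => simp
    | add x y _ _ hx hy => rw [map_add, mul_add]; exact Submodule.add_mem _ hx hy
    | smul c x _ hx => rw [map_smul, mul_smul_comm]; exact Submodule.smul_mem _ _ hx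
  have hex : ∀ W : List (FreeMagma κ), (¬ ∃ a ∈ W, ∃ x ∈ a.word, x ∉ Set.range f) →
      ∃ W' : List (FreeMagma ι), W = W'.map (FreeMagma.map f) := by
    intro W hW
    push Not at hW
    induction W with
    | nil => exact ⟨[], rfl⟩
    | cons a W ih =>
      obtain ⟨W', rfl⟩ := ih (fun b hb => hW b (List.mem_cons_of_mem _ hb))
      obtain ⟨b, rfl⟩ := FreeMagma.exists_map_eq f a (hW a List.mem_cons_self)
      exact ⟨b :: W', rfl⟩
  refine Submodule.span_le.2 ?_ hmem'
  rintro _ ⟨_, ⟨W, hW, hWd, rfl⟩ | ⟨h, W, hW, hWd, rfl⟩, rfl⟩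
  · by_cases hx : ∃ a ∈ W, ∃ x ∈ a.word, x ∉ Set.range f
    · have h' := hlow 1 W hWd.le hx
      rw [Env.grp_one, one_mul] at h'
      exact Submodule.span_mono Set.subset_union_right h'
    · obtain ⟨W, rfl⟩ := hex W hx
      refine Submodule.subset_span (.inl ⟨W, fun a ha => ?_, ?_, ?_⟩)
      · have h' := hW _ (List.mem_map_of_mem ha)
        rwa [isSuperLetter_map hf, FreeMagma.word_map, FreeMagma.word_map, wordGT_map hf] at h'
      · rw [← hdegW, hWd, hdeg]
      · rw [superWordValue_map hg hχ φ hφ, hE]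
  · by_cases hx : ∃ a ∈ W, ∃ x ∈ a.word, x ∉ Set.range f
    · exact Submodule.span_mono Set.subset_union_right (hlow h W hWd.le hx)
    · obtain ⟨W, rfl⟩ := hex W hx
      refine Submodule.subset_span (.inr ⟨h, W, fun a ha => ?_, ?_, ?_⟩)
      · have h' := hW _ (List.mem_map_of_mem ha)
        rwa [isSuperLetter_map hf] at h'
      · rw [← hdegW, ← hdeg]
        exact hWd
      · rw [hEgrp, superWordValue_map hg hχ φ hφ, hE]

end SuperValues

/-! ### Sorting words in the glued algebra, the two retractions, and hardness. -/

namespace Glue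

variable {k G ι₁ ι₂ : Type*} [Field k] [CommGroup G]
  {V₁ : QuantumVars k G ι₁} {V₂ : QuantumVars k G ι₂} {F₁ : Set (FreeAlgebra k ι₁)}
  {F₂ : Set (FreeAlgebra k ι₂)} {α : ι₁ → ι₂ → k}

theorem eq_inlₗ_or_eq_inrₗ (x : ι₁ ⊕ₗ ι₂) : (∃ i, x = Sum.inlₗ i) ∨ ∃ j, x = Sum.inrₗ j := by
  rcases x with i | j
  · exact .inl ⟨i, rfl⟩
  · exact .inr ⟨j, rfl⟩

section OrderedWords

variable {D : Type*} [AddCommGroup D] [LinearOrder D] [IsOrderedAddMonoid D]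
  {d : ι₁ ⊕ₗ ι₂ → D} (hd : ∀ i, 0 < d i)

include hd

/-- Each time x_i passes a letter x_j, the correction α_ij (1 - g_i g_j) loses both letters, and
degrees are positive. -/
theorem gen_inl_mul_inr_word (i : ι₁) (u : List ι₂) :
    ∃ c : k, ∃ z ∈ Submodule.span k {t | ∃ h u',
        wordDeg (fun j => d (Sum.inrₗ j)) u' < d (Sum.inlₗ i) + wordDeg (fun j => d (Sum.inrₗ j)) u ∧
          t = Env.grp _ _ h * glueInr V₁ V₂ F₁ F₂ α (Env.word V₂ _ u')},
      Env.gen _ _ (Sum.inlₗ i) * glueInr V₁ V₂ F₁ F₂ α (Env.word V₂ _ u) =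
        c • (glueInr V₁ V₂ F₁ F₂ α (Env.word V₂ _ u) * Env.gen _ _ (Sum.inlₗ i)) + z := by
  induction u with
  | nil => exact ⟨1, 0, Submodule.zero_mem _, by simp⟩
  | cons j u ih =>
    obtain ⟨c, z, hz, he⟩ := ih
    refine ⟨(V₁.χ i (V₂.g j) : k) * c, (V₁.χ i (V₂.g j) : k) • (Env.gen _ _ (Sum.inrₗ j) * z) +
      α i j • (glueInr V₁ V₂ F₁ F₂ α (Env.word V₂ _ u) -
        Env.grp _ _ (V₁.g i * V₂.g j) * glueInr V₁ V₂ F₁ F₂ α (Env.word V₂ _ u)), ?_, ?_⟩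
    · have hlt : wordDeg (fun j => d (Sum.inrₗ j)) u <
          d (Sum.inlₗ i) + wordDeg (fun j => d (Sum.inrₗ j)) (j :: u) := by
        rw [wordDeg_cons, ← add_assoc]
        exact lt_add_of_pos_left _ (add_pos (hd _) (hd _))
      refine Submodule.add_mem _ (Submodule.smul_mem _ _ ?_)
        (Submodule.smul_mem _ _ (Submodule.sub_mem _ (Submodule.subset_span ⟨1, u, hlt, ?_⟩)
          (Submodule.subset_span ⟨_, u, hlt, rfl⟩)))
      · clear he
        induction hz using Submodule.span_induction with
        | mem x hx =>
          obtain ⟨h, u', hu', rfl⟩ := hx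
          rw [← mul_assoc, gen_inr_mul_grp, smul_mul_assoc, mul_assoc, ← inr_gen, ← map_mul,
            ← Env.word_cons]
          refine Submodule.smul_mem _ _ (Submodule.subset_span ⟨h, j :: u', ?_, rfl⟩)
          rw [wordDeg_cons, wordDeg_cons, add_left_comm]
          exact add_lt_add_right hu' _
        | zero => simp
        | add x y _ _ hx hy => rw [mul_add]; exact Submodule.add_mem _ hx hy
        | smul c x _ hx => rw [mul_smul_comm]; exact Submodule.smul_mem _ _ hx
      · rw [Env.grp_one, one_mul]
    · rw [Env.word_cons, map_mul, inr_gen, ← mul_assoc, gen_mul_gen, add_mul, smul_mul_assoc,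
        mul_assoc, he, mul_add, smul_add, mul_smul_comm, smul_smul, smul_mul_assoc, sub_mul,
        one_mul, mul_assoc, add_assoc]

/-- Every word is a combination of ordered words of at most the same degree; if letters of both
families occur in it then both parts of these ordered words have smaller degree. -/
theorem word_mem_span_ordered (w : List (ι₁ ⊕ₗ ι₂)) :
    Env.word _ (glueRel V₁ V₂ F₁ F₂ α) w ∈ Submodule.span k {t | ∃ h u v,
      wordDeg (fun j => d (Sum.inrₗ j)) u + wordDeg (fun i => d (Sum.inlₗ i)) v ≤ wordDeg d w ∧
      ((∃ j, Sum.inrₗ j ∈ w) → wordDeg (fun i => d (Sum.inlₗ i)) v < wordDeg d w) ∧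
      ((∃ i, Sum.inlₗ i ∈ w) → wordDeg (fun j => d (Sum.inrₗ j)) u < wordDeg d w) ∧
      t = Env.grp _ _ h * (glueInr V₁ V₂ F₁ F₂ α (Env.word V₂ _ u) *
        glueInl V₁ V₂ F₁ F₂ α (Env.word V₁ _ v))} := by
  have hn₁ := fun v => wordDeg_nonneg (d := fun i => d (Sum.inlₗ i)) (fun i => hd _) v
  have hn₂ := fun v => wordDeg_nonneg (d := fun i => d (Sum.inrₗ i)) (fun i => hd _) v
  induction w with
  | nil => exact Submodule.subset_span ⟨1, [], [], by simp [Env.grp_one]⟩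
  | cons x w ih =>
    rw [Env.word_cons]
    generalize Env.word _ (glueRel V₁ V₂ F₁ F₂ α) w = z at ih
    induction ih using Submodule.span_induction with
    | zero => simp
    | add x y _ _ hx hy => rw [mul_add]; exact Submodule.add_mem _ hx hy
    | smul c x _ hx => rw [mul_smul_comm]; exact Submodule.smul_mem _ _ hx
    | mem z hz =>
      obtain ⟨h, u, v, h₁, h₂, h₃, rfl⟩ := hz
      have hv := (le_add_of_nonneg_left (hn₂ u)).trans h₁
      have hu := (le_add_of_nonneg_right (hn₁ v)).trans h₁
      rw [← mul_assoc, Env.gen_mul_grp, smul_mul_assoc, mul_assoc]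
      refine Submodule.smul_mem _ _ ?_
      obtain ⟨i, rfl⟩ | ⟨j, rfl⟩ := eq_inlₗ_or_eq_inrₗ x
      · have hdi := hd (Sum.inlₗ i)
        obtain ⟨c, z, hz, he⟩ := gen_inl_mul_inr_word (V₁ := V₁) (V₂ := V₂) (F₁ := F₁) (F₂ := F₂)
          (α := α) hd i u
        rw [← mul_assoc (Env.gen _ _ _), he, add_mul, mul_add]
        refine Submodule.add_mem _ ?_ ?_
        · rw [smul_mul_assoc, mul_smul_comm, mul_assoc, ← inl_gen, ← map_mul, ← Env.word_cons]
          refine Submodule.smul_mem _ _ (Submodule.subset_span ⟨h, u, i :: v, ?_, ?_, ?_, rfl⟩)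
          · rw [wordDeg_cons, wordDeg_cons, add_left_comm]
            exact add_le_add_right h₁ _
          · rintro ⟨j, hj⟩
            have hj' : Sum.inrₗ j ∈ w := by
              rcases List.mem_cons.1 hj with h | h
              · cases h
              · exact h
            rw [wordDeg_cons, wordDeg_cons]
            exact add_lt_add_right (h₂ ⟨j, hj'⟩) _
          · intro _
            rw [wordDeg_cons]
            exact hu.trans_lt (lt_add_of_pos_left _ hdi)
        · clear he
          induction hz using Submodule.span_induction with
          | mem x hx =>
            obtain ⟨h', u', hu', rfl⟩ := hx
            refine Submodule.subset_span ⟨h * h', u', v, ?_, fun _ => ?_, fun _ => ?_, ?_⟩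
            · rw [wordDeg_cons]
              calc _ ≤ d (Sum.inlₗ i) + wordDeg (fun j => d (Sum.inrₗ j)) u +
                    wordDeg (fun i => d (Sum.inlₗ i)) v := by gcongr
                _ ≤ _ := by rw [add_assoc]; exact add_le_add_right h₁ _
            · rw [wordDeg_cons]
              exact hv.trans_lt (lt_add_of_pos_left _ hdi)
            · rw [wordDeg_cons]
              exact hu'.trans_le (add_le_add_right hu _)
            · rw [Env.grp_mul]
              simp only [mul_assoc]
          | zero => simp
          | add x y _ _ hx hy => rw [add_mul, mul_add]; exact Submodule.add_mem _ hx hy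
          | smul c x _ hx =>
            rw [smul_mul_assoc, mul_smul_comm]; exact Submodule.smul_mem _ _ hx
      · have hdj := hd (Sum.inrₗ j)
        rw [← mul_assoc (Env.gen _ _ _), ← inr_gen, ← map_mul, ← Env.word_cons]
        refine Submodule.subset_span ⟨h, j :: u, v, ?_, ?_, ?_, rfl⟩
        · rw [wordDeg_cons, wordDeg_cons, add_assoc]
          exact add_le_add_right h₁ _
        · intro _
          rw [wordDeg_cons]
          exact hv.trans_lt (lt_add_of_pos_left _ hdj)
        · rintro ⟨i, hi⟩
          have hi' : Sum.inlₗ i ∈ w := by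
            rcases List.mem_cons.1 hi with h | h
            · cases h
            · exact h
          rw [wordDeg_cons, wordDeg_cons]
          exact add_lt_add_right (h₃ ⟨i, hi'⟩) _

end OrderedWords

section Projections

variable (hF₁ : ∀ f ∈ F₁, V₁.IsHomogeneous f) (hF₂ : ∀ h ∈ F₂, V₂.IsHomogeneous h)
  (hα : ∀ i j, V₁.χ i * V₂.χ j ≠ 1 → α i j = 0) (hD : DerivativesVanish V₁ V₂ F₁ F₂ α)
  (S₁ : CharHopf V₁ (polyEmb k G ι₁ '' F₁)) (S₂ : CharHopf V₂ (polyEmb k G ι₂ '' F₂))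

/-- The projection `a b ↦ π(a) b` to the first algebra, where `π` kills the variables. -/
def fstProj : Glue V₁ V₂ F₁ F₂ α →ₗ[k] Quant V₁ F₁ :=
  BalancedTensor.lift _ _ _ _ (LinearMap.mul' k _ ∘ₗ
      (S₂.grpLift (Env.grpHom V₁ _)).toLinearMap.rTensor _)
    (fun a g b => by simp [mul_assoc]) ∘ₗ (mulEquiv hF₁ hF₂ hα hD).symm.toLinearMap

/-- The projection `a b ↦ a π(b)` to the second algebra, where `π` kills the variables. -/
def sndProj : Glue V₁ V₂ F₁ F₂ α →ₗ[k] Quant V₂ F₂ :=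
  BalancedTensor.lift _ _ _ _ (LinearMap.mul' k _ ∘ₗ
      (S₁.grpLift (Env.grpHom V₂ _)).toLinearMap.lTensor _)
    (fun a g b => by simp [mul_assoc]) ∘ₗ (mulEquiv hF₁ hF₂ hα hD).symm.toLinearMap

theorem fstProj_mul (a b) : fstProj hF₁ hF₂ hα hD S₂
    (glueInr V₁ V₂ F₁ F₂ α a * glueInl V₁ V₂ F₁ F₂ α b) = S₂.grpLift (Env.grpHom V₁ _) a * b := by
  rw [fstProj, LinearMap.comp_apply, LinearEquiv.coe_coe, mulEquiv_symm_mul]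
  rfl

theorem sndProj_mul (a b) : sndProj hF₁ hF₂ hα hD S₁
    (glueInr V₁ V₂ F₁ F₂ α a * glueInl V₁ V₂ F₁ F₂ α b) = a * S₁.grpLift (Env.grpHom V₂ _) b := by
  rw [sndProj, LinearMap.comp_apply, LinearEquiv.coe_coe, mulEquiv_symm_mul]
  rfl

theorem fstProj_inl (b) : fstProj hF₁ hF₂ hα hD S₂ (glueInl V₁ V₂ F₁ F₂ α b) = b := by
  have h := fstProj_mul hF₁ hF₂ hα hD S₂ 1 b
  rwa [map_one, map_one, one_mul, one_mul] at h

theorem sndProj_inr (a) : sndProj hF₁ hF₂ hα hD S₁ (glueInr V₁ V₂ F₁ F₂ α a) = a := by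
  have h := sndProj_mul hF₁ hF₂ hα hD S₁ a 1
  rwa [map_one, map_one, mul_one, mul_one] at h

include hF₁ hF₂ hα hD in
theorem linearMap_ext_mul {P : Type*} [AddCommGroup P] [Module k P]
    {f g : Glue V₁ V₂ F₁ F₂ α →ₗ[k] P}
    (h : ∀ a b, f (glueInr V₁ V₂ F₁ F₂ α a * glueInl V₁ V₂ F₁ F₂ α b) =
      g (glueInr V₁ V₂ F₁ F₂ α a * glueInl V₁ V₂ F₁ F₂ α b)) : f = g := by
  have h' : f ∘ₗ (mulEquiv hF₁ hF₂ hα hD).toLinearMap =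
      g ∘ₗ (mulEquiv hF₁ hF₂ hα hD).toLinearMap := BalancedTensor.linearMap_ext h
  ext x
  obtain ⟨y, rfl⟩ := (mulEquiv hF₁ hF₂ hα hD).surjective x
  exact DFunLike.congr_fun h' y

theorem fstProj_grp_mul (g : G) (x) : fstProj hF₁ hF₂ hα hD S₂ (Env.grp _ _ g * x) =
    Env.grp V₁ _ g * fstProj hF₁ hF₂ hα hD S₂ x := by
  have h : fstProj hF₁ hF₂ hα hD S₂ ∘ₗ LinearMap.mulLeft k (Env.grp _ _ g) =
      LinearMap.mulLeft k (Env.grp V₁ _ g) ∘ₗ fstProj hF₁ hF₂ hα hD S₂ := by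
    refine linearMap_ext_mul hF₁ hF₂ hα hD fun a b => ?_
    have h := fstProj_mul hF₁ hF₂ hα hD S₂ (Env.grp V₂ _ g * a) b
    rw [map_mul (glueInr _ _ _ _ _), inr_grp, map_mul (CharHopf.grpLift _ _), CharHopf.grpLift_grp,
      mul_assoc, mul_assoc] at h
    rw [LinearMap.comp_apply, LinearMap.mulLeft_apply, h, LinearMap.comp_apply, fstProj_mul]
    rfl
  exact DFunLike.congr_fun h x

theorem sndProj_grp_mul (g : G) (x) : sndProj hF₁ hF₂ hα hD S₁ (Env.grp _ _ g * x) =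
    Env.grp V₂ _ g * sndProj hF₁ hF₂ hα hD S₁ x := by
  have h : sndProj hF₁ hF₂ hα hD S₁ ∘ₗ LinearMap.mulLeft k (Env.grp _ _ g) =
      LinearMap.mulLeft k (Env.grp V₂ _ g) ∘ₗ sndProj hF₁ hF₂ hα hD S₁ := by
    refine linearMap_ext_mul hF₁ hF₂ hα hD fun a b => ?_
    have h := sndProj_mul hF₁ hF₂ hα hD S₁ (Env.grp V₂ _ g * a) b
    rw [map_mul (glueInr _ _ _ _ _), inr_grp, mul_assoc, mul_assoc] at h
    rw [LinearMap.comp_apply, LinearMap.mulLeft_apply, h, LinearMap.comp_apply, sndProj_mul]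
    rfl
  exact DFunLike.congr_fun h x

-- H₁ embeds in H through the retraction, and G embeds in H₁.
include hF₁ hF₂ hα hD S₁ S₂ in
theorem grp_injective : Function.Injective (Env.grp (glueVars V₁ V₂) (glueRel V₁ V₂ F₁ F₂ α)) := by
  intro a b h
  rw [← inl_grp, ← inl_grp] at h
  have h' := congrArg (fstProj hF₁ hF₂ hα hD S₂) h
  rw [fstProj_inl, fstProj_inl] at h'
  exact S₁.grp_injective h'

section Hard

variable [LinearOrder ι₁] [LinearOrder ι₂]
  {D : Type*} [AddCommGroup D] [LinearOrder D] [IsOrderedAddMonoid D]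
  {d : ι₁ ⊕ₗ ι₂ → D} (hd : ∀ i, 0 < d i)

include hd hF₁ hF₂ hα hD

-- A word with a letter of the second family sorts into products g u v with v of smaller degree. The
-- retraction to H₁ kills those with u non-empty and sends the others to g v.
include S₂ in
theorem isHard_map_inl {u : FreeMagma ι₁}
    (hu : IsHard V₁ (polyEmb k G ι₁ '' F₁) (fun i => d (Sum.inlₗ i)) u) :
    IsHard (glueVars V₁ V₂) (glueRel V₁ V₂ F₁ F₂ α) d (FreeMagma.map Sum.inlₗ u) := by
  refine IsHard.map (V := V₁) (V' := glueVars V₁ V₂) (f := Sum.inlₗ) (fun _ => rfl) (fun _ => rfl)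
    (glueInl V₁ V₂ F₁ F₂ α) (inl_gen _ _ _ _ _) Sum.Lex.inl_strictMono d (fstProj hF₁ hF₂ hα hD S₂)
    (fstProj_inl hF₁ hF₂ hα hD S₂) (fstProj_grp_mul hF₁ hF₂ hα hD S₂) ?_ hu
  rintro w ⟨x, hx, hxr⟩
  have hj : ∃ j, Sum.inrₗ j ∈ w := by
    obtain ⟨i, rfl⟩ | ⟨j, rfl⟩ := eq_inlₗ_or_eq_inrₗ x
    · exact absurd ⟨i, rfl⟩ hxr
    · exact ⟨j, hx⟩
  have h := word_mem_span_ordered (V₁ := V₁) (V₂ := V₂) (F₁ := F₁) (F₂ := F₂) (α := α) hd w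
  generalize Env.word _ (glueRel V₁ V₂ F₁ F₂ α) w = z at h
  induction h using Submodule.span_induction with
  | mem z hz =>
    obtain ⟨h, u, v, -, h₂, -, rfl⟩ := hz
    rw [fstProj_grp_mul, fstProj_mul]
    cases u with
    | nil => exact Submodule.subset_span ⟨h, v, h₂ hj, by simp⟩
    | cons j u => simp
  | zero => simp
  | add x y _ _ hx hy => rw [map_add]; exact Submodule.add_mem _ hx hy
  | smul c x _ hx => rw [map_smul]; exact Submodule.smul_mem _ _ hx

include S₁ in
theorem isHard_map_inr {u : FreeMagma ι₂}
    (hu : IsHard V₂ (polyEmb k G ι₂ '' F₂) (fun j => d (Sum.inrₗ j)) u) :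
    IsHard (glueVars V₁ V₂) (glueRel V₁ V₂ F₁ F₂ α) d (FreeMagma.map Sum.inrₗ u) := by
  refine IsHard.map (V := V₂) (V' := glueVars V₁ V₂) (f := Sum.inrₗ) (fun _ => rfl) (fun _ => rfl)
    (glueInr V₁ V₂ F₁ F₂ α) (inr_gen _ _ _ _ _) Sum.Lex.inr_strictMono d (sndProj hF₁ hF₂ hα hD S₁)
    (sndProj_inr hF₁ hF₂ hα hD S₁) (sndProj_grp_mul hF₁ hF₂ hα hD S₁) ?_ hu
  rintro w ⟨x, hx, hxr⟩
  have hi : ∃ i, Sum.inlₗ i ∈ w := by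
    obtain ⟨i, rfl⟩ | ⟨j, rfl⟩ := eq_inlₗ_or_eq_inrₗ x
    · exact ⟨i, hx⟩
    · exact absurd ⟨j, rfl⟩ hxr
  have h := word_mem_span_ordered (V₁ := V₁) (V₂ := V₂) (F₁ := F₁) (F₂ := F₂) (α := α) hd w
  generalize Env.word _ (glueRel V₁ V₂ F₁ F₂ α) w = z at h
  induction h using Submodule.span_induction with
  | mem z hz =>
    obtain ⟨h, u, v, -, -, h₃, rfl⟩ := hz
    rw [sndProj_grp_mul, sndProj_mul]
    cases v with
    | nil => exact Submodule.subset_span ⟨h, u, h₃ hi, by simp⟩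
    | cons j u => simp
  | zero => simp
  | add x y _ _ hx hy => rw [map_add]; exact Submodule.add_mem _ hx hy
  | smul c x _ hx => rw [map_smul]; exact Submodule.smul_mem _ _ hx

end Hard

end Projections

end Glue

/-! ### Skew primitive elements of the glued algebra. -/

section GrpLift

variable {k G ι κ : Type*} [Field k] [CommGroup G] {V : QuantumVars k G ι}
  {F : Set (FreeAlgebra k ι)} {V' : QuantumVars k G κ} {R' : Set (FreeAlgebra k (G ⊕ κ))}

/-- The homomorphism `x ↦ 0`, `g ↦ g` is a coalgebra map. -/
theorem CharHopf.comul_grpLift (S : CharHopf V (polyEmb k G ι '' F)) (S' : CharHopf V' R')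
    (a : Quant V F) : S'.comul (S.grpLift (Env.grpHom V' R') a) =
      Algebra.TensorProduct.map (S.grpLift (Env.grpHom V' R')) (S.grpLift (Env.grpHom V' R'))
        (S.comul a) := by
  have h : S'.comul.comp (S.grpLift (Env.grpHom V' R')) =
      (Algebra.TensorProduct.map (S.grpLift (Env.grpHom V' R'))
        (S.grpLift (Env.grpHom V' R'))).comp S.comul :=
    Env.algHom_ext (fun a => by simp [S.comul_grp, S'.comul_grp])
      (fun i => by simp [S.comul_gen])
  exact DFunLike.congr_fun h a

theorem CharHopf.mem_skewPrim (S : CharHopf V' R') {a : Env V' R'} {h : G}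
    (ha : S.comul a = a ⊗ₜ[k] 1 + Env.grp V' R' h ⊗ₜ[k] a) : a ∈ S.skewPrim :=
  Submodule.subset_span ⟨h, ha⟩

end GrpLift

namespace Glue

variable {k G ι₁ ι₂ : Type*} [Field k] [CommGroup G]
  {V₁ : QuantumVars k G ι₁} {V₂ : QuantumVars k G ι₂} {F₁ : Set (FreeAlgebra k ι₁)}
  {F₂ : Set (FreeAlgebra k ι₂)} {α : ι₁ → ι₂ → k}

variable (hF₁ : ∀ f ∈ F₁, V₁.IsHomogeneous f) (hF₂ : ∀ h ∈ F₂, V₂.IsHomogeneous h)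
  (hα : ∀ i j, V₁.χ i * V₂.χ j ≠ 1 → α i j = 0) (hD : DerivativesVanish V₁ V₂ F₁ F₂ α)
  (S₁ : CharHopf V₁ (polyEmb k G ι₁ '' F₁)) (S₂ : CharHopf V₂ (polyEmb k G ι₂ '' F₂))
  (S : CharHopf (glueVars V₁ V₂) (glueRel V₁ V₂ F₁ F₂ α))

theorem fstProj_grp (g : G) : fstProj hF₁ hF₂ hα hD S₂ (Env.grp _ _ g) = Env.grp V₁ _ g := by
  rw [← inl_grp, fstProj_inl]

theorem sndProj_grp (g : G) : sndProj hF₁ hF₂ hα hD S₁ (Env.grp _ _ g) = Env.grp V₂ _ g := by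
  rw [← inr_grp, sndProj_inr]

theorem fstProj_one : fstProj hF₁ hF₂ hα hD S₂ 1 = 1 := by
  rw [← map_one (glueInl V₁ V₂ F₁ F₂ α), fstProj_inl]

theorem sndProj_one : sndProj hF₁ hF₂ hα hD S₁ 1 = 1 := by
  rw [← map_one (glueInr V₁ V₂ F₁ F₂ α), sndProj_inr]

theorem comul_inr_mul_inl (a b) :
    S.comul (glueInr V₁ V₂ F₁ F₂ α a * glueInl V₁ V₂ F₁ F₂ α b) =
      Algebra.TensorProduct.map (glueInr V₁ V₂ F₁ F₂ α) (glueInr V₁ V₂ F₁ F₂ α) (S₂.comul a) *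
      Algebra.TensorProduct.map (glueInl V₁ V₂ F₁ F₂ α) (glueInl V₁ V₂ F₁ F₂ α) (S₁.comul b) := by
  rw [map_mul, comul_inr α S S₂, comul_inl α S S₁]

theorem map_fstProj_fstProj (x : Quant V₂ F₂ ⊗[k] Quant V₂ F₂) (y : Quant V₁ F₁ ⊗[k] Quant V₁ F₁) :
    TensorProduct.map (fstProj hF₁ hF₂ hα hD S₂) (fstProj hF₁ hF₂ hα hD S₂)
      (Algebra.TensorProduct.map (glueInr V₁ V₂ F₁ F₂ α) (glueInr V₁ V₂ F₁ F₂ α) x *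
        Algebra.TensorProduct.map (glueInl V₁ V₂ F₁ F₂ α) (glueInl V₁ V₂ F₁ F₂ α) y) =
      Algebra.TensorProduct.map (S₂.grpLift (Env.grpHom V₁ (polyEmb k G ι₁ '' F₁))) (S₂.grpLift (Env.grpHom V₁ (polyEmb k G ι₁ '' F₁))) x *
        y := by
  induction x with
  | zero => simp
  | add x x' hx hx' => simp only [map_add, add_mul, hx, hx']
  | tmul a a' =>
    induction y with
    | zero => simp
    | add y y' hy hy' => simp only [map_add, mul_add, hy, hy']
    | tmul b b' => simp [fstProj_mul]

theorem map_sndProj_sndProj (x : Quant V₂ F₂ ⊗[k] Quant V₂ F₂) (y : Quant V₁ F₁ ⊗[k] Quant V₁ F₁) :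
    TensorProduct.map (sndProj hF₁ hF₂ hα hD S₁) (sndProj hF₁ hF₂ hα hD S₁)
      (Algebra.TensorProduct.map (glueInr V₁ V₂ F₁ F₂ α) (glueInr V₁ V₂ F₁ F₂ α) x *
        Algebra.TensorProduct.map (glueInl V₁ V₂ F₁ F₂ α) (glueInl V₁ V₂ F₁ F₂ α) y) =
      x * Algebra.TensorProduct.map (S₁.grpLift (Env.grpHom V₂ (polyEmb k G ι₂ '' F₂)))
        (S₁.grpLift (Env.grpHom V₂ (polyEmb k G ι₂ '' F₂))) y := by
  induction x with
  | zero => simp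
  | add x x' hx hx' => simp only [map_add, add_mul, hx, hx']
  | tmul a a' =>
    induction y with
    | zero => simp
    | add y y' hy hy' => simp only [map_add, mul_add, hy, hy']
    | tmul b b' => simp [sndProj_mul]

theorem map_sndProj_fstProj (x : Quant V₂ F₂ ⊗[k] Quant V₂ F₂) (y : Quant V₁ F₁ ⊗[k] Quant V₁ F₁) :
    TensorProduct.map (sndProj hF₁ hF₂ hα hD S₁) (fstProj hF₁ hF₂ hα hD S₂)
      (Algebra.TensorProduct.map (glueInr V₁ V₂ F₁ F₂ α) (glueInr V₁ V₂ F₁ F₂ α) x *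
        Algebra.TensorProduct.map (glueInl V₁ V₂ F₁ F₂ α) (glueInl V₁ V₂ F₁ F₂ α) y) =
      Algebra.TensorProduct.map (AlgHom.id k _) (S₂.grpLift (Env.grpHom V₁ (polyEmb k G ι₁ '' F₁))) x *
        Algebra.TensorProduct.map (S₁.grpLift (Env.grpHom V₂ (polyEmb k G ι₂ '' F₂))) (AlgHom.id k _) y := by
  induction x with
  | zero => simp
  | add x x' hx hx' => simp only [map_add, add_mul, hx, hx']
  | tmul a a' =>
    induction y with
    | zero => simp
    | add y y' hy hy' => simp only [map_add, mul_add, hy, hy']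
    | tmul b b' => simp [fstProj_mul, sndProj_mul]

-- On products a b the retraction is π(a) b with π the homomorphism killing the variables. Since π
-- is a coalgebra map and Δ is multiplicative, the retraction respects Δ although it is only linear.
include hF₁ hF₂ hα hD in
theorem comul_fstProj (z) : S₁.comul (fstProj hF₁ hF₂ hα hD S₂ z) =
    TensorProduct.map (fstProj hF₁ hF₂ hα hD S₂) (fstProj hF₁ hF₂ hα hD S₂) (S.comul z) := by
  have h : S₁.comul.toLinearMap ∘ₗ fstProj hF₁ hF₂ hα hD S₂ =
      TensorProduct.map (fstProj hF₁ hF₂ hα hD S₂) (fstProj hF₁ hF₂ hα hD S₂) ∘ₗ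
        S.comul.toLinearMap := by
    refine linearMap_ext_mul hF₁ hF₂ hα hD fun a b => ?_
    rw [LinearMap.comp_apply, LinearMap.comp_apply, AlgHom.toLinearMap_apply,
      AlgHom.toLinearMap_apply, comul_inr_mul_inl S₁ S₂ S, map_fstProj_fstProj, fstProj_mul,
      map_mul, CharHopf.comul_grpLift S₂ S₁]
  exact DFunLike.congr_fun h z

theorem comul_sndProj (z) : S₂.comul (sndProj hF₁ hF₂ hα hD S₁ z) =
    TensorProduct.map (sndProj hF₁ hF₂ hα hD S₁) (sndProj hF₁ hF₂ hα hD S₁) (S.comul z) := by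
  have h : S₂.comul.toLinearMap ∘ₗ sndProj hF₁ hF₂ hα hD S₁ =
      TensorProduct.map (sndProj hF₁ hF₂ hα hD S₁) (sndProj hF₁ hF₂ hα hD S₁) ∘ₗ
        S.comul.toLinearMap := by
    refine linearMap_ext_mul hF₁ hF₂ hα hD fun a b => ?_
    rw [LinearMap.comp_apply, LinearMap.comp_apply, AlgHom.toLinearMap_apply,
      AlgHom.toLinearMap_apply, comul_inr_mul_inl S₁ S₂ S, map_sndProj_sndProj, sndProj_mul,
      map_mul, CharHopf.comul_grpLift S₁ S₂]
  exact DFunLike.congr_fun h z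

/-- The map `a ⊗ b ↦ a b` on ordered products, after the group part of `a` is cancelled. -/
def cancelMul : Quant V₂ F₂ ⊗[k] Quant V₁ F₁ →ₗ[k] Glue V₁ V₂ F₁ F₂ α :=
  LinearMap.mul' k _ ∘ₗ TensorProduct.map
    ((glueInr V₁ V₂ F₁ F₂ α).toLinearMap ∘ₗ
      S₂.twist ((Env.grpHom V₂ (polyEmb k G ι₂ '' F₂)).comp (invMonoidHom : G →* G)))
    (glueInl V₁ V₂ F₁ F₂ α).toLinearMap

/-- The component of an element in the span of the ordered products in which both families of
variables occur. -/
def mixedPart : Glue V₁ V₂ F₁ F₂ α →ₗ[k] Glue V₁ V₂ F₁ F₂ α :=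
  cancelMul S₂ ∘ₗ TensorProduct.map
    ((LinearMap.id - (S₂.grpLift (Env.grpHom V₂ (polyEmb k G ι₂ '' F₂))).toLinearMap) ∘ₗ sndProj hF₁ hF₂ hα hD S₁)
    ((LinearMap.id - (S₁.grpLift (Env.grpHom V₁ (polyEmb k G ι₁ '' F₁))).toLinearMap) ∘ₗ fstProj hF₁ hF₂ hα hD S₂) ∘ₗ
    S.comul.toLinearMap

/-- Checked on spanning products u g v of words and a group element. Both sides are 0 if u or v is
empty and give back u g v otherwise. The last summand on the right corrects for the group part,
which both retractions retain. -/
theorem mixedPart_eq (z) : mixedPart hF₁ hF₂ hα hD S₁ S₂ S z =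
    z - glueInl V₁ V₂ F₁ F₂ α (fstProj hF₁ hF₂ hα hD S₂ z) -
      glueInr V₁ V₂ F₁ F₂ α (sndProj hF₁ hF₂ hα hD S₁ z) +
      glueInr V₁ V₂ F₁ F₂ α (S₂.grpLift (Env.grpHom V₂ (polyEmb k G ι₂ '' F₂)) (sndProj hF₁ hF₂ hα hD S₁ z)) := by
  have h : mixedPart hF₁ hF₂ hα hD S₁ S₂ S = LinearMap.id -
      (glueInl V₁ V₂ F₁ F₂ α).toLinearMap ∘ₗ fstProj hF₁ hF₂ hα hD S₂ -
      (glueInr V₁ V₂ F₁ F₂ α).toLinearMap ∘ₗ sndProj hF₁ hF₂ hα hD S₁ +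
      (glueInr V₁ V₂ F₁ F₂ α).toLinearMap ∘ₗ (S₂.grpLift (Env.grpHom V₂ (polyEmb k G ι₂ '' F₂))).toLinearMap ∘ₗ
        sndProj hF₁ hF₂ hα hD S₁ := by
    refine linearMap_ext_mul hF₁ hF₂ hα hD fun a b => ?_
    have ha : a ∈ Submodule.span k {t | ∃ w a, t = Env.word V₂ _ w * Env.grp V₂ _ a} :=
      (Env.span_word_mul_grp V₂ (polyEmb k G ι₂ '' F₂)) ▸ Submodule.mem_top
    have hb : b ∈ Submodule.span k {t | ∃ a w, t = Env.grp V₁ _ a * Env.word V₁ _ w} :=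
      (Env.span_grp_mul_word V₁ (polyEmb k G ι₁ '' F₁)) ▸ Submodule.mem_top
    induction ha using Submodule.span_induction with
    | zero => simp
    | add x y _ _ hx hy => rw [map_add, add_mul, map_add, map_add, hx, hy]
    | smul c x _ hx => rw [map_smul, smul_mul_assoc, map_smul, map_smul, hx]
    | mem x hx =>
      obtain ⟨u, g, rfl⟩ := hx
      induction hb using Submodule.span_induction with
      | zero => simp
      | add x y _ _ hx hy => rw [map_add, mul_add, map_add, map_add, hx, hy]
      | smul c x _ hx => rw [map_smul, mul_smul_comm, map_smul, map_smul, hx]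
      | mem y hy =>
        obtain ⟨g', v, rfl⟩ := hy
        have he : glueInr V₁ V₂ F₁ F₂ α (Env.word V₂ _ u * Env.grp V₂ _ g) *
            glueInl V₁ V₂ F₁ F₂ α (Env.grp V₁ _ g' * Env.word V₁ _ v) =
            glueInr V₁ V₂ F₁ F₂ α (Env.word V₂ _ u * Env.grp V₂ _ (g * g')) *
            glueInl V₁ V₂ F₁ F₂ α (Env.word V₁ _ v) := by
          rw [map_mul, map_mul, map_mul, inr_grp, inr_grp, inl_grp, Env.grp_mul]
          simp only [mul_assoc]
        rw [he]
        generalize g * g' = g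
        -- Of Δ(u) only u ⊗ 1 survives and of Δ(v) only g_v ⊗ v, because the other terms have a
        -- variable on the side where its family is killed.
        have hT : TensorProduct.map (sndProj hF₁ hF₂ hα hD S₁) (fstProj hF₁ hF₂ hα hD S₂)
            (S.comul (glueInr V₁ V₂ F₁ F₂ α (Env.word V₂ _ u * Env.grp V₂ _ g) *
            glueInl V₁ V₂ F₁ F₂ α (Env.word V₁ _ v))) =
            (Env.word V₂ _ u * Env.grp V₂ _ (g * V₁.gWord v)) ⊗ₜ
              (Env.grp V₁ _ g * Env.word V₁ _ v) := by
          rw [comul_inr_mul_inl S₁ S₂ S, map_sndProj_fstProj, map_mul, map_mul,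
            CharHopf.map_grpLift_comul_word, CharHopf.map_grpLift_comul_word',
            S₂.comul_grp, Env.grp_mul]
          simp [mul_assoc]
        have hA : mixedPart hF₁ hF₂ hα hD S₁ S₂ S
            (glueInr V₁ V₂ F₁ F₂ α (Env.word V₂ _ u * Env.grp V₂ _ g) *
            glueInl V₁ V₂ F₁ F₂ α (Env.word V₁ _ v)) = cancelMul S₂
            ((Env.word V₂ _ u * Env.grp V₂ _ (g * V₁.gWord v) - S₂.grpLift (Env.grpHom V₂ (polyEmb k G ι₂ '' F₂))
                (Env.word V₂ _ u * Env.grp V₂ _ (g * V₁.gWord v))) ⊗ₜ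
              (Env.grp V₁ _ g * Env.word V₁ _ v - S₁.grpLift (Env.grpHom V₁ (polyEmb k G ι₁ '' F₁))
                (Env.grp V₁ _ g * Env.word V₁ _ v))) := by
          rw [mixedPart, TensorProduct.map_comp, LinearMap.comp_apply, LinearMap.comp_apply,
            LinearMap.comp_apply, AlgHom.toLinearMap_apply, hT]
          rfl
        rw [hA]
        simp only [LinearMap.add_apply, LinearMap.sub_apply, LinearMap.id_apply,
          LinearMap.comp_apply, AlgHom.toLinearMap_apply, fstProj_mul, sndProj_mul]
        cases u with
        | nil =>
          cases v with
          | nil => simp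
          | cons i v => simp
        | cons j u =>
          cases v with
          | nil => simp
          | cons i v =>
            have h₁ : S₂.grpLift (Env.grpHom V₂ (polyEmb k G ι₂ '' F₂))
                (Env.word V₂ _ (j :: u)) = 0 := S₂.grpLift_word _ (List.cons_ne_nil _ _)
            have h₂ : S₁.grpLift (Env.grpHom V₁ (polyEmb k G ι₁ '' F₁))
                (Env.word V₁ _ (i :: v)) = 0 := S₁.grpLift_word _ (List.cons_ne_nil _ _)
            have h₃ : S₁.grpLift (Env.grpHom V₂ (polyEmb k G ι₂ '' F₂))
                (Env.word V₁ _ (i :: v)) = 0 := S₁.grpLift_word _ (List.cons_ne_nil _ _)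
            have h₄ : S₂.grpLift (Env.grpHom V₁ (polyEmb k G ι₁ '' F₁))
                (Env.word V₂ _ (j :: u)) = 0 := S₂.grpLift_word _ (List.cons_ne_nil _ _)
            -- The twist by inversion strips the group factor g g_v from the left tensor factor. The
            -- factor g is kept on the right, so the product is u g v.
            have h₅ : cancelMul (α := α) S₂
                ((Env.word V₂ _ (j :: u) * Env.grp V₂ _ (g * V₁.gWord (i :: v))) ⊗ₜ
                  (Env.grp V₁ _ g * Env.word V₁ _ (i :: v))) =
                glueInr V₁ V₂ F₁ F₂ α (Env.word V₂ _ (j :: u)) *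
                  glueInl V₁ V₂ F₁ F₂ α (Env.grp V₁ _ g * Env.word V₁ _ (i :: v)) := by
              rw [cancelMul, LinearMap.comp_apply, TensorProduct.map_tmul, LinearMap.mul'_apply,
                LinearMap.comp_apply, CharHopf.twist_word_mul_grp, mul_assoc]
              change glueInr V₁ V₂ F₁ F₂ α (_ * (_ * Env.grp V₂ _ (_)⁻¹)) * _ = _
              rw [Env.grp_mul_grp_inv, mul_one]
              rfl
            simp only [map_mul (CharHopf.grpLift _ _), h₁, h₂, h₃, h₄, zero_mul, mul_zero, sub_zero,
              map_zero, add_zero]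
            rw [h₅, map_mul (glueInl _ _ _ _ _), inl_grp, map_mul (glueInr _ _ _ _ _), inr_grp,
              mul_assoc]
  rw [h]
  rfl

include hF₁ hF₂ hα hD in
/-- The skew primitive elements of the glued algebra. -/
theorem skewPrim_eq : S.skewPrim = S₁.skewPrim.map (glueInl V₁ V₂ F₁ F₂ α).toLinearMap ⊔
    S₂.skewPrim.map (glueInr V₁ V₂ F₁ F₂ α).toLinearMap := by
  apply le_antisymm
  · refine Submodule.span_le.2 ?_
    rintro z ⟨h, hz⟩
    -- In z ⊗ 1 + h ⊗ z one factor of each term retracts into the group, where id - π vanishes.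
    have h0 : mixedPart hF₁ hF₂ hα hD S₁ S₂ S z = 0 := by
      rw [mixedPart, LinearMap.comp_apply, LinearMap.comp_apply, AlgHom.toLinearMap_apply, hz]
      simp [fstProj_one, sndProj_grp]
    have h1 : S₁.comul (fstProj hF₁ hF₂ hα hD S₂ z) = fstProj hF₁ hF₂ hα hD S₂ z ⊗ₜ 1 +
        Env.grp V₁ _ h ⊗ₜ fstProj hF₁ hF₂ hα hD S₂ z := by
      rw [comul_fstProj hF₁ hF₂ hα hD S₁ S₂ S, hz, map_add, TensorProduct.map_tmul,
        TensorProduct.map_tmul, fstProj_one, fstProj_grp]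
    have h2 : S₂.comul (sndProj hF₁ hF₂ hα hD S₁ z) = sndProj hF₁ hF₂ hα hD S₁ z ⊗ₜ 1 +
        Env.grp V₂ _ h ⊗ₜ sndProj hF₁ hF₂ hα hD S₁ z := by
      rw [comul_sndProj hF₁ hF₂ hα hD S₁ S₂ S, hz, map_add, TensorProduct.map_tmul,
        TensorProduct.map_tmul, sndProj_one, sndProj_grp]
    -- The group part occurring in the formula for the mixed part is skew primitive too, with the
    -- same h, because π is a coalgebra map fixing h.
    have h3 : S₂.comul (S₂.grpLift (Env.grpHom V₂ (polyEmb k G ι₂ '' F₂)) (sndProj hF₁ hF₂ hα hD S₁ z)) =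
        S₂.grpLift (Env.grpHom V₂ (polyEmb k G ι₂ '' F₂)) (sndProj hF₁ hF₂ hα hD S₁ z) ⊗ₜ 1 +
        Env.grp V₂ _ h ⊗ₜ S₂.grpLift (Env.grpHom V₂ (polyEmb k G ι₂ '' F₂)) (sndProj hF₁ hF₂ hα hD S₁ z) := by
      rw [CharHopf.comul_grpLift S₂ S₂, h2, map_add, Algebra.TensorProduct.map_tmul,
        Algebra.TensorProduct.map_tmul, map_one, CharHopf.grpLift_grp]
      rfl
    have hz' : z = glueInl V₁ V₂ F₁ F₂ α (fstProj hF₁ hF₂ hα hD S₂ z) +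
        glueInr V₁ V₂ F₁ F₂ α (sndProj hF₁ hF₂ hα hD S₁ z -
          S₂.grpLift (Env.grpHom V₂ (polyEmb k G ι₂ '' F₂)) (sndProj hF₁ hF₂ hα hD S₁ z)) := by
      rw [mixedPart_eq] at h0
      rw [map_sub, ← sub_eq_zero, ← h0]
      abel
    rw [hz']
    exact Submodule.add_mem_sup (Submodule.mem_map_of_mem (S₁.mem_skewPrim h1))
      (Submodule.mem_map_of_mem
        (Submodule.sub_mem _ (S₂.mem_skewPrim h2) (S₂.mem_skewPrim h3)))
  · refine sup_le ?_ ?_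
    · rw [CharHopf.skewPrim, Submodule.map_span, Submodule.span_le]
      rintro _ ⟨a, ⟨h, ha⟩, rfl⟩
      refine S.mem_skewPrim (h := h) ?_
      rw [AlgHom.toLinearMap_apply, comul_inl α S S₁, ha]
      simp
    · rw [CharHopf.skewPrim, Submodule.map_span, Submodule.span_le]
      rintro _ ⟨a, ⟨h, ha⟩, rfl⟩
      refine S.mem_skewPrim (h := h) ?_
      rw [AlgHom.toLinearMap_apply, comul_inr α S S₂, ha]
      simp

end Glue

end

/-! ### The theorem. -/

theorem lemma6p2 {k G D : Type*} [Field k] [CommGroup G]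
    [AddCommGroup D] [LinearOrder D] [IsOrderedAddMonoid D] {m n : ℕ}
    (V₁ : QuantumVars k G (Fin m)) (V₂ : QuantumVars k G (Fin n))
    (F₁ : Set (FreeAlgebra k (Fin m))) (F₂ : Set (FreeAlgebra k (Fin n)))
    (hF₁ : ∀ f ∈ F₁, V₁.IsHomogeneous f) (hF₂ : ∀ h ∈ F₂, V₂.IsHomogeneous h)
    -- the algebras `H₁ = ⟨x₁, …, x_m ‖ F₁⟩` and `H₂` are character Hopf algebras
    (S₁ : CharHopf V₁ (polyEmb k G (Fin m) '' F₁)) (S₂ : CharHopf V₂ (polyEmb k G (Fin n) '' F₂))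
    (α : Fin m → Fin n → k)
    (hp : ∀ i j, V₁.χ i (V₂.g j) * V₂.χ j (V₁.g i) = 1)
    (hα : ∀ i j, V₁.χ i * V₂.χ j ≠ 1 → α i j = 0)
    -- the positive degrees of all the variables
    (d : Fin m ⊕ₗ Fin n → D) (hd : ∀ i, 0 < d i) :
    ∃ S : CharHopf (glueVars V₁ V₂) (glueRel V₁ V₂ F₁ F₂ α),
      ((Function.Injective (Env.grp (glueVars V₁ V₂) (glueRel V₁ V₂ F₁ F₂ α)) ∧
          (∀ u, IsHard V₁ (polyEmb k G (Fin m) '' F₁) (fun i => d (Sum.inlₗ i)) u →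
            IsHard (glueVars V₁ V₂) (glueRel V₁ V₂ F₁ F₂ α) d (FreeMagma.map Sum.inlₗ u)) ∧
          (∀ u, IsHard V₂ (polyEmb k G (Fin n) '' F₂) (fun j => d (Sum.inrₗ j)) u →
            IsHard (glueVars V₁ V₂) (glueRel V₁ V₂ F₁ F₂ α) d (FreeMagma.map Sum.inrₗ u))) ↔
        DerivativesVanish V₁ V₂ F₁ F₂ α) ∧
      (DerivativesVanish V₁ V₂ F₁ F₂ α →
        (∃ e : BalancedTensor V₁ V₂ (polyEmb k G (Fin m) '' F₁) (polyEmb k G (Fin n) '' F₂) ≃ₗ[k]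
              Glue V₁ V₂ F₁ F₂ α,
          (∀ a b, e (BalancedTensor.tmul V₁ V₂ _ _ a b) =
            glueInr V₁ V₂ F₁ F₂ α a * glueInl V₁ V₂ F₁ F₂ α b) ∧
          (∀ g t, e (BalancedTensor.lact V₁ V₂ _ _ g t) = Env.grp _ _ g * e t) ∧
          (∀ g t, e (BalancedTensor.ract V₁ V₂ _ _ g t) = e t * Env.grp _ _ g)) ∧
        S.skewPrim = S₁.skewPrim.map (glueInl V₁ V₂ F₁ F₂ α).toLinearMap ⊔
          S₂.skewPrim.map (glueInr V₁ V₂ F₁ F₂ α).toLinearMap) := by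
  refine ⟨Glue.charHopf α S₁ S₂ hp, ⟨fun h => ?_, fun hD => ⟨?_, fun u hu => ?_, fun u hu => ?_⟩⟩,
    fun hD => ⟨⟨Glue.mulEquiv hF₁ hF₂ hα hD, ?_, ?_, ?_⟩, ?_⟩⟩
  · exact derivativesVanish_of_injective hF₂ S₁ S₂ hp hα (Glue.charHopf α S₁ S₂ hp) h.1
  · exact Glue.grp_injective hF₁ hF₂ hα hD S₁ S₂
  · exact Glue.isHard_map_inl hF₁ hF₂ hα hD S₂ hd hu
  · exact Glue.isHard_map_inr hF₁ hF₂ hα hD S₁ hd hu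
  · exact Glue.mulEquiv_tmul hF₁ hF₂ hα hD
  · exact Glue.mulEquiv_lact hF₁ hF₂ hα hD
  · exact Glue.mulEquiv_ract hF₁ hF₂ hα hD
  · exact Glue.skewPrim_eq hF₁ hF₂ hα hD S₁ S₂ _
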